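/- **Definitions.** A *compact quantum group* is a pair $(A,\Delta)$ of a von Neumann algebra $A$ and a faithful normal unital $*$-homomorphism $\Delta : A \to A \,\overline{\otimes}\, A$ that is co-associative, $(\Delta \otimes \mathrm{id})\Delta = (\mathrm{id} \otimes \Delta)\Delta$, such that there is a faithful normal state $\varphi$ on $A$ with $(\mathrm{id} \otimes \varphi)\Delta(a) = \varphi(a)1 = (\varphi \otimes \mathrm{id})\Delta(a)$ for all $a \in A$. This $\varphi$ is unique and is called the Haar state; $(A,\Delta)$ is of *Kac type* if $\varphi$ is a trace. A *quantum group isomorphism* $(A,\Delta_A) \to (B,\Delta_B)$ is a $*$-isomorphism $\pi : A \to B$ with $\Delta_B \circ \pi = (\pi \otimes \pi) \circ \Delta_A$; $\mathrm{Aut}(A,\Delta_A)$ denotes the group of quantum group automorphisms. A finite dimensional unitary corepresentation of $(A,\Delta)$ is a unitary $X = (X_{ij}) \in A \otimes M_n(\mathbb{C})$ with $\Delta(X_{ij}) = \sum_k X_{ik} \otimes X_{kj}$. Let $\mathcal{A} \subset A$ be the $*$-algebra of their coefficients $X_{ij}$. A *character* of $(A,\Delta)$ is a unital $*$-homomorphism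 $\omega : \mathcal{A} \to \mathbb{C}$, and for $(A,\Delta)$ of Kac type, the *left translation automorphism* $\lambda_\omega$ is the unique automorphism of $A$ with $\lambda_\omega(X_{ij}) = \sum_k \omega(X_{ik}) X_{kj}$ for all such $X$. For $\alpha \in \mathrm{Aut}(A,\Delta)$, $\omega$ is $\alpha$-invariant if $\omega \circ \alpha = \omega$ on $\mathcal{A}$. A Kac type compact quantum group $(A,\Delta_A)$ with Haar state $\varphi_A$ is *strictly rigid relative to* a subgroup $\mathcal{G} < \mathrm{Aut}(A,\Delta_A)$ if the following holds: whenever $(B,\Delta_B)$ is a Kac type compact quantum group with Haar state $\varphi_B$ and $\pi : A \to B$ is a $*$-isomorphism with $\varphi_B \circ \pi = \varphi_A$ such that $\pi \circ \alpha \circ \pi^{-1} \in \mathrm{Aut}(B,\Delta_B)$ for all $\alpha \in \mathcal{G}$, then $\pi = \pi_0 \circ \lambda_\omega$ for some quantum group isomorphism $\pi_0 : (A,\Delta_A) \to (B,\Delta_B)$ and some character $\omega$ of $(A,\Delta_A)$ that is invariant under all $\alpha\in\mathcal{G}$. **Theorem.** Let $G$ be an icc group (every nontrivial element of $G$ has an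 infinite conjugacy class). Let $L(G)$ be its group von Neumann algebra, generated by the left regular unitaries $(u_g)_{g \in G}$ on $\ell^2(G)$, with comultiplication $\Delta_G(u_g) = u_g \otimes u_g$ and canonical trace $\tau(x) = \langle x \delta_e, \delta_e\rangle$. Let $\mathcal{G} < \mathrm{Aut}(G)$ be a countable subgroup that contains all inner automorphisms. Then $(L(G),\Delta_G)$ is a Kac type compact quantum group with Haar state $\tau$, every $\theta \in \mathcal{G}$ gives a quantum group automorphism $\alpha_\theta$ of $(L(G),\Delta_G)$ by $\alpha_\theta(u_g) = u_{\theta(g)}$, and $(L(G),\Delta_G)$ is strictly rigid relative to the group $\{\alpha_\theta \mid \theta \in \mathcal{G}\}$. -/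

import Mathlib

open scoped TensorProduct InnerProductSpace ComplexOrder

universe u v w

noncomputable section

namespace QGroup

/-! ### Hilbert space tensor products and von Neumann algebras -/

section Hilbert

variable {H : Type u} [NormedAddCommGroup H] [InnerProductSpace ℂ H]
variable {K : Type v} [NormedAddCommGroup K] [InnerProductSpace ℂ K]

/-- The Hilbert space tensor product: the completion of the algebraic tensor product. -/
abbrev HTensor (H : Type u) [NormedAddCommGroup H] [InnerProductSpace ℂ H]
    (K : Type v) [NormedAddCommGroup K] [InnerProductSpace ℂ K] : Type (max u v) :=
  UniformSpace.Completion (H ⊗[ℂ] K)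

/-- The elementary tensor `ξ ⊗ η` in the Hilbert space tensor product. -/
def vtmul (ξ : H) (η : K) : HTensor H K := ((ξ ⊗ₜ[ℂ] η : H ⊗[ℂ] K) : HTensor H K)

/-- The bounded operator `S ⊗ T` on the Hilbert space tensor product. -/
def opTensor (S : H →L[ℂ] H) (T : K →L[ℂ] K) : HTensor H K →L[ℂ] HTensor H K :=
  (TensorProduct.mapL S T).completion

theorem opTensor_vtmul (S : H →L[ℂ] H) (T : K →L[ℂ] K) (ξ : H) (η : K) :
    opTensor S T (vtmul ξ η) = vtmul (S ξ) (T η) := by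
  simp [opTensor, vtmul, TensorProduct.mapL_apply]

theorem inner_vtmul (ξ ξ' : H) (η η' : K) :
    ⟪vtmul ξ η, vtmul ξ' η'⟫_ℂ = ⟪ξ, ξ'⟫_ℂ * ⟪η, η'⟫_ℂ := by
  simp [vtmul]

theorem span_vtmul_dense :
    (Submodule.span ℂ (Set.range fun p : H × K => vtmul p.1 p.2)).topologicalClosure = ⊤ := by
  rw [← Submodule.dense_iff_topologicalClosure_eq_top]
  refine (UniformSpace.Completion.denseRange_coe (α := H ⊗[ℂ] K)).mono ?_
  rintro _ ⟨x, rfl⟩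
  induction x using TensorProduct.induction_on with
  | zero => exact Submodule.zero_mem _
  | tmul ξ η => exact Submodule.subset_span ⟨(ξ, η), rfl⟩
  | add x y hx hy =>
    rw [UniformSpace.Completion.coe_add]
    exact Submodule.add_mem _ hx hy

theorem op_ext {L : Type w} [NormedAddCommGroup L] [InnerProductSpace ℂ L]
    {S T : HTensor H K →L[ℂ] L} (h : ∀ ξ η, S (vtmul ξ η) = T (vtmul ξ η)) : S = T := by
  refine ContinuousLinearMap.ext_on
    (Submodule.dense_iff_topologicalClosure_eq_top.mpr span_vtmul_dense) ?_
  rintro _ ⟨p, rfl⟩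
  exact h _ _

theorem vec_ext {x y : HTensor H K} (h : ∀ ξ η, ⟪vtmul ξ η, x⟫_ℂ = ⟪vtmul ξ η, y⟫_ℂ) :
    x = y := by
  refine ext_inner_left ℂ fun z => ?_
  have : innerSL ℂ x = innerSL ℂ y := by
    refine op_ext fun ξ η => ?_
    simpa using congrArg (starRingEnd ℂ) (h ξ η)
  have h2 := congrArg (fun f => starRingEnd ℂ (f z)) this
  simpa using h2

end Hilbert

section VonNeumann

variable {H : Type u} [NormedAddCommGroup H] [InnerProductSpace ℂ H] [CompleteSpace H]
variable {K : Type v} [NormedAddCommGroup K] [InnerProductSpace ℂ K] [CompleteSpace K]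

/-- The *-algebra underlying a von Neumann algebra `M` on the Hilbert space `H`. -/
abbrev Elem (M : VonNeumannAlgebra H) : Type u := M.toStarSubalgebra

/-- The von Neumann algebra generated by a set of operators: the double commutant of its
star-closure. -/
def generated (S : Set (H →L[ℂ] H)) : VonNeumannAlgebra H where
  toStarSubalgebra :=
    StarSubalgebra.centralizer ℂ (StarSubalgebra.centralizer ℂ S : Set (H →L[ℂ] H))
  centralizer_centralizer' := by
    change Set.centralizer (Set.centralizer
      (StarSubalgebra.centralizer ℂ (StarSubalgebra.centralizer ℂ S : Set (H →L[ℂ] H)) :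
        Set (H →L[ℂ] H))) = _
    simp only [StarSubalgebra.coe_centralizer_centralizer]
    rw [Set.centralizer_centralizer_centralizer]
    exact (StarSubalgebra.coe_centralizer_centralizer ℂ S).symm

theorem mem_generated {S : Set (H →L[ℂ] H)} {x : H →L[ℂ] H} :
    x ∈ (generated S).toStarSubalgebra ↔ x ∈ (S ∪ star S).centralizer.centralizer := by
  rw [← StarSubalgebra.coe_centralizer_centralizer ℂ S]
  rfl

theorem subset_generated {S : Set (H →L[ℂ] H)} {x : H →L[ℂ] H} (hx : x ∈ S) :
    x ∈ (generated S).toStarSubalgebra :=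
  mem_generated.mpr (Set.subset_centralizer_centralizer (Or.inl hx))

/-- The von Neumann algebra tensor product `M ⊗̄ N`, acting on the Hilbert space tensor product. -/
def vnTensor (M : VonNeumannAlgebra H) (N : VonNeumannAlgebra K) :
    VonNeumannAlgebra (HTensor H K) :=
  generated {x | ∃ a ∈ M, ∃ b ∈ N, x = opTensor a b}

/-- The elementary tensor `a ⊗ b ∈ M ⊗̄ N`. -/
def tmul {M : VonNeumannAlgebra H} {N : VonNeumannAlgebra K} (a : Elem M) (b : Elem N) :
    Elem (vnTensor M N) :=
  ⟨opTensor (a : H →L[ℂ] H) (b : K →L[ℂ] K), subset_generated ⟨a, a.2, b, b.2, rfl⟩⟩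

/-- Normal (ultraweakly continuous) functionals `x ↦ ∑ₙ ⟪ξₙ, x ηₙ⟫` with
`∑ₙ ‖ξₙ‖² < ∞` and `∑ₙ ‖ηₙ‖² < ∞`. -/
def IsNormalFunctional (M : VonNeumannAlgebra H) (ω : Elem M →ₗ[ℂ] ℂ) : Prop :=
  ∃ ξ η : ℕ → H, Summable (fun n => ‖ξ n‖ ^ 2) ∧ Summable (fun n => ‖η n‖ ^ 2) ∧
    ∀ x : Elem M, HasSum (fun n => ⟪ξ n, (x : H →L[ℂ] H) (η n)⟫_ℂ) (ω x)

/-- Normal (ultraweakly continuous) linear maps between von Neumann algebras. -/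
def IsNormalMap {M : VonNeumannAlgebra H} {N : VonNeumannAlgebra K}
    (f : Elem M →ₗ[ℂ] Elem N) : Prop :=
  ∀ ω : Elem N →ₗ[ℂ] ℂ, IsNormalFunctional N ω → IsNormalFunctional M (ω ∘ₗ f)

/-- Normal *-homomorphisms between von Neumann algebras. -/
def IsNormalHom {M : VonNeumannAlgebra H} {N : VonNeumannAlgebra K}
    (f : Elem M →⋆ₐ[ℂ] Elem N) : Prop :=
  IsNormalMap (f.toAlgHom.toLinearMap)

/-- `φ` is a faithful normal state on `M`. -/
structure IsFaithfulNormalState (M : VonNeumannAlgebra H) (φ : Elem M →ₗ[ℂ] ℂ) : Prop where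
  normal : IsNormalFunctional M φ
  map_one : φ 1 = 1
  nonneg : ∀ a, 0 ≤ φ (star a * a)
  faithful : ∀ a, φ (star a * a) = 0 → a = 0

/-- `R` is the slice map `id ⊗ φ : M ⊗̄ N → M`, i.e. the unique normal linear map with
`(id ⊗ φ)(a ⊗ b) = φ(b) a`. -/
def IsSliceRight {M : VonNeumannAlgebra H} {N : VonNeumannAlgebra K} (φ : Elem N →ₗ[ℂ] ℂ)
    (R : Elem (vnTensor M N) →ₗ[ℂ] Elem M) : Prop :=
  IsNormalMap R ∧ ∀ a b, R (tmul a b) = φ b • a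

/-- `L` is the slice map `φ ⊗ id : M ⊗̄ N → N`, i.e. the unique normal linear map with
`(φ ⊗ id)(a ⊗ b) = φ(a) b`. -/
def IsSliceLeft {M : VonNeumannAlgebra H} {N : VonNeumannAlgebra K} (φ : Elem M →ₗ[ℂ] ℂ)
    (L : Elem (vnTensor M N) →ₗ[ℂ] Elem N) : Prop :=
  IsNormalMap L ∧ ∀ a b, L (tmul a b) = φ a • b

end VonNeumann

section TensorHom

variable {H₁ : Type*} [NormedAddCommGroup H₁] [InnerProductSpace ℂ H₁] [CompleteSpace H₁]
  {H₂ : Type*} [NormedAddCommGroup H₂] [InnerProductSpace ℂ H₂] [CompleteSpace H₂]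
  {K₁ : Type*} [NormedAddCommGroup K₁] [InnerProductSpace ℂ K₁] [CompleteSpace K₁]
  {K₂ : Type*} [NormedAddCommGroup K₂] [InnerProductSpace ℂ K₂] [CompleteSpace K₂]
  {M₁ : VonNeumannAlgebra H₁} {M₂ : VonNeumannAlgebra H₂}
  {N₁ : VonNeumannAlgebra K₁} {N₂ : VonNeumannAlgebra K₂}

/-- `Φ` is the *-homomorphism `α ⊗ β : M₁ ⊗̄ M₂ → N₁ ⊗̄ N₂`, i.e. the unique normal
*-homomorphism with `(α ⊗ β)(a ⊗ b) = α(a) ⊗ β(b)`. -/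
def IsTensorHom (α : Elem M₁ →⋆ₐ[ℂ] Elem N₁) (β : Elem M₂ →⋆ₐ[ℂ] Elem N₂)
    (Φ : Elem (vnTensor M₁ M₂) →⋆ₐ[ℂ] Elem (vnTensor N₁ N₂)) : Prop :=
  IsNormalHom Φ ∧ ∀ a b, Φ (tmul a b) = tmul (α a) (β b)

end TensorHom

/-! ### Compact quantum groups -/

section CQG

variable {H : Type u} [NormedAddCommGroup H] [InnerProductSpace ℂ H] [CompleteSpace H]
variable {K : Type v} [NormedAddCommGroup K] [InnerProductSpace ℂ K] [CompleteSpace K]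

/-- Co-associativity `(Δ ⊗ id)Δ = (id ⊗ Δ)Δ`, where `assoc` is the canonical identification
`(M ⊗̄ M) ⊗̄ M = M ⊗̄ (M ⊗̄ M)`. -/
def IsCoassociative {M : VonNeumannAlgebra H} (Δ : Elem M →⋆ₐ[ℂ] Elem (vnTensor M M)) : Prop :=
  ∃ (Δl : Elem (vnTensor M M) →⋆ₐ[ℂ] Elem (vnTensor (vnTensor M M) M))
    (Δr : Elem (vnTensor M M) →⋆ₐ[ℂ] Elem (vnTensor M (vnTensor M M)))
    (assoc : Elem (vnTensor (vnTensor M M) M) →⋆ₐ[ℂ] Elem (vnTensor M (vnTensor M M))),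
    IsTensorHom Δ (StarAlgHom.id ℂ (Elem M)) Δl ∧
    IsTensorHom (StarAlgHom.id ℂ (Elem M)) Δ Δr ∧
    (IsNormalHom assoc ∧ ∀ a b c, assoc (tmul (tmul a b) c) = tmul a (tmul b c)) ∧
    ∀ a, assoc (Δl (Δ a)) = Δr (Δ a)

/-- `φ` is a Haar state of `(M, Δ)`: a faithful normal state with
`(id ⊗ φ)Δ(a) = φ(a) 1 = (φ ⊗ id)Δ(a)`. -/
def IsHaarState {M : VonNeumannAlgebra H} (Δ : Elem M →⋆ₐ[ℂ] Elem (vnTensor M M))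
    (φ : Elem M →ₗ[ℂ] ℂ) : Prop :=
  IsFaithfulNormalState M φ ∧
  ∃ R L : Elem (vnTensor M M) →ₗ[ℂ] Elem M, IsSliceRight φ R ∧ IsSliceLeft φ L ∧
    ∀ a, R (Δ a) = φ a • 1 ∧ L (Δ a) = φ a • 1

/-- `(M, Δ)` is a compact quantum group. -/
structure IsCompactQuantumGroup {M : VonNeumannAlgebra H}
    (Δ : Elem M →⋆ₐ[ℂ] Elem (vnTensor M M)) : Prop where
  injective : Function.Injective Δ
  normal : IsNormalHom Δ
  coassociative : IsCoassociative Δ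
  exists_haar : ∃ φ, IsHaarState Δ φ

/-- `(M, Δ)` is a compact quantum group of Kac type with (tracial) Haar state `φ`. -/
structure IsKacQuantumGroup {M : VonNeumannAlgebra H}
    (Δ : Elem M →⋆ₐ[ℂ] Elem (vnTensor M M)) (φ : Elem M →ₗ[ℂ] ℂ) : Prop where
  isCompactQuantumGroup : IsCompactQuantumGroup Δ
  isHaarState : IsHaarState Δ φ
  tracial : ∀ a b, φ (a * b) = φ (b * a)

/-- The *-isomorphism `π` is an isomorphism of quantum groups: `Δ_N ∘ π = (π ⊗ π) ∘ Δ_M`. -/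
def IsQuantumGroupIso {M : VonNeumannAlgebra H} {N : VonNeumannAlgebra K}
    (ΔM : Elem M →⋆ₐ[ℂ] Elem (vnTensor M M)) (ΔN : Elem N →⋆ₐ[ℂ] Elem (vnTensor N N))
    (π : Elem M ≃⋆ₐ[ℂ] Elem N) : Prop :=
  ∃ ππ : Elem (vnTensor M M) →⋆ₐ[ℂ] Elem (vnTensor N N),
    IsTensorHom π.toStarAlgHom π.toStarAlgHom ππ ∧ ∀ a, ΔN (π a) = ππ (ΔM a)

/-- `X ∈ M ⊗ Mₙ(ℂ)` is a (finite dimensional) unitary corepresentation of `(M, Δ)`. -/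
def IsUnitaryCorep {M : VonNeumannAlgebra H} (Δ : Elem M →⋆ₐ[ℂ] Elem (vnTensor M M))
    {n : ℕ} (X : Matrix (Fin n) (Fin n) (Elem M)) : Prop :=
  X ∈ unitary (Matrix (Fin n) (Fin n) (Elem M)) ∧
    ∀ i j, Δ (X i j) = ∑ k, tmul (X i k) (X k j)

/-- The *-algebra of coefficients of finite dimensional unitary corepresentations. (For a
compact quantum group of Kac type it is also the linear span of these coefficients.) -/
def coeffAlgebra {M : VonNeumannAlgebra H} (Δ : Elem M →⋆ₐ[ℂ] Elem (vnTensor M M)) :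
    StarSubalgebra ℂ (Elem M) :=
  StarAlgebra.adjoin ℂ {a | ∃ (n : ℕ) (X : Matrix (Fin n) (Fin n) (Elem M)),
    IsUnitaryCorep Δ X ∧ ∃ i j, a = X i j}

theorem IsUnitaryCorep.mem_coeffAlgebra {M : VonNeumannAlgebra H}
    {Δ : Elem M →⋆ₐ[ℂ] Elem (vnTensor M M)} {n : ℕ} {X : Matrix (Fin n) (Fin n) (Elem M)}
    (hX : IsUnitaryCorep Δ X) (i j : Fin n) : X i j ∈ coeffAlgebra Δ :=
  StarAlgebra.subset_adjoin ℂ _ ⟨n, X, hX, i, j, rfl⟩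

/-- Characters of `(M, Δ)`: unital *-homomorphisms from the coefficient algebra to `ℂ`. -/
abbrev QChar {M : VonNeumannAlgebra H} (Δ : Elem M →⋆ₐ[ℂ] Elem (vnTensor M M)) : Type u :=
  coeffAlgebra Δ →⋆ₐ[ℂ] ℂ

/-- `lam` is the left translation automorphism `λ_ω = (ω ⊗ id)Δ` given by the character `ω`,
i.e. the unique automorphism of `M` with `λ_ω(X_ij) = ∑ₖ ω(X_ik) X_kj` for every finite
dimensional unitary corepresentation `X`. -/
def IsLeftTranslation {M : VonNeumannAlgebra H} (Δ : Elem M →⋆ₐ[ℂ] Elem (vnTensor M M))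
    (ω : QChar Δ) (lam : Elem M ≃⋆ₐ[ℂ] Elem M) : Prop :=
  ∀ (n : ℕ) (X : Matrix (Fin n) (Fin n) (Elem M)) (hX : IsUnitaryCorep Δ X) (i j : Fin n),
    lam (X i j) = ∑ k, ω ⟨X i k, hX.mem_coeffAlgebra i k⟩ • X k j

/-- The character `ω` is invariant under the automorphism `α`: `ω ∘ α = ω`. -/
def IsInvariantChar {M : VonNeumannAlgebra H} {Δ : Elem M →⋆ₐ[ℂ] Elem (vnTensor M M)}
    (ω : QChar Δ) (α : Elem M ≃⋆ₐ[ℂ] Elem M) : Prop :=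
  ∀ a : coeffAlgebra Δ, ∃ h : α a ∈ coeffAlgebra Δ, ω ⟨α a, h⟩ = ω a

/-- Strict rigidity of the Kac type compact quantum group `(M, Δ)` with Haar state `φ` relative
to a group `Γ` of quantum group automorphisms: if `(N, ΔN)` is any Kac type compact quantum
group with Haar state `φN` and `π : M → N` is any state preserving *-isomorphism such that
`π ∘ α ∘ π⁻¹` is a quantum group automorphism for all `α ∈ Γ`, then `π = π₀ ∘ λ_ω` for some
quantum group isomorphism `π₀` and some `Γ`-invariant character `ω`.
The universe `v` is that of the Hilbert space on which `N` acts. -/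
def IsStrictlyRigid {M : VonNeumannAlgebra H} (Δ : Elem M →⋆ₐ[ℂ] Elem (vnTensor M M))
    (φ : Elem M →ₗ[ℂ] ℂ) (Γ : Subgroup (Elem M ≃⋆ₐ[ℂ] Elem M)) : Prop :=
  ∀ (K : Type v) [NormedAddCommGroup K] [InnerProductSpace ℂ K] [CompleteSpace K]
    (N : VonNeumannAlgebra K) (ΔN : Elem N →⋆ₐ[ℂ] Elem (vnTensor N N)) (φN : Elem N →ₗ[ℂ] ℂ),
    IsKacQuantumGroup ΔN φN →
    ∀ π : Elem M ≃⋆ₐ[ℂ] Elem N, (∀ a, φN (π a) = φ a) →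
      (∀ α ∈ Γ, IsQuantumGroupIso ΔN ΔN ((π.symm.trans α).trans π)) →
      ∃ (π₀ : Elem M ≃⋆ₐ[ℂ] Elem N) (ω : QChar Δ) (lam : Elem M ≃⋆ₐ[ℂ] Elem M),
        IsQuantumGroupIso Δ ΔN π₀ ∧ (∀ α ∈ Γ, IsInvariantChar ω α) ∧
        IsLeftTranslation Δ ω lam ∧ ∀ a, π a = π₀ (lam a)

end CQG

/-! ### The group von Neumann algebra and its comultiplication -/

theorem basis_op_ext {E : Type u} [NormedAddCommGroup E] [InnerProductSpace ℂ E] {ι : Type v}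
    (b : HilbertBasis ι ℂ E) {S T : E →L[ℂ] E} (h : ∀ i, S (b i) = T (b i)) :
    S = T := by
  refine ContinuousLinearMap.ext_on
    (Submodule.dense_iff_topologicalClosure_eq_top.mpr b.dense_span) ?_
  rintro _ ⟨i, rfl⟩
  exact h i

section Perm

variable {H : Type u} [NormedAddCommGroup H] [InnerProductSpace ℂ H] [CompleteSpace H]
  {ι : Type v}

/-- The unitary permuting the vectors of a Hilbert basis. -/
def permUnitary (b : HilbertBasis ι ℂ H) (e : Equiv.Perm ι) : H ≃ₗᵢ[ℂ] H :=
  b.repr.trans (HilbertBasis.mk (b.orthonormal.comp e e.injective) (by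
    rw [Set.range_comp, e.surjective.range_eq, Set.image_univ, b.dense_span])).repr.symm

theorem permUnitary_apply (b : HilbertBasis ι ℂ H) (e : Equiv.Perm ι) (i : ι) :
    permUnitary b e (b i) = b (e i) := by
  classical
  simp only [permUnitary, LinearIsometryEquiv.trans_apply, b.repr_self]
  rw [HilbertBasis.repr_symm_single]
  simp

theorem permUnitary_symm_apply (b : HilbertBasis ι ℂ H) (e : Equiv.Perm ι) (i : ι) :
    (permUnitary b e).symm (b i) = b (e.symm i) := by
  rw [LinearIsometryEquiv.symm_apply_eq, permUnitary_apply]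
  simp

end Perm

section Amplification

variable {H : Type u} [NormedAddCommGroup H] [InnerProductSpace ℂ H] [CompleteSpace H]
variable {K : Type v} [NormedAddCommGroup K] [InnerProductSpace ℂ K] [CompleteSpace K]

theorem inner_opTensor_right (S : H →L[ℂ] H) (T : K →L[ℂ] K) (x y : HTensor H K) :
    ⟪x, opTensor S T y⟫_ℂ = ⟪opTensor (star S) (star T) x, y⟫_ℂ := by
  have : ContinuousLinearMap.adjoint (opTensor S T) = opTensor (star S) (star T) := by
    refine op_ext fun ξ η => vec_ext fun ξ' η' => ?_
    rw [ContinuousLinearMap.adjoint_inner_right, opTensor_vtmul, opTensor_vtmul, inner_vtmul,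
      inner_vtmul]
    simp only [ContinuousLinearMap.star_eq_adjoint, ContinuousLinearMap.adjoint_inner_right]
  rw [← this, ContinuousLinearMap.adjoint_inner_left]

variable (K) in
/-- The amplification `a ↦ a ⊗ 1`. -/
def amplify : (H →L[ℂ] H) →⋆ₐ[ℂ] (HTensor H K →L[ℂ] HTensor H K) where
  toFun a := opTensor a 1
  map_one' := op_ext fun ξ η => by simp [opTensor_vtmul]
  map_mul' a b := op_ext fun ξ η => by simp [opTensor_vtmul]
  map_zero' := op_ext fun ξ η => by
    rw [opTensor_vtmul]
    simp [vtmul]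
  map_add' a b := op_ext fun ξ η => by
    rw [_root_.add_apply, opTensor_vtmul, opTensor_vtmul, opTensor_vtmul]
    simp [vtmul, TensorProduct.add_tmul, UniformSpace.Completion.coe_add]
  commutes' r := op_ext fun ξ η => by
    rw [opTensor_vtmul]
    simp [vtmul, Algebra.algebraMap_eq_smul_one, ← TensorProduct.smul_tmul',
      UniformSpace.Completion.coe_smul]
  map_star' a := by
    refine ContinuousLinearMap.ext fun y => ext_inner_left ℂ fun x => ?_
    rw [ContinuousLinearMap.star_eq_adjoint (opTensor a 1),
      ContinuousLinearMap.adjoint_inner_right, inner_opTensor_right, star_star, star_one]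

theorem amplify_vtmul (a : H →L[ℂ] H) (ξ : H) (η : K) :
    amplify K a (vtmul ξ η) = vtmul (a ξ) η := by
  change opTensor a 1 (vtmul ξ η) = _
  rw [opTensor_vtmul]
  rfl

/-- The operator `ξ ↦ ξ ⊗ η`. -/
def creation {H : Type u} [NormedAddCommGroup H] [InnerProductSpace ℂ H]
    {K : Type v} [NormedAddCommGroup K] [InnerProductSpace ℂ K] (η : K) : H →L[ℂ] HTensor H K :=
  UniformSpace.Completion.toComplL ∘L (TensorProduct.mkL ℂ H K).flip η

theorem creation_apply {H : Type u} [NormedAddCommGroup H] [InnerProductSpace ℂ H]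
    {K : Type v} [NormedAddCommGroup K] [InnerProductSpace ℂ K] (ξ : H) (η : K) : creation η ξ = vtmul ξ η := rfl

theorem amplify_mem_generated {S : Set (H →L[ℂ] H)}
    {T : Set (HTensor H K →L[ℂ] HTensor H K)}
    (h : ∀ s ∈ S, amplify K s ∈ (generated T).toStarSubalgebra)
    {x : H →L[ℂ] H} (hx : x ∈ (generated S).toStarSubalgebra) :
    amplify K x ∈ (generated T).toStarSubalgebra := by
  rw [mem_generated] at hx ⊢
  intro y hy
  have h' : ∀ s ∈ S ∪ star S, y * amplify K s = amplify K s * y := by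
    rintro s (hs | hs)
    · exact mem_generated.mp (h s hs) y hy
    · have := mem_generated.mp (star_mem (h (star s) hs)) y hy
      rwa [← map_star, star_star] at this
  have key : ∀ (s : H →L[ℂ] H) (ξ ξ' : H) (η η' : K),
      ⟪vtmul ξ η, (y * amplify K s) (vtmul ξ' η')⟫_ℂ =
        ⟪ξ, (((creation η).adjoint ∘L y ∘L creation η') * s) ξ'⟫_ℂ := by
    intro s ξ ξ' η η'
    simp [amplify_vtmul, ContinuousLinearMap.adjoint_inner_right, creation_apply]
  have key' : ∀ (s : H →L[ℂ] H) (ξ ξ' : H) (η η' : K),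
      ⟪vtmul ξ η, (amplify K s * y) (vtmul ξ' η')⟫_ℂ =
        ⟪ξ, (s * ((creation η).adjoint ∘L y ∘L creation η')) ξ'⟫_ℂ := by
    intro s ξ ξ' η η'
    have e : amplify K s = star (amplify K (star s)) := by rw [← map_star, star_star]
    rw [mul_apply_eq_comp, e, ContinuousLinearMap.star_eq_adjoint,
      ContinuousLinearMap.adjoint_inner_right, amplify_vtmul, ← creation_apply,
      ← ContinuousLinearMap.adjoint_inner_right, ContinuousLinearMap.star_eq_adjoint,
      ContinuousLinearMap.adjoint_inner_left]
    rfl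
  refine op_ext fun ξ' η' => vec_ext fun ξ η => ?_
  rw [key, key']
  congr 2
  refine hx _ ?_
  intro s hs
  refine ContinuousLinearMap.ext fun ξ' => ext_inner_left ℂ fun ξ => ?_
  rw [← key, ← key', h' s hs]

theorem map_mem_generated (Φ : (H →L[ℂ] H) ≃⋆ₐ[ℂ] (K →L[ℂ] K)) {S : Set (H →L[ℂ] H)}
    {T : Set (K →L[ℂ] K)} (h : ∀ s ∈ S, Φ s ∈ (generated T).toStarSubalgebra)
    {x : H →L[ℂ] H} (hx : x ∈ (generated S).toStarSubalgebra) :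
    Φ x ∈ (generated T).toStarSubalgebra := by
  rw [mem_generated] at hx ⊢
  intro y hy
  have hstar : ∀ s, Φ (star s) = star (Φ s) := fun s => Φ.map_star' s
  have hmul : ∀ s t, Φ (s * t) = Φ s * Φ t := fun s t => Φ.map_mul' s t
  have h' : ∀ s ∈ S ∪ star S, y * Φ s = Φ s * y := by
    rintro s (hs | hs)
    · exact mem_generated.mp (h s hs) y hy
    · have := mem_generated.mp (star_mem (h (star s) hs)) y hy
      rwa [← hstar, star_star] at this
  have := hx (Φ.symm y) fun s hs => by
    refine EquivLike.injective Φ ?_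
    rw [hmul, hmul, StarAlgEquiv.apply_symm_apply, h' s hs]
  have h2 := congrArg Φ this
  rwa [hmul, hmul, StarAlgEquiv.apply_symm_apply] at h2

end Amplification

section Group

variable (G : Type u)

/-- The Hilbert space `ℓ²(G)`. -/
abbrev L2 : Type u := lp (fun _ : G => ℂ) 2

/-- The canonical basis `(δ_g)` of `ℓ²(G)`. -/
def delta : HilbertBasis G ℂ (L2 G) := HilbertBasis.ofRepr (LinearIsometryEquiv.refl ℂ _)

theorem delta2_total {x : HTensor (L2 G) (L2 G)}
    (hx : ∀ g h, ⟪x, vtmul (delta G g) (delta G h)⟫_ℂ = 0) : x = 0 := by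
  have h1 : ∀ (ξ : L2 G) (h : G), ⟪x, vtmul ξ (delta G h)⟫_ℂ = 0 := by
    intro ξ h
    have : innerSL ℂ x ∘L creation (delta G h) = 0 := by
      refine ContinuousLinearMap.ext_on
        (Submodule.dense_iff_topologicalClosure_eq_top.mpr (delta G).dense_span) ?_
      rintro _ ⟨g, rfl⟩
      exact hx g h
    exact congrArg (fun f => f ξ) this
  have h2 : ∀ ξ η : L2 G, ⟪x, vtmul ξ η⟫_ℂ = 0 := by
    intro ξ η
    have : innerSL ℂ x ∘L
        (UniformSpace.Completion.toComplL ∘L TensorProduct.mkL ℂ (L2 G) (L2 G) ξ) = 0 := by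
      refine ContinuousLinearMap.ext_on
        (Submodule.dense_iff_topologicalClosure_eq_top.mpr (delta G).dense_span) ?_
      rintro _ ⟨h, rfl⟩
      exact h1 ξ h
    exact congrArg (fun f => f η) this
  refine vec_ext fun ξ η => ?_
  rw [inner_zero_right, ← inner_conj_symm, h2, map_zero]

theorem delta2_orthonormal :
    Orthonormal ℂ fun p : G × G => vtmul (delta G p.1) (delta G p.2) :=
  ((delta G).orthonormal.tmul (delta G).orthonormal).comp_linearIsometry
    UniformSpace.Completion.toComplₗᵢ

/-- The orthonormal basis `(δ_g ⊗ δ_h)` of `ℓ²(G) ⊗ ℓ²(G)`. -/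
def delta2 : HilbertBasis (G × G) ℂ (HTensor (L2 G) (L2 G)) :=
  HilbertBasis.mkOfOrthogonalEqBot (delta2_orthonormal G) (by
    rw [Submodule.eq_bot_iff]
    intro x hx
    exact delta2_total G fun g h =>
      (Submodule.mem_orthogonal' _ _).mp hx _ (Submodule.subset_span ⟨(g, h), rfl⟩))

theorem delta2_apply (g h : G) : delta2 G (g, h) = vtmul (delta G g) (delta G h) := by
  classical
  rw [delta2, HilbertBasis.coe_mkOfOrthogonalEqBot]

variable {G} [Group G]

/-- The left regular representation as unitaries: `u_g δ_h = δ_{gh}`. -/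
def leftReg (g : G) : L2 G →L[ℂ] L2 G :=
  (permUnitary (delta G) (Equiv.mulLeft g)).toContinuousLinearEquiv

theorem leftReg_apply (g h : G) : leftReg g (delta G h) = delta G (g * h) :=
  permUnitary_apply (delta G) (Equiv.mulLeft g) h

variable (G)

/-- The group von Neumann algebra `L(G)`, generated by the left regular representation. -/
def groupVN : VonNeumannAlgebra (L2 G) := generated (Set.range leftReg)

variable {G}

/-- The canonical unitaries `u_g ∈ L(G)`. -/
def canonicalUnitary (g : G) : Elem (groupVN G) := ⟨leftReg g, subset_generated ⟨g, rfl⟩⟩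

variable (G)

/-- The canonical trace `τ(x) = ⟪δ_e, x δ_e⟫` on `L(G)`. -/
def groupTrace : Elem (groupVN G) →ₗ[ℂ] ℂ where
  toFun x := ⟪delta G 1, (x : L2 G →L[ℂ] L2 G) (delta G 1)⟫_ℂ
  map_add' x y := by simp
  map_smul' c x := by simp

/-- The unitary `W (δ_g ⊗ δ_h) = δ_g ⊗ δ_{gh}` on `ℓ²(G) ⊗ ℓ²(G)`. -/
def groupW : HTensor (L2 G) (L2 G) ≃ₗᵢ[ℂ] HTensor (L2 G) (L2 G) :=
  permUnitary (delta2 G) (Equiv.prodShear (Equiv.refl G) Equiv.mulLeft)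

theorem groupW_conj_leftReg (g : G) :
    (groupW G).conjStarAlgEquiv (amplify (L2 G) (leftReg g)) = opTensor (leftReg g) (leftReg g) := by
  refine basis_op_ext (delta2 G) ?_
  rintro ⟨h, k⟩
  rw [LinearIsometryEquiv.conjStarAlgEquiv_apply_apply, groupW, permUnitary_symm_apply,
    Equiv.prodShear_symm_apply, delta2_apply, amplify_vtmul, leftReg_apply, ← delta2_apply,
    permUnitary_apply, delta2_apply, delta2_apply, opTensor_vtmul, leftReg_apply, leftReg_apply]
  simp

theorem groupComul_mem (x : Elem (groupVN G)) :
    (groupW G).conjStarAlgEquiv (amplify (L2 G) (x : L2 G →L[ℂ] L2 G)) ∈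
      (vnTensor (groupVN G) (groupVN G)).toStarSubalgebra := by
  refine map_mem_generated (groupW G).conjStarAlgEquiv
    (S := amplify (L2 G) '' Set.range (leftReg (G := G))) ?_ ?_
  · rintro _ ⟨_, ⟨g, rfl⟩, rfl⟩
    rw [groupW_conj_leftReg]
    exact (tmul (canonicalUnitary g) (canonicalUnitary g)).2
  · refine amplify_mem_generated (S := Set.range leftReg) (fun s hs => ?_) x.2
    exact subset_generated ⟨s, hs, rfl⟩

/-- The comultiplication `Δ_G : L(G) → L(G) ⊗̄ L(G)`, `Δ_G(x) = W (x ⊗ 1) W*`. It satisfies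
`Δ_G(u_g) = u_g ⊗ u_g`. -/
def groupComul : Elem (groupVN G) →⋆ₐ[ℂ] Elem (vnTensor (groupVN G) (groupVN G)) :=
  StarAlgHom.codRestrict
    (((groupW G).conjStarAlgEquiv.toStarAlgHom.comp (amplify (L2 G))).comp
      (groupVN G).toStarSubalgebra.subtype)
    (vnTensor (groupVN G) (groupVN G)).toStarSubalgebra (groupComul_mem G)

theorem groupComul_canonicalUnitary (g : G) :
    groupComul G (canonicalUnitary g) = tmul (canonicalUnitary g) (canonicalUnitary g) :=
  Subtype.ext (groupW_conj_leftReg G g)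

variable {G}

/-- The unitary `δ_g ↦ δ_{θ(g)}` given by a group automorphism `θ`. -/
def autUnitary (θ : MulAut G) : L2 G ≃ₗᵢ[ℂ] L2 G := permUnitary (delta G) θ.toEquiv

theorem autUnitary_conj_leftReg (θ : MulAut G) (g : G) :
    (autUnitary θ).conjStarAlgEquiv (leftReg g) = leftReg (θ g) := by
  refine basis_op_ext (delta G) fun h => ?_
  rw [LinearIsometryEquiv.conjStarAlgEquiv_apply_apply, autUnitary, permUnitary_symm_apply,
    leftReg_apply, permUnitary_apply, leftReg_apply]
  simp

theorem autUnitary_conj_mem (θ : MulAut G) {x : L2 G →L[ℂ] L2 G}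
    (hx : x ∈ (groupVN G).toStarSubalgebra) :
    (autUnitary θ).conjStarAlgEquiv x ∈ (groupVN G).toStarSubalgebra := by
  refine map_mem_generated _ ?_ hx
  rintro _ ⟨g, rfl⟩
  rw [autUnitary_conj_leftReg]
  exact (canonicalUnitary (θ g)).2

theorem autUnitary_conj_mul (θ θ' : MulAut G) (x : L2 G →L[ℂ] L2 G) :
    (autUnitary (θ * θ')).conjStarAlgEquiv x =
      (autUnitary θ).conjStarAlgEquiv ((autUnitary θ').conjStarAlgEquiv x) := by
  have h1 : ∀ y : L2 G, autUnitary (θ * θ') y = autUnitary θ (autUnitary θ' y) := by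
    intro y
    have : ((autUnitary (θ * θ')).toContinuousLinearEquiv : L2 G →L[ℂ] L2 G) =
        ((autUnitary θ).toContinuousLinearEquiv : L2 G →L[ℂ] L2 G) ∘L
          ((autUnitary θ').toContinuousLinearEquiv : L2 G →L[ℂ] L2 G) := by
      refine basis_op_ext (delta G) fun g => ?_
      change permUnitary (delta G) _ (delta G g) =
        permUnitary (delta G) _ (permUnitary (delta G) _ (delta G g))
      rw [permUnitary_apply, permUnitary_apply, permUnitary_apply]
      rfl
    exact congrArg (fun f => f y) this
  have h2 : ∀ y : L2 G,
      (autUnitary (θ * θ')).symm y = (autUnitary θ').symm ((autUnitary θ).symm y) := by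
    intro y
    rw [LinearIsometryEquiv.symm_apply_eq, h1]
    simp
  ext1 y
  simp only [LinearIsometryEquiv.conjStarAlgEquiv_apply_apply, h1, h2]

theorem autUnitary_conj_one (x : L2 G →L[ℂ] L2 G) :
    (autUnitary (1 : MulAut G)).conjStarAlgEquiv x = x := by
  have := autUnitary_conj_mul (1 : MulAut G) 1 x
  rw [one_mul] at this
  exact ((autUnitary (1 : MulAut G)).conjStarAlgEquiv.injective this).symm

/-- The automorphism of `L(G)` given by a group automorphism `θ` of `G`: `u_g ↦ u_{θ(g)}`. -/
def groupVNAut : MulAut G →* (Elem (groupVN G) ≃⋆ₐ[ℂ] Elem (groupVN G)) where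
  toFun θ :=
    { toFun := fun x => ⟨(autUnitary θ).conjStarAlgEquiv x, autUnitary_conj_mem θ x.2⟩
      invFun := fun x => ⟨(autUnitary θ⁻¹).conjStarAlgEquiv x, autUnitary_conj_mem θ⁻¹ x.2⟩
      left_inv := fun x => Subtype.ext (by
        change (autUnitary θ⁻¹).conjStarAlgEquiv ((autUnitary θ).conjStarAlgEquiv _) = _
        rw [← autUnitary_conj_mul, inv_mul_cancel, autUnitary_conj_one])
      right_inv := fun x => Subtype.ext (by
        change (autUnitary θ).conjStarAlgEquiv ((autUnitary θ⁻¹).conjStarAlgEquiv _) = _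
        rw [← autUnitary_conj_mul, mul_inv_cancel, autUnitary_conj_one])
      map_mul' := fun x y => Subtype.ext (map_mul _ _ _)
      map_add' := fun x y => Subtype.ext (map_add _ _ _)
      map_star' := fun x => Subtype.ext (map_star _ _)
      map_smul' := fun c x => Subtype.ext (map_smul _ _ _) }
  map_one' := StarAlgEquiv.ext fun x => Subtype.ext (autUnitary_conj_one _)
  map_mul' θ θ' := StarAlgEquiv.ext fun x => Subtype.ext (autUnitary_conj_mul θ θ' _)

theorem groupVNAut_canonicalUnitary (θ : MulAut G) (g : G) :
    groupVNAut θ (canonicalUnitary g) = canonicalUnitary (θ g) :=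
  Subtype.ext (autUnitary_conj_leftReg θ g)

end Group

/-- A group is icc if the conjugacy class of every nontrivial element is infinite. -/
def IsICC (G : Type u) [Group G] : Prop := ∀ g : G, g ≠ 1 → (conjugatesOf g).Infinite

end QGroup
end

/-! Pull the comultiplication of N back along π: Δ = (π⁻¹ ⊗ π⁻¹) Δ_N π is coassociative on L(G), has
τ as Haar state, and commutes with α_θ for θ ∈ Γ, in particular with conjugation by each u_s. The
point is that such a Δ satisfies Δ(u_g) = χ(g) u_g ⊗ u_g for a character χ : G → 𝕋. Given this,
μ(u_g) = χ(g) u_g defines an automorphism, π ∘ μ is a quantum group isomorphism, μ⁻¹ is the left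
translation by u_g ↦ χ(g)⁻¹, and equivariance forces χ ∘ θ = χ.

Write Δ(u_g) = ∑ c(g;h,k) u_h ⊗ u_k, where c is `coef`. Three vanishing statements carry the proof.

(1) c(g;s,s) = 0 for g ≠ s (`IsDual.coef_self`). The unitaries u_s ⊗ u_s and Δ(u_s) act alike by
conjugation on Δ(L(G)), so v = (u_s ⊗ u_s)* Δ(u_s) commutes with Δ(L(G)). Hence r ↦ (τ ⊗ τ)(v
Δ(u_r)) is a square summable class function, and icc confines its support to r = 1.

(2) c(s;h,s) = 0 for h ≠ s (`IsDual.coef_right`). The same argument runs on the dual family V*(ρ_h⁻¹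
⊗ 1)V with V(δ_g ⊗ δ_k) = Δ(u_g)(δ_1 ⊗ δ_k). Left invariance of τ makes V isometric; it is onto by
an antipode identity, which combines coassociativity with right invariance.

(3) c(m;l,k) = 0 for l ≠ k (`IsDual.coef_eq_zero`). The antipode identity also yields an
orthogonality relation for slices (`IsDual.inner_slice_slice`). With (2), it shows that conj(a_k)
c(g;k,h) is Hermitian in (g,h), where a_k = c(k;k,k) ≠ 0. Coassociativity at u_l ⊗ u_l ⊗ u_k, with
(1) and (2), gives ∑_m c(k;l,m) c(m;l,k) = 0; by the Hermitian symmetry this sum is a phase times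
∑_m |c(m;l,k)|².

On the analytic side, π is only an abstract state preserving *-isomorphism, while tensor products of
maps require normality. Homomorphisms are therefore handled in the form x ↦ ∑ wᵢ* x wᵢ with
intertwiners wᵢ such that ∑ wᵢ* wᵢ = 1 (`IsSpatial`). Such maps are normal and can be tensored. That
π and π⁻¹ are of this form follows from normality of the Haar state of N
(`isSpatial_of_statePreserving`). -/

noncomputable section

namespace QGroup

/-! ### Square summable families of vectors, column and diagonal operators -/

section Column

variable {H : Type*} [NormedAddCommGroup H] {κ : Type*}

theorem lp_hasSum_norm_sq (f : lp (fun _ : κ => H) 2) :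
    HasSum (fun i => ‖f i‖ ^ 2) (‖f‖ ^ 2) := by
  have := lp.hasSum_norm (p := 2) (by norm_num) f
  simpa using this

theorem memℓp_two_of_sum_le {f : κ → H} {C : ℝ} (h : ∀ F : Finset κ, ∑ i ∈ F, ‖f i‖ ^ 2 ≤ C) :
    Memℓp f 2 :=
  memℓp_gen' (C := C) fun s => by simpa using h s

theorem memℓp_two_of_summable {f : κ → H} (h : Summable fun i => ‖f i‖ ^ 2) : Memℓp f 2 :=
  memℓp_gen (by simpa using h)

variable [InnerProductSpace ℂ H]
variable {K : Type*} [NormedAddCommGroup K] [InnerProductSpace ℂ K]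

/-- The operator `η ↦ (wᵢ η)ᵢ` from `K` to `ℓ²(κ, H)`. -/
def column (w : κ → K →L[ℂ] H) (C : ℝ) (hC : 0 ≤ C)
    (h : ∀ (η : K) (F : Finset κ), ∑ i ∈ F, ‖w i η‖ ^ 2 ≤ (C * ‖η‖) ^ 2) :
    K →L[ℂ] lp (fun _ : κ => H) 2 :=
  LinearMap.mkContinuous
    { toFun := fun η => ⟨fun i => w i η, memℓp_two_of_sum_le (h η)⟩
      map_add' := fun η η' => lp.ext (funext fun i => map_add (w i) η η')
      map_smul' := fun c η => lp.ext (funext fun i => map_smul (w i) c η) } C fun η => by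
    refine lp.norm_le_of_forall_sum_le (by norm_num) (by positivity) fun s => ?_
    simpa using h η s

theorem column_apply (w : κ → K →L[ℂ] H) (C : ℝ) (hC : 0 ≤ C)
    (h : ∀ (η : K) (F : Finset κ), ∑ i ∈ F, ‖w i η‖ ^ 2 ≤ (C * ‖η‖) ^ 2) (η : K) (i : κ) :
    column w C hC h η i = w i η := rfl

/-- The diagonal operator `(ηᵢ)ᵢ ↦ (x ηᵢ)ᵢ` on `ℓ²(κ, H)`. -/
def diag (κ : Type*) (x : H →L[ℂ] K) : lp (fun _ : κ => H) 2 →L[ℂ] lp (fun _ : κ => K) 2 :=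
  column (fun i => x ∘L lp.evalCLM ℂ (fun _ : κ => H) 2 i) ‖x‖ (norm_nonneg x) fun η F => by
    calc ∑ i ∈ F, ‖x (η i)‖ ^ 2 ≤ ∑ i ∈ F, ‖x‖ ^ 2 * ‖η i‖ ^ 2 := by
          refine Finset.sum_le_sum fun i _ => ?_
          rw [← mul_pow]
          gcongr
          exact x.le_opNorm _
      _ ≤ (‖x‖ * ‖η‖) ^ 2 := by
          rw [← Finset.mul_sum, mul_pow]
          gcongr
          exact sum_le_hasSum F (fun _ _ => by positivity) (lp_hasSum_norm_sq η)

theorem diag_apply (x : H →L[ℂ] K) (η : lp (fun _ : κ => H) 2) (i : κ) :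
    diag κ x η i = x (η i) := rfl

theorem diag_adjoint [CompleteSpace H] [CompleteSpace K] (x : H →L[ℂ] K) :
    (diag κ x).adjoint = diag κ x.adjoint := by
  refine (ContinuousLinearMap.eq_adjoint_iff _ _).mpr (fun a b => ?_) |>.symm
  rw [lp.inner_eq_tsum, lp.inner_eq_tsum]
  simp only [diag_apply, ContinuousLinearMap.adjoint_inner_left]

/-- The inclusion of the `i`-th summand. -/
def single (i : κ) : H →L[ℂ] lp (fun _ : κ => H) 2 :=
  open Classical in lp.singleContinuousLinearMap ℂ (fun _ : κ => H) 2 i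

/-- The projection on the `i`-th summand. -/
def coord (i : κ) : lp (fun _ : κ => H) 2 →L[ℂ] H := lp.evalCLM ℂ (fun _ : κ => H) 2 i

theorem hasSum_single (f : lp (fun _ : κ => H) 2) : HasSum (fun i => single i (f i)) f := by
  classical
  have := lp.hasSum_single (p := 2) (by norm_num) f
  exact this

theorem inner_single_left (i : κ) (a : H) (f : lp (fun _ : κ => H) 2) :
    ⟪single i a, f⟫_ℂ = ⟪a, f i⟫_ℂ := by
  classical
  exact lp.inner_single_left (𝕜 := ℂ) (G := fun _ : κ => H) i a f

theorem diag_single (x : H →L[ℂ] K) (i : κ) (a : H) :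
    diag κ x (single i a) = single i (x a) := by
  classical
  refine lp.ext (funext fun j => ?_)
  rw [diag_apply]
  simp only [single, lp.singleContinuousLinearMap_apply, lp.single_apply]
  by_cases h : j = i
  · subst h
    simp
  · simp [h]

end Column

/-! ### The double commutant theorem in an amplification -/

section Density

variable {H : Type*} [NormedAddCommGroup H] [InnerProductSpace ℂ H] [CompleteSpace H]
variable {κ : Type*}

theorem mem_commutant_generated {S : Set (H →L[ℂ] H)} {x y : H →L[ℂ] H}
    (hx : x ∈ (generated S).toStarSubalgebra) (hy : ∀ s ∈ S, y * s = s * y)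
    (hy' : ∀ s ∈ S, y * star s = star s * y) : x * y = y * x := by
  refine (mem_generated.mp hx y ?_).symm
  rintro s (hs | hs)
  · exact (hy s hs).symm
  · have := hy' _ hs
    rw [star_star] at this
    exact this.symm

/-- The double commutant theorem, for several vectors at once. -/
theorem diag_mem_closure {S : Set (H →L[ℂ] H)} (hmul : ∀ s ∈ S, ∀ t ∈ S, s * t ∈ S)
    (hstar : ∀ s ∈ S, star s ∈ S) (h1 : (1 : H →L[ℂ] H) ∈ S) {x : H →L[ℂ] H}
    (hx : x ∈ (generated S).toStarSubalgebra) (η : lp (fun _ : κ => H) 2) :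
    diag κ x η ∈ (Submodule.span ℂ ((fun s => diag κ s η) '' S)).topologicalClosure := by
  -- Z is the closed subspace generated by η under the amplified S. Its projection commutes with the
  -- amplification of S, so each matrix entry commutes with S, hence with x. The projection then
  -- commutes with the amplification of x, and η ∈ Z gives the claim.
  set Z := (Submodule.span ℂ ((fun s => diag κ s η) '' S)).topologicalClosure with hZ
  have : CompleteSpace Z := (Submodule.isClosed_topologicalClosure _).completeSpace_coe
  have hinv : ∀ s ∈ S, ∀ z ∈ Z, diag κ s z ∈ Z := by
    intro s hs
    have : Z ≤ Z.comap (diag κ s : lp (fun _ : κ => H) 2 →ₗ[ℂ] lp (fun _ : κ => H) 2) := by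
      refine Submodule.topologicalClosure_minimal _ ?_ ?_
      · rw [Submodule.span_le]
        rintro _ ⟨t, ht, rfl⟩
        exact Submodule.le_topologicalClosure _ (Submodule.subset_span ⟨s * t, hmul s hs t ht, rfl⟩)
      · exact (Submodule.isClosed_topologicalClosure _).preimage (diag κ s).continuous
    exact this
  have hcomm : ∀ s ∈ S, ∀ v, Z.starProjection (diag κ s v) = diag κ s (Z.starProjection v) := by
    intro s hs v
    refine (Submodule.eq_starProjection_of_mem_of_inner_eq_zero
      (hinv s hs _ (Z.starProjection_apply_mem v)) fun z hz => ?_)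
    rw [← map_sub, ← ContinuousLinearMap.adjoint_inner_right, diag_adjoint]
    exact Z.starProjection_inner_eq_zero v _ (hinv _ (hstar s hs) z hz)
  have hentry : ∀ i j, x * (coord i ∘L Z.starProjection ∘L single j : H →L[ℂ] H) =
      (coord i ∘L Z.starProjection ∘L single j) * x := by
    intro i j
    have h0 : ∀ s ∈ S, (coord i ∘L Z.starProjection ∘L single j : H →L[ℂ] H) * s =
        s * (coord i ∘L Z.starProjection ∘L single j) := by
      intro s hs
      ext a
      change coord i (Z.starProjection (single j (s a))) = s (coord i (Z.starProjection (single j a)))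
      rw [← diag_single, hcomm s hs]
      rfl
    exact mem_commutant_generated hx h0 fun s hs => h0 _ (hstar s hs)
  have hxP : ∀ v, Z.starProjection (diag κ x v) = diag κ x (Z.starProjection v) := by
    intro v
    refine lp.ext (funext fun i => ?_)
    have h2 := ((hasSum_single (diag κ x v)).mapL Z.starProjection).mapL (coord i)
    have h3 := (((hasSum_single v).mapL Z.starProjection).mapL (coord i)).mapL x
    change coord i (Z.starProjection (diag κ x v)) = x (coord i (Z.starProjection v))
    refine h2.unique ?_
    convert h3 using 2 with j
    exact (DFunLike.congr_fun (hentry i j) (v j)).symm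
  have hη : η ∈ Z := Submodule.le_topologicalClosure _ (Submodule.subset_span ⟨1, h1, rfl⟩)
  rw [← Z.starProjection_eq_self_iff.mpr hη, ← hxP]
  exact Z.starProjection_apply_mem _

end Density

/-! ### Normal functionals and normal maps are determined on generators -/

section NormalFunctional

variable {H : Type u} [NormedAddCommGroup H] [InnerProductSpace ℂ H] [CompleteSpace H]
variable {K : Type v} [NormedAddCommGroup K] [InnerProductSpace ℂ K] [CompleteSpace K]

/-- A summable family of squared norms has countable support, so only countably many indices matter;
an injection of them into ℕ, with zero padding, gives the sequences required by the definition. -/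
theorem IsNormalFunctional.of_hasSum {M : VonNeumannAlgebra H} {ω : Elem M →ₗ[ℂ] ℂ} {κ : Type*}
    {ξ η : κ → H} (hξ : Summable fun i => ‖ξ i‖ ^ 2) (hη : Summable fun i => ‖η i‖ ^ 2)
    (h : ∀ x : Elem M, HasSum (fun i => ⟪ξ i, (x : H →L[ℂ] H) (η i)⟫_ℂ) (ω x)) :
    IsNormalFunctional M ω := by
  set s : Set κ := Function.support (fun i => ‖ξ i‖ ^ 2) with hs
  have hcount : Countable s := hξ.countable_support
  obtain ⟨e, he⟩ := Countable.exists_injective_nat s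
  have hnorm : ∀ ζ : κ → H, (fun n => ‖Function.extend e (fun i : s => ζ i) 0 n‖ ^ 2) =
      Function.extend e (fun i : s => ‖ζ i‖ ^ 2) 0 := by
    intro ζ
    ext n
    by_cases hn : ∃ i, e i = n
    · obtain ⟨i, rfl⟩ := hn
      rw [he.extend_apply, he.extend_apply]
    · rw [Function.extend_apply' _ _ _ hn, Function.extend_apply' _ _ _ hn]
      simp
  have hsum : ∀ ζ : κ → H, Summable (fun i => ‖ζ i‖ ^ 2) →
      Summable fun n => ‖Function.extend e (fun i : s => ζ i) 0 n‖ ^ 2 := by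
    intro ζ hζ
    rw [hnorm, summable_extend_zero he]
    exact hζ.subtype s
  refine ⟨_, _, hsum ξ hξ, hsum η hη, fun x => ?_⟩
  have h1 : HasSum (fun i : s => ⟪ξ i, (x : H →L[ℂ] H) (η i)⟫_ℂ) (ω x) := by
    refine (hasSum_subtype_iff_of_support_subset (f := fun i => ⟪ξ i, (x : H →L[ℂ] H) (η i)⟫_ℂ)
      (s := s) fun i hi => by_contra fun hi' => hi ?_).mpr (h x)
    have : ξ i = 0 := by simpa [hs] using hi'
    simp [this]
  rw [← hasSum_extend_zero he] at h1
  convert h1 using 1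
  ext n
  by_cases hn : ∃ i, e i = n
  · obtain ⟨i, rfl⟩ := hn
    rw [he.extend_apply, he.extend_apply, he.extend_apply]
  · rw [Function.extend_apply' _ _ _ hn, Function.extend_apply' _ _ _ hn,
      Function.extend_apply' _ _ _ hn]
    simp

/-- The functional `x ↦ ⟪ξ, x η⟫`. -/
def vectorFunctional (M : VonNeumannAlgebra H) (ξ η : H) : Elem M →ₗ[ℂ] ℂ where
  toFun x := ⟪ξ, (x : H →L[ℂ] H) η⟫_ℂ
  map_add' x y := by simp
  map_smul' c x := by simp

theorem vectorFunctional_apply (M : VonNeumannAlgebra H) (ξ η : H) (x : Elem M) :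
    vectorFunctional M ξ η x = ⟪ξ, (x : H →L[ℂ] H) η⟫_ℂ := rfl

theorem isNormalFunctional_vectorFunctional (M : VonNeumannAlgebra H) (ξ η : H) :
    IsNormalFunctional M (vectorFunctional M ξ η) :=
  IsNormalFunctional.of_hasSum (κ := Unit) (ξ := fun _ => ξ) (η := fun _ => η)
    (Summable.of_finite) (Summable.of_finite) fun x => by
      simp [vectorFunctional_apply]

theorem IsNormalFunctional.sub {M : VonNeumannAlgebra H} {ω ω' : Elem M →ₗ[ℂ] ℂ}
    (h : IsNormalFunctional M ω) (h' : IsNormalFunctional M ω') :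
    IsNormalFunctional M (ω - ω') := by
  obtain ⟨ξ, η, hξ, hη, hs⟩ := h
  obtain ⟨ξ', η', hξ', hη', hs'⟩ := h'
  refine IsNormalFunctional.of_hasSum (κ := ℕ ⊕ ℕ) (ξ := Sum.elim ξ (fun n => -ξ' n))
    (η := Sum.elim η η') ?_ ?_ fun x => ?_
  · exact (HasSum.sum (by simpa [Function.comp_def] using hξ.hasSum)
      (by simpa [Function.comp_def] using hξ'.hasSum)).summable
  · exact (HasSum.sum (by simpa [Function.comp_def] using hη.hasSum)
      (by simpa [Function.comp_def] using hη'.hasSum)).summable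
  · rw [LinearMap.sub_apply, sub_eq_add_neg]
    exact HasSum.sum (by simpa [Function.comp_def] using hs x)
      (by simpa [Function.comp_def] using (hs' x).neg)

/-- A set of operators that is closed under products and adjoints, and contains `1`. -/
structure IsStarMonoid (S : Set (H →L[ℂ] H)) : Prop where
  mul_mem : ∀ s ∈ S, ∀ t ∈ S, s * t ∈ S
  star_mem : ∀ s ∈ S, star s ∈ S
  one_mem : (1 : H →L[ℂ] H) ∈ S

/-- Seen on the amplification to ℓ²(ℕ, H), a normal functional is a single vector functional, so
`diag_mem_closure` applies. This is what allows later identities to be checked on the u_g or on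
elementary tensors only. -/
theorem IsNormalFunctional.eq_zero {S : Set (H →L[ℂ] H)} (hS : IsStarMonoid S)
    {ω : Elem (generated S) →ₗ[ℂ] ℂ} (h : IsNormalFunctional (generated S) ω)
    (h0 : ∀ s (hs : s ∈ S), ω ⟨s, subset_generated hs⟩ = 0) : ω = 0 := by
  obtain ⟨ξ, η, hξ, hη, hs⟩ := h
  let ξ' : lp (fun _ : ℕ => H) 2 := ⟨ξ, memℓp_two_of_summable hξ⟩
  let η' : lp (fun _ : ℕ => H) 2 := ⟨η, memℓp_two_of_summable hη⟩
  have key : ∀ x : Elem (generated S), ω x = ⟪ξ', diag ℕ (x : H →L[ℂ] H) η'⟫_ℂ := fun x =>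
    (hs x).unique (lp.hasSum_inner ξ' (diag ℕ (x : H →L[ℂ] H) η'))
  ext x
  rw [key]
  have hx := diag_mem_closure hS.mul_mem hS.star_mem hS.one_mem x.2 η'
  have hle : (Submodule.span ℂ ((fun s => diag ℕ s η') '' S)).topologicalClosure ≤
      LinearMap.ker (innerSL ℂ ξ' : lp (fun _ : ℕ => H) 2 →ₗ[ℂ] ℂ) := by
    refine Submodule.topologicalClosure_minimal _ ?_ (innerSL ℂ ξ').isClosed_ker
    rw [Submodule.span_le]
    rintro _ ⟨s, hs, rfl⟩
    exact (key ⟨s, subset_generated hs⟩).symm.trans (h0 s hs)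
  exact hle hx

theorem IsNormalFunctional.ext {S : Set (H →L[ℂ] H)} (hS : IsStarMonoid S)
    {ω ω' : Elem (generated S) →ₗ[ℂ] ℂ} (h : IsNormalFunctional (generated S) ω)
    (h' : IsNormalFunctional (generated S) ω')
    (h0 : ∀ s (hs : s ∈ S), ω ⟨s, subset_generated hs⟩ = ω' ⟨s, subset_generated hs⟩) : ω = ω' :=
  sub_eq_zero.mp ((h.sub h').eq_zero hS fun s hs => by
    rw [LinearMap.sub_apply, h0 s hs, sub_self])

theorem IsNormalMap.ext {S : Set (H →L[ℂ] H)} (hS : IsStarMonoid S) {N : VonNeumannAlgebra K}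
    {f g : Elem (generated S) →ₗ[ℂ] Elem N} (hf : IsNormalMap f) (hg : IsNormalMap g)
    (h0 : ∀ s (hs : s ∈ S), f ⟨s, subset_generated hs⟩ = g ⟨s, subset_generated hs⟩) : f = g := by
  ext x : 1
  refine Subtype.ext (ContinuousLinearMap.ext fun η => ext_inner_left ℂ fun ξ => ?_)
  have h := IsNormalFunctional.ext hS (hf _ (isNormalFunctional_vectorFunctional N ξ η))
    (hg _ (isNormalFunctional_vectorFunctional N ξ η)) fun s hs => by
      rw [LinearMap.comp_apply, LinearMap.comp_apply, h0 s hs]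
  exact DFunLike.congr_fun h x

theorem IsNormalMap.comp {L : Type w} [NormedAddCommGroup L] [InnerProductSpace ℂ L]
    [CompleteSpace L] {M : VonNeumannAlgebra H} {N : VonNeumannAlgebra K}
    {P : VonNeumannAlgebra L} {g : Elem N →ₗ[ℂ] Elem P} {f : Elem M →ₗ[ℂ] Elem N}
    (hg : IsNormalMap g) (hf : IsNormalMap f) : IsNormalMap (g ∘ₗ f) :=
  fun ω hω => hf _ (hg ω hω)

theorem IsNormalHom.comp {L : Type w} [NormedAddCommGroup L] [InnerProductSpace ℂ L]
    [CompleteSpace L] {M : VonNeumannAlgebra H} {N : VonNeumannAlgebra K}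
    {P : VonNeumannAlgebra L} {g : Elem N →⋆ₐ[ℂ] Elem P} {f : Elem M →⋆ₐ[ℂ] Elem N}
    (hg : IsNormalHom g) (hf : IsNormalHom f) : IsNormalHom (g.comp f) :=
  IsNormalMap.comp (g := g.toAlgHom.toLinearMap) (f := f.toAlgHom.toLinearMap) hg hf

theorem IsNormalHom.ext {S : Set (H →L[ℂ] H)} (hS : IsStarMonoid S) {N : VonNeumannAlgebra K}
    {f g : Elem (generated S) →⋆ₐ[ℂ] Elem N} (hf : IsNormalHom f) (hg : IsNormalHom g)
    (h0 : ∀ s (hs : s ∈ S), f ⟨s, subset_generated hs⟩ = g ⟨s, subset_generated hs⟩) : f = g := by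
  have := IsNormalMap.ext hS hf hg h0
  exact StarAlgHom.ext fun x => DFunLike.congr_fun this x

end NormalFunctional

/-! ### Elementary tensors of operators as generators -/

section TensorOperators

variable {H : Type*} [NormedAddCommGroup H] [InnerProductSpace ℂ H]
variable {K : Type*} [NormedAddCommGroup K] [InnerProductSpace ℂ K]

theorem opTensor_mul (S S' : H →L[ℂ] H) (T T' : K →L[ℂ] K) :
    opTensor S T * opTensor S' T' = opTensor (S * S') (T * T') :=
  op_ext fun ξ η => by
    rw [mul_apply_eq_comp, opTensor_vtmul, opTensor_vtmul, opTensor_vtmul]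
    rfl

theorem opTensor_one : opTensor (1 : H →L[ℂ] H) (1 : K →L[ℂ] K) = 1 :=
  op_ext fun ξ η => by
    rw [opTensor_vtmul]
    rfl

theorem star_opTensor [CompleteSpace H] [CompleteSpace K] (S : H →L[ℂ] H) (T : K →L[ℂ] K) :
    star (opTensor S T) = opTensor (star S) (star T) := by
  refine ContinuousLinearMap.ext fun y => ext_inner_left ℂ fun x => ?_
  rw [ContinuousLinearMap.star_eq_adjoint (opTensor S T),
    ContinuousLinearMap.adjoint_inner_right, inner_opTensor_right, star_star, star_star]

end TensorOperators

section Generators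

variable {H : Type u} [NormedAddCommGroup H] [InnerProductSpace ℂ H] [CompleteSpace H]
variable {K : Type v} [NormedAddCommGroup K] [InnerProductSpace ℂ K] [CompleteSpace K]
variable {L : Type w} [NormedAddCommGroup L] [InnerProductSpace ℂ L] [CompleteSpace L]

theorem isStarMonoid_elementary (M : VonNeumannAlgebra H) (N : VonNeumannAlgebra K) :
    IsStarMonoid {x | ∃ a ∈ M, ∃ b ∈ N, x = opTensor a b} where
  mul_mem := by
    rintro _ ⟨a, ha, b, hb, rfl⟩ _ ⟨a', ha', b', hb', rfl⟩
    exact ⟨a * a', mul_mem ha ha', b * b', mul_mem hb hb', opTensor_mul _ _ _ _⟩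
  star_mem := by
    rintro _ ⟨a, ha, b, hb, rfl⟩
    exact ⟨star a, star_mem ha, star b, star_mem hb, star_opTensor _ _⟩
  one_mem := ⟨1, one_mem _, 1, one_mem _, opTensor_one.symm⟩

theorem IsNormalFunctional.vnTensor_ext {M : VonNeumannAlgebra H} {N : VonNeumannAlgebra K}
    {ω ω' : Elem (vnTensor M N) →ₗ[ℂ] ℂ} (h : IsNormalFunctional _ ω)
    (h' : IsNormalFunctional _ ω') (h0 : ∀ a b, ω (tmul a b) = ω' (tmul a b)) : ω = ω' := by
  refine IsNormalFunctional.ext (isStarMonoid_elementary M N) h h' ?_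
  rintro _ ⟨a, ha, b, hb, rfl⟩
  exact h0 ⟨a, ha⟩ ⟨b, hb⟩

theorem IsNormalMap.vnTensor_ext {M : VonNeumannAlgebra H} {N : VonNeumannAlgebra K}
    {P : VonNeumannAlgebra L} {f g : Elem (vnTensor M N) →ₗ[ℂ] Elem P} (hf : IsNormalMap f)
    (hg : IsNormalMap g) (h0 : ∀ a b, f (tmul a b) = g (tmul a b)) : f = g := by
  refine IsNormalMap.ext (isStarMonoid_elementary M N) hf hg ?_
  rintro _ ⟨a, ha, b, hb, rfl⟩
  exact h0 ⟨a, ha⟩ ⟨b, hb⟩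

theorem IsNormalHom.vnTensor_ext {M : VonNeumannAlgebra H} {N : VonNeumannAlgebra K}
    {P : VonNeumannAlgebra L} {f g : Elem (vnTensor M N) →⋆ₐ[ℂ] Elem P} (hf : IsNormalHom f)
    (hg : IsNormalHom g) (h0 : ∀ a b, f (tmul a b) = g (tmul a b)) : f = g := by
  have := IsNormalMap.vnTensor_ext hf hg h0
  exact StarAlgHom.ext fun x => DFunLike.congr_fun this x

theorem tmul_mul {M : VonNeumannAlgebra H} {N : VonNeumannAlgebra K} (a a' : Elem M)
    (b b' : Elem N) : tmul a b * tmul a' b' = tmul (a * a') (b * b') :=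
  Subtype.ext (opTensor_mul _ _ _ _)

end Generators

/-! ### Parseval families of operators -/

section Parseval

variable {H : Type*} [NormedAddCommGroup H] [InnerProductSpace ℂ H]
variable {K : Type*} [NormedAddCommGroup K] [InnerProductSpace ℂ K]
variable {κ : Type*}

/-- A family of operators with `∑ᵢ wᵢ* wᵢ = 1`. -/
def IsParseval (w : κ → K →L[ℂ] H) : Prop :=
  ∀ η, HasSum (fun i => ‖w i η‖ ^ 2) (‖η‖ ^ 2)

/-- The polarised identity extends to the span by sesquilinearity. Finite partial sums are
continuous, so the Bessel bound passes to the closure and gives a bounded column operator; being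
isometric is then a closed condition. -/
theorem isParseval_of_span {w : κ → K →L[ℂ] H} {X : Set K}
    (hX : (Submodule.span ℂ X).topologicalClosure = ⊤)
    (h : ∀ x ∈ X, ∀ y ∈ X, HasSum (fun i => ⟪w i x, w i y⟫_ℂ) ⟪x, y⟫_ℂ) : IsParseval w := by
  have h1 : ∀ x ∈ X, ∀ y ∈ Submodule.span ℂ X,
      HasSum (fun i => ⟪w i x, w i y⟫_ℂ) ⟪x, y⟫_ℂ := by
    intro x hx y hy
    induction hy using Submodule.span_induction with
    | mem y hy => exact h x hx y hy
    | zero => simp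
    | add y z _ _ hy hz => simpa [inner_add_right] using hy.add hz
    | smul c y _ hy => simpa [inner_smul_right] using hy.mul_left c
  have h2 : ∀ x ∈ Submodule.span ℂ X, ∀ y ∈ Submodule.span ℂ X,
      HasSum (fun i => ⟪w i x, w i y⟫_ℂ) ⟪x, y⟫_ℂ := by
    intro x hx y hy
    induction hx using Submodule.span_induction with
    | mem x hx => exact h1 x hx y hy
    | zero => simp
    | add x z _ _ hx hz => simpa [inner_add_left] using hx.add hz
    | smul c x _ hx => simpa [inner_smul_left, mul_comm] using hx.mul_left (starRingEnd ℂ c)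
  have h3 : ∀ x ∈ Submodule.span ℂ X, HasSum (fun i => ‖w i x‖ ^ 2) (‖x‖ ^ 2) := by
    intro x hx
    have := Complex.hasSum_re (h2 x hx x hx)
    simpa only [inner_self_eq_norm_sq_to_K, Complex.coe_algebraMap, ← Complex.ofReal_pow,
      Complex.ofReal_re] using this
  have hd : Dense ((Submodule.span ℂ X : Submodule ℂ K) : Set K) :=
    Submodule.dense_iff_topologicalClosure_eq_top.mpr hX
  have h4 : ∀ (x : K) (F : Finset κ), ∑ i ∈ F, ‖w i x‖ ^ 2 ≤ (1 * ‖x‖) ^ 2 := by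
    intro x F
    refine hd.induction (P := fun x => ∑ i ∈ F, ‖w i x‖ ^ 2 ≤ (1 * ‖x‖) ^ 2) (fun x hx => ?_)
      ?_ x
    · rw [one_mul]
      exact sum_le_hasSum F (fun _ _ => by positivity) (h3 x hx)
    · exact isClosed_le (by fun_prop) (by fun_prop)
  have h5 : ∀ x : K, ‖column w 1 zero_le_one h4 x‖ = ‖x‖ := by
    intro x
    refine hd.induction (P := fun x => ‖column w 1 zero_le_one h4 x‖ = ‖x‖) (fun x hx => ?_)
      ?_ x
    · have := (lp_hasSum_norm_sq (column w 1 zero_le_one h4 x)).unique (h3 x hx)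
      exact (sq_eq_sq₀ (norm_nonneg _) (norm_nonneg _)).mp this
    · exact isClosed_eq (by fun_prop) (by fun_prop)
  intro x
  rw [← h5 x]
  exact lp_hasSum_norm_sq (column w 1 zero_le_one h4 x)

/-- The isometry `η ↦ (wᵢ η)ᵢ` given by a Parseval family. -/
def IsParseval.isometry {w : κ → K →L[ℂ] H} (hw : IsParseval w) :
    K →L[ℂ] lp (fun _ : κ => H) 2 :=
  column w 1 zero_le_one fun η F => by
    rw [one_mul]
    exact sum_le_hasSum F (fun _ _ => by positivity) (hw η)

theorem IsParseval.norm_isometry {w : κ → K →L[ℂ] H} (hw : IsParseval w) (η : K) :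
    ‖hw.isometry η‖ = ‖η‖ :=
  (sq_eq_sq₀ (norm_nonneg _) (norm_nonneg _)).mp
    ((lp_hasSum_norm_sq (hw.isometry η)).unique (hw η))

theorem IsParseval.inner_isometry {w : κ → K →L[ℂ] H} (hw : IsParseval w) (ξ η : K) :
    ⟪hw.isometry ξ, hw.isometry η⟫_ℂ = ⟪ξ, η⟫_ℂ :=
  LinearIsometry.inner_map_map
    ({ toLinearMap := hw.isometry.toLinearMap, norm_map' := hw.norm_isometry } :
      K →ₗᵢ[ℂ] lp (fun _ : κ => H) 2) ξ η

theorem IsParseval.hasSum_inner {w : κ → K →L[ℂ] H} (hw : IsParseval w) (ξ η : K) :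
    HasSum (fun i => ⟪w i ξ, w i η⟫_ℂ) ⟪ξ, η⟫_ℂ := by
  rw [← hw.inner_isometry]
  exact lp.hasSum_inner (hw.isometry ξ) (hw.isometry η)

theorem IsParseval.ext {w : κ → K →L[ℂ] H} (hw : IsParseval w) {η η' : K}
    (h : ∀ i, w i η = w i η') : η = η' := by
  rw [← sub_eq_zero, ← norm_eq_zero, ← sq_eq_zero_iff (M₀ := ℝ)]
  refine (hw (η - η')).unique ?_
  simp [h]

theorem IsParseval.hasSum [CompleteSpace H] [CompleteSpace K] {w : κ → K →L[ℂ] H}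
    (hw : IsParseval w) (η : K) :
    HasSum (fun i => (w i).adjoint (w i η)) η := by
  have h1 : hw.isometry.adjoint (hw.isometry η) = η := ext_inner_left ℂ fun ξ => by
    rw [ContinuousLinearMap.adjoint_inner_right, hw.inner_isometry]
  have h2 := (hasSum_single (hw.isometry η)).mapL hw.isometry.adjoint
  rw [h1] at h2
  convert h2 using 2 with i
  refine ext_inner_right ℂ fun ζ => ?_
  rw [ContinuousLinearMap.adjoint_inner_left, ContinuousLinearMap.adjoint_inner_left,
    inner_single_left]
  rfl

end Parseval

/-! ### Homomorphisms given by Parseval families of intertwiners -/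

section Spatial

variable {H : Type u} [NormedAddCommGroup H] [InnerProductSpace ℂ H] [CompleteSpace H]
variable {K : Type v} [NormedAddCommGroup K] [InnerProductSpace ℂ K] [CompleteSpace K]
variable {κ : Type*}

/-- `w f(x) = x w` for all `x`. -/
def IsIntertwiner {M : VonNeumannAlgebra H} {N : VonNeumannAlgebra K}
    (f : Elem M →⋆ₐ[ℂ] Elem N) (w : K →L[ℂ] H) : Prop :=
  ∀ (x : Elem M) (η : K), w ((f x : K →L[ℂ] K) η) = (x : H →L[ℂ] H) (w η)

/-- A *-homomorphism that is given by reducing an amplification. -/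
def IsSpatial {M : VonNeumannAlgebra H} {N : VonNeumannAlgebra K}
    (f : Elem M →⋆ₐ[ℂ] Elem N) : Prop :=
  ∃ (κ : Type (max u v)) (w : κ → K →L[ℂ] H), IsParseval w ∧ ∀ i, IsIntertwiner f (w i)

theorem IsParseval.isSpatial {M : VonNeumannAlgebra H} {N : VonNeumannAlgebra K}
    {f : Elem M →⋆ₐ[ℂ] Elem N} {w : κ → K →L[ℂ] H} (hw : IsParseval w)
    (h : ∀ i, IsIntertwiner f (w i)) {κ' : Type (max u v)} (e : κ' ≃ κ) : IsSpatial f :=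
  ⟨κ', fun i => w (e i), fun η => (e.hasSum_iff (f := fun i => ‖w i η‖ ^ 2)).mpr (hw η),
    fun i => h (e i)⟩

/-- Composition with a normal functional replaces the vectors ξₙ, ηₙ by the double families wᵢ ξₙ,
wᵢ ηₙ, whose total square sums are unchanged by the Parseval identity. -/
theorem IsParseval.isNormalHom {M : VonNeumannAlgebra H} {N : VonNeumannAlgebra K}
    {f : Elem M →⋆ₐ[ℂ] Elem N} {w : κ → K →L[ℂ] H} (hw : IsParseval w)
    (h : ∀ i, IsIntertwiner f (w i)) : IsNormalHom f := by
  rintro ω ⟨ξ, η, hξ, hη, hs⟩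
  have hsum : ∀ ζ : ℕ → K, Summable (fun n => ‖ζ n‖ ^ 2) →
      Summable fun p : ℕ × κ => ‖w p.2 (ζ p.1)‖ ^ 2 := by
    intro ζ hζ
    rw [summable_prod_of_nonneg (fun _ => by positivity)]
    refine ⟨fun n => (hw (ζ n)).summable, ?_⟩
    simpa only [(hw _).tsum_eq] using hζ
  refine IsNormalFunctional.of_hasSum (hsum ξ hξ) (hsum η hη) fun x => ?_
  have h1 : Summable fun p : ℕ × κ =>
      ⟪w p.2 (ξ p.1), (x : H →L[ℂ] H) (w p.2 (η p.1))⟫_ℂ := by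
    have h2 : Summable fun p : ℕ × κ => ‖(x : H →L[ℂ] H)‖ *
        (‖w p.2 (ξ p.1)‖ ^ 2 + ‖w p.2 (η p.1)‖ ^ 2) := ((hsum ξ hξ).add (hsum η hη)).mul_left _
    refine Summable.of_norm_bounded h2 fun p => ?_
    calc _ ≤ ‖w p.2 (ξ p.1)‖ * (‖(x : H →L[ℂ] H)‖ * ‖w p.2 (η p.1)‖) :=
          (norm_inner_le_norm _ _).trans (by gcongr; exact ContinuousLinearMap.le_opNorm _ _)
      _ = ‖(x : H →L[ℂ] H)‖ * (‖w p.2 (ξ p.1)‖ * ‖w p.2 (η p.1)‖) := by ring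
      _ ≤ _ := by
        gcongr
        nlinarith [sq_nonneg (‖w p.2 (ξ p.1)‖ - ‖w p.2 (η p.1)‖), sq_nonneg (‖w p.2 (ξ p.1)‖),
          sq_nonneg (‖w p.2 (η p.1)‖)]
  have h3 : HasSum (fun n => ⟪ξ n, (f x : K →L[ℂ] K) (η n)⟫_ℂ) _ :=
    h1.hasSum.prod_fiberwise fun n => by
      convert hw.hasSum_inner (ξ n) ((f x : K →L[ℂ] K) (η n)) using 3 with i
      exact (h i x (η n)).symm
  have h4 := (hs (f x)).unique h3
  change HasSum _ (ω (f x))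
  rw [h4]
  exact h1.hasSum

theorem IsSpatial.isNormalHom {M : VonNeumannAlgebra H} {N : VonNeumannAlgebra K}
    {f : Elem M →⋆ₐ[ℂ] Elem N} (hf : IsSpatial f) : IsNormalHom f := by
  obtain ⟨κ, w, hw, h⟩ := hf
  exact hw.isNormalHom h

end Spatial

/-! ### Construction of a homomorphism from its generators -/

section Construction

variable {H : Type*} [NormedAddCommGroup H] [InnerProductSpace ℂ H] [CompleteSpace H]
variable {K : Type*} [NormedAddCommGroup K] [InnerProductSpace ℂ K] [CompleteSpace K]
variable {κ : Type*}

/-- The operator `∑ᵢ wᵢ* x wᵢ`. -/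
def IsParseval.reduce {w : κ → K →L[ℂ] H} (hw : IsParseval w) (x : H →L[ℂ] H) : K →L[ℂ] K :=
  hw.isometry.adjoint ∘L diag κ x ∘L hw.isometry

/-- The computation is ∑ⱼ wᵢ wⱼ* x wⱼ = x wᵢ ∑ⱼ wⱼ* wⱼ = x wᵢ. -/
theorem IsParseval.apply_reduce {w : κ → K →L[ℂ] H} (hw : IsParseval w) {x : H →L[ℂ] H}
    (hx : ∀ i j, x * (w i ∘L (w j).adjoint) = (w i ∘L (w j).adjoint) * x) (i : κ) (η : K) :
    w i (hw.reduce x η) = x (w i η) := by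
  have h1 := ((hasSum_single (diag κ x (hw.isometry η))).mapL hw.isometry.adjoint).mapL (w i)
  refine h1.unique ?_
  have h2 := ((hw.hasSum η).mapL (w i)).mapL x
  convert h2 using 2 with j
  have h3 : hw.isometry.adjoint (single j (x (w j η))) = (w j).adjoint (x (w j η)) := by
    refine ext_inner_right ℂ fun ζ => ?_
    rw [ContinuousLinearMap.adjoint_inner_left, ContinuousLinearMap.adjoint_inner_left,
      inner_single_left]
    rfl
  exact (congrArg (w i) h3).trans (DFunLike.congr_fun (hx i j) (w j η)).symm

theorem IsParseval.inner_reduce {w : κ → K →L[ℂ] H} (hw : IsParseval w) (x : H →L[ℂ] H)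
    (ξ η : K) : ⟪ξ, hw.reduce x η⟫_ℂ = ⟪hw.reduce (star x) ξ, η⟫_ℂ := by
  simp only [IsParseval.reduce, ContinuousLinearMap.comp_apply,
    ContinuousLinearMap.adjoint_inner_right, ContinuousLinearMap.adjoint_inner_left,
    ContinuousLinearMap.star_eq_adjoint]
  rw [← diag_adjoint, ContinuousLinearMap.adjoint_inner_left]

/-- For y in the commutant of N, the operators wᵢ y wⱼ* commute with S, hence with everything S
generates. The case y = 1 makes the wᵢ intertwine x with ∑ wᵢ* x wᵢ; general y shows that this
operator commutes with the commutant of N, so it lies in N. -/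
theorem IsParseval.exists_hom {w : κ → K →L[ℂ] H} (hw : IsParseval w) {S : Set (H →L[ℂ] H)}
    {N : VonNeumannAlgebra K}
    (hS : ∀ s ∈ S, ∃ t : K →L[ℂ] K, t ∈ N.toStarSubalgebra ∧ (∀ i η, w i (t η) = s (w i η)) ∧
      ∀ i η, w i (star t η) = star s (w i η)) :
    ∃ Φ : Elem (generated S) →⋆ₐ[ℂ] Elem N, ∀ i, IsIntertwiner Φ (w i) := by
  have hadj : ∀ s ∈ S, ∀ t : K →L[ℂ] K, (∀ i η, w i (star t η) = star s (w i η)) →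
      ∀ j ξ, (w j).adjoint (s ξ) = t ((w j).adjoint ξ) := by
    intro s _ t ht j ξ
    refine ext_inner_right ℂ fun η => ?_
    rw [ContinuousLinearMap.adjoint_inner_left, ← ContinuousLinearMap.adjoint_inner_right,
      ← ContinuousLinearMap.star_eq_adjoint, ← ht, ← ContinuousLinearMap.adjoint_inner_left,
      ContinuousLinearMap.star_eq_adjoint, ContinuousLinearMap.adjoint_inner_right]
  have hstar : ∀ s ∈ S, ∃ t : K →L[ℂ] K, t ∈ N.toStarSubalgebra ∧
      (∀ i η, w i (t η) = star s (w i η)) ∧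
      ∀ j ξ, (w j).adjoint (star s ξ) = t ((w j).adjoint ξ) := by
    intro s hs
    obtain ⟨t, htN, ht, ht'⟩ := hS s hs
    refine ⟨star t, star_mem htN, ht', fun j ξ => ?_⟩
    refine ext_inner_right ℂ fun η => ?_
    rw [ContinuousLinearMap.adjoint_inner_left, ContinuousLinearMap.star_eq_adjoint,
      ContinuousLinearMap.adjoint_inner_left, ← ht, ContinuousLinearMap.star_eq_adjoint,
      ContinuousLinearMap.adjoint_inner_left, ContinuousLinearMap.adjoint_inner_left]
  have hcomm : ∀ y : K →L[ℂ] K, y ∈ Set.centralizer (N.toStarSubalgebra : Set (K →L[ℂ] K)) →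
      ∀ x ∈ (generated S).toStarSubalgebra, ∀ i j,
      x * (w i ∘L y ∘L (w j).adjoint) = (w i ∘L y ∘L (w j).adjoint) * x := by
    intro y hy x hx i j
    refine mem_commutant_generated hx (fun s hs => ?_) fun s hs => ?_
    · obtain ⟨t, htN, ht, ht'⟩ := hS s hs
      ext ξ
      change w i (y ((w j).adjoint (s ξ))) = s (w i (y ((w j).adjoint ξ)))
      rw [hadj s hs t ht', ← ht]
      exact congrArg (w i) (DFunLike.congr_fun (hy t htN) _).symm
    · obtain ⟨t, htN, ht, ht'⟩ := hstar s hs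
      ext ξ
      change w i (y ((w j).adjoint (star s ξ))) = star s (w i (y ((w j).adjoint ξ)))
      rw [ht', ← ht]
      exact congrArg (w i) (DFunLike.congr_fun (hy t htN) _).symm
  have hred : ∀ x ∈ (generated S).toStarSubalgebra, ∀ i η,
      w i (hw.reduce x η) = x (w i η) := fun x hx =>
    hw.apply_reduce fun i j => hcomm 1 (Set.one_mem_centralizer) x hx i j
  have hmem : ∀ x ∈ (generated S).toStarSubalgebra, hw.reduce x ∈ N.toStarSubalgebra := by
    intro x hx
    suffices h : hw.reduce x ∈ Set.centralizer (Set.centralizer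
        (N.toStarSubalgebra : Set (K →L[ℂ] K))) from N.centralizer_centralizer'.subset h
    intro y hy
    refine ContinuousLinearMap.ext fun η => hw.ext fun i => ?_
    change w i (y (hw.reduce x η)) = w i (hw.reduce x (y η))
    rw [hred x hx]
    have h1 := ((hw.hasSum (hw.reduce x η)).mapL y).mapL (w i)
    have h2 := (((hw.hasSum η).mapL y).mapL (w i)).mapL x
    refine h1.unique ?_
    convert h2 using 2 with j
    rw [hred x hx]
    exact (DFunLike.congr_fun (hcomm y hy x hx i j) (w j η)).symm
  -- The unit and the algebra operations are checked after applying the jointly injective wᵢ; the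
  -- adjoint is read off from the symmetric form of ∑ wᵢ* x wᵢ.
  refine ⟨{ toFun := fun x => ⟨hw.reduce x, hmem x x.2⟩
            map_one' := ?_
            map_mul' := fun x y => ?_
            map_zero' := ?_
            map_add' := fun x y => ?_
            commutes' := fun c => ?_
            map_star' := fun x => ?_ }, fun i x η => hred x x.2 i η⟩
  · refine Subtype.ext (ContinuousLinearMap.ext fun η => hw.ext fun i => ?_)
    exact hred 1 (one_mem _) i η
  · refine Subtype.ext (ContinuousLinearMap.ext fun η => hw.ext fun i => ?_)
    refine (hred _ (x * y).2 i η).trans ?_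
    change _ = w i (hw.reduce x (hw.reduce y η))
    rw [hred _ x.2, hred _ y.2]
    rfl
  · refine Subtype.ext (ContinuousLinearMap.ext fun η => hw.ext fun i => ?_)
    refine (hred _ (0 : Elem (generated S)).2 i η).trans ?_
    simp
  · refine Subtype.ext (ContinuousLinearMap.ext fun η => hw.ext fun i => ?_)
    refine (hred _ (x + y).2 i η).trans ?_
    change _ = w i (hw.reduce x η + hw.reduce y η)
    rw [map_add, hred _ x.2, hred _ y.2]
    rfl
  · refine Subtype.ext (ContinuousLinearMap.ext fun η => hw.ext fun i => ?_)
    refine (hred _ (algebraMap ℂ (Elem (generated S)) c).2 i η).trans ?_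
    simp [Algebra.algebraMap_eq_smul_one]
  · refine Subtype.ext (ContinuousLinearMap.ext fun η => ext_inner_right ℂ fun ξ => ?_)
    refine (hw.inner_reduce x η ξ).symm.trans ?_
    exact (ContinuousLinearMap.adjoint_inner_left _ _ _).symm

end Construction

/-! ### Tensor products of Parseval families -/

section TensorOfSpatial

theorem hasSum_prod_mul {κ₁ κ₂ : Type*} {f : κ₁ → ℂ} {g : κ₂ → ℂ} {a b : ℂ} (hf : HasSum f a)
    (hg : HasSum g b) : HasSum (fun p : κ₁ × κ₂ => f p.1 * g p.2) (a * b) :=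
  HasSum.mul hf hg (summable_mul_of_summable_norm hf.summable.norm hg.summable.norm)

theorem norm_vtmul {H : Type*} [NormedAddCommGroup H] [InnerProductSpace ℂ H]
    {K : Type*} [NormedAddCommGroup K] [InnerProductSpace ℂ K] (ξ : H) (η : K) :
    ‖vtmul ξ η‖ = ‖ξ‖ * ‖η‖ := by
  simp [vtmul]

variable {H₁ : Type*} [NormedAddCommGroup H₁] [InnerProductSpace ℂ H₁]
  {H₂ : Type*} [NormedAddCommGroup H₂] [InnerProductSpace ℂ H₂]
  {K₁ : Type*} [NormedAddCommGroup K₁] [InnerProductSpace ℂ K₁]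
  {K₂ : Type*} [NormedAddCommGroup K₂] [InnerProductSpace ℂ K₂]

/-- The tensor product of two operators. -/
def clmTensor (S : H₁ →L[ℂ] K₁) (T : H₂ →L[ℂ] K₂) : HTensor H₁ H₂ →L[ℂ] HTensor K₁ K₂ :=
  (TensorProduct.mapL S T).completion

theorem clmTensor_vtmul (S : H₁ →L[ℂ] K₁) (T : H₂ →L[ℂ] K₂) (ξ : H₁) (η : H₂) :
    clmTensor S T (vtmul ξ η) = vtmul (S ξ) (T η) := by
  simp [clmTensor, vtmul, TensorProduct.mapL_apply]

theorem hasSum_inner_clmTensor {κ₁ κ₂ : Type*} {w₁ : κ₁ → K₁ →L[ℂ] H₁} {w₂ : κ₂ → K₂ →L[ℂ] H₂}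
    (h₁ : IsParseval w₁) (h₂ : IsParseval w₂) (ξ ξ' : K₁) (η η' : K₂) :
    HasSum (fun p : κ₁ × κ₂ => ⟪clmTensor (w₁ p.1) (w₂ p.2) (vtmul ξ η),
      clmTensor (w₁ p.1) (w₂ p.2) (vtmul ξ' η')⟫_ℂ) ⟪vtmul ξ η, vtmul ξ' η'⟫_ℂ := by
  have a := h₁.hasSum_inner ξ ξ'
  have b := h₂.hasSum_inner η η'
  have c := hasSum_prod_mul a b
  rw [← inner_vtmul] at c
  refine c.congr_fun fun p => ?_
  rw [clmTensor_vtmul, clmTensor_vtmul, inner_vtmul]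

theorem IsParseval.tensor {κ₁ κ₂ : Type*} {w₁ : κ₁ → K₁ →L[ℂ] H₁} {w₂ : κ₂ → K₂ →L[ℂ] H₂}
    (h₁ : IsParseval w₁) (h₂ : IsParseval w₂) :
    IsParseval fun p : κ₁ × κ₂ => clmTensor (w₁ p.1) (w₂ p.2) := by
  refine isParseval_of_span span_vtmul_dense ?_
  rintro _ ⟨p, rfl⟩ _ ⟨q, rfl⟩
  exact hasSum_inner_clmTensor h₁ h₂ p.1 q.1 p.2 q.2

theorem adjoint_creation_vtmul [CompleteSpace H₁] (η : H₂) (ξ : H₁) (η' : H₂) :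
    (creation η : H₁ →L[ℂ] HTensor H₁ H₂).adjoint (vtmul ξ η') = ⟪η, η'⟫_ℂ • ξ := by
  refine ext_inner_left ℂ fun ζ => ?_
  rw [ContinuousLinearMap.adjoint_inner_right, creation_apply, inner_vtmul, inner_smul_right,
    mul_comm]

/-- This is the decomposition of H₁ ⊗ H₂ into the orthogonal copies H₁ ⊗ bᵢ. Through it a ↦ a ⊗ 1
becomes a diagonal amplification. -/
theorem isParseval_adjoint_creation [CompleteSpace H₁] {ι : Type*} (b : HilbertBasis ι ℂ H₂) :
    IsParseval fun i => (creation (b i) : H₁ →L[ℂ] HTensor H₁ H₂).adjoint := by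
  refine isParseval_of_span span_vtmul_dense ?_
  rintro _ ⟨⟨ξ, η⟩, rfl⟩ _ ⟨⟨ξ', η'⟩, rfl⟩
  simp only [adjoint_creation_vtmul, inner_vtmul, inner_smul_left, inner_smul_right,
    inner_conj_symm]
  refine ((b.hasSum_inner_mul_inner η η').mul_left ⟪ξ, ξ'⟫_ℂ).congr_fun fun i => ?_
  ring

theorem adjoint_creation_opTensor_one [CompleteSpace H₁] (η : H₂) (x : H₁ →L[ℂ] H₁) (ζ : HTensor H₁ H₂) :
    (creation η : H₁ →L[ℂ] HTensor H₁ H₂).adjoint (opTensor x 1 ζ) =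
      x ((creation η : H₁ →L[ℂ] HTensor H₁ H₂).adjoint ζ) := by
  refine DFunLike.congr_fun (f := (creation η : H₁ →L[ℂ] HTensor H₁ H₂).adjoint ∘L opTensor x 1)
    (g := x ∘L (creation η : H₁ →L[ℂ] HTensor H₁ H₂).adjoint) (op_ext fun ξ η' => ?_) ζ
  simp only [ContinuousLinearMap.comp_apply, opTensor_vtmul, adjoint_creation_vtmul, map_smul]
  rfl

end TensorOfSpatial

/-! ### Tensor products of spatial homomorphisms -/

section TensorHom

variable {H₁ : Type*} [NormedAddCommGroup H₁] [InnerProductSpace ℂ H₁] [CompleteSpace H₁]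
  {H₂ : Type*} [NormedAddCommGroup H₂] [InnerProductSpace ℂ H₂] [CompleteSpace H₂]
  {K₁ : Type*} [NormedAddCommGroup K₁] [InnerProductSpace ℂ K₁] [CompleteSpace K₁]
  {K₂ : Type*} [NormedAddCommGroup K₂] [InnerProductSpace ℂ K₂] [CompleteSpace K₂]
  {M₁ : VonNeumannAlgebra H₁} {M₂ : VonNeumannAlgebra H₂}
  {N₁ : VonNeumannAlgebra K₁} {N₂ : VonNeumannAlgebra K₂}

/-- The operators w₁ ⊗ w₂ form a Parseval family which intertwines elementary tensors, and
elementary tensors generate; this is all that `IsParseval.exists_hom` needs. -/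
theorem IsSpatial.exists_tensor {α : Elem M₁ →⋆ₐ[ℂ] Elem N₁} {β : Elem M₂ →⋆ₐ[ℂ] Elem N₂}
    (hα : IsSpatial α) (hβ : IsSpatial β) :
    ∃ Φ : Elem (vnTensor M₁ M₂) →⋆ₐ[ℂ] Elem (vnTensor N₁ N₂), IsTensorHom α β Φ ∧
      IsSpatial Φ := by
  obtain ⟨κ₁, w₁, h₁, i₁⟩ := hα
  obtain ⟨κ₂, w₂, h₂, i₂⟩ := hβ
  have key : ∀ (a : Elem M₁) (b : Elem M₂) (p : κ₁ × κ₂) (ζ : HTensor K₁ K₂),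
      clmTensor (w₁ p.1) (w₂ p.2) (opTensor (α a : K₁ →L[ℂ] K₁) (β b : K₂ →L[ℂ] K₂) ζ) =
        opTensor (a : H₁ →L[ℂ] H₁) (b : H₂ →L[ℂ] H₂) (clmTensor (w₁ p.1) (w₂ p.2) ζ) := by
    intro a b p ζ
    refine DFunLike.congr_fun (f := clmTensor (w₁ p.1) (w₂ p.2) ∘L
      opTensor (α a : K₁ →L[ℂ] K₁) (β b : K₂ →L[ℂ] K₂)) (g := opTensor (a : H₁ →L[ℂ] H₁)
        (b : H₂ →L[ℂ] H₂) ∘L clmTensor (w₁ p.1) (w₂ p.2)) (op_ext fun ξ η => ?_) ζ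
    simp only [ContinuousLinearMap.comp_apply, opTensor_vtmul, clmTensor_vtmul, i₁ p.1 a ξ,
      i₂ p.2 b η]
  have hP := h₁.tensor h₂
  obtain ⟨Φ, hΦ⟩ : ∃ Φ : Elem (vnTensor M₁ M₂) →⋆ₐ[ℂ] Elem (vnTensor N₁ N₂),
      ∀ p : κ₁ × κ₂, IsIntertwiner Φ (clmTensor (w₁ p.1) (w₂ p.2)) := hP.exists_hom (S := {x | ∃ a ∈ M₁, ∃ b ∈ M₂, x = opTensor a b})
    (N := vnTensor N₁ N₂) (by
      rintro _ ⟨a, ha, b, hb, rfl⟩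
      refine ⟨_, (tmul (α ⟨a, ha⟩) (β ⟨b, hb⟩)).2, fun i ζ => key ⟨a, ha⟩ ⟨b, hb⟩ i ζ,
        fun i ζ => ?_⟩
      have := key (star ⟨a, ha⟩) (star ⟨b, hb⟩) i ζ
      rw [map_star, map_star] at this
      rw [star_opTensor]
      exact (congrArg (fun T => clmTensor (w₁ i.1) (w₂ i.2) (T ζ)) (star_opTensor _ _)).trans this)
  have hs : IsSpatial Φ := hP.isSpatial hΦ (Equiv.refl _)
  refine ⟨Φ, ⟨hs.isNormalHom, fun a b => ?_⟩, hs⟩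
  refine Subtype.ext (ContinuousLinearMap.ext fun ζ => hP.ext fun p => ?_)
  rw [hΦ p (tmul a b) ζ]
  exact (key a b p ζ).symm

theorem isSpatial_id (M : VonNeumannAlgebra H₁) : IsSpatial (StarAlgHom.id ℂ (Elem M)) := by
  refine IsParseval.isSpatial (κ := PUnit) (w := fun _ => 1) (fun η => ?_) (fun i x η => rfl)
    (Equiv.refl _)
  simp

theorem isNormalHom_id (M : VonNeumannAlgebra H₁) : IsNormalHom (StarAlgHom.id ℂ (Elem M)) :=
  (isSpatial_id M).isNormalHom

/-- A *-homomorphism given by conjugating with a unitary is spatial. -/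
theorem isSpatial_of_unitary {f : Elem M₁ →⋆ₐ[ℂ] Elem N₁} (U : H₁ ≃ₗᵢ[ℂ] K₁)
    (h : ∀ (x : Elem M₁) (η : K₁),
      (f x : K₁ →L[ℂ] K₁) η = U ((x : H₁ →L[ℂ] H₁) (U.symm η))) : IsSpatial f := by
  refine IsParseval.isSpatial (κ := PUnit)
    (w := fun _ => (U.symm.toContinuousLinearEquiv : K₁ →L[ℂ] H₁)) (fun η => ?_)
    (fun i x η => ?_) (Equiv.refl _)
  · simp
  · change U.symm _ = _
    rw [h]
    simp

/-- The *-homomorphism `a ↦ a ⊗ 1`. -/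
def tmulLeft (M : VonNeumannAlgebra H₁) (N : VonNeumannAlgebra H₂) :
    Elem M →⋆ₐ[ℂ] Elem (vnTensor M N) :=
  StarAlgHom.codRestrict ((amplify H₂).comp M.toStarSubalgebra.subtype)
    (vnTensor M N).toStarSubalgebra fun a => (tmul a (1 : Elem N)).2

theorem tmulLeft_apply (M : VonNeumannAlgebra H₁) (N : VonNeumannAlgebra H₂) (a : Elem M) :
    tmulLeft M N a = tmul a 1 := rfl

theorem isNormalHom_tmulLeft (M : VonNeumannAlgebra H₁) (N : VonNeumannAlgebra H₂) :
    IsNormalHom (tmulLeft M N) := by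
  obtain ⟨ι, b, hb⟩ := exists_hilbertBasis ℂ H₂
  exact (isParseval_adjoint_creation (H₁ := H₁) b).isNormalHom fun i x ζ =>
    adjoint_creation_opTensor_one (b i) (x : H₁ →L[ℂ] H₁) ζ

theorem IsTensorHom.comp {L₁ : Type*} [NormedAddCommGroup L₁] [InnerProductSpace ℂ L₁]
    [CompleteSpace L₁] {L₂ : Type*} [NormedAddCommGroup L₂] [InnerProductSpace ℂ L₂]
    [CompleteSpace L₂] {P₁ : VonNeumannAlgebra L₁} {P₂ : VonNeumannAlgebra L₂}
    {α : Elem M₁ →⋆ₐ[ℂ] Elem N₁} {β : Elem M₂ →⋆ₐ[ℂ] Elem N₂}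
    {α' : Elem N₁ →⋆ₐ[ℂ] Elem P₁} {β' : Elem N₂ →⋆ₐ[ℂ] Elem P₂}
    {Φ : Elem (vnTensor M₁ M₂) →⋆ₐ[ℂ] Elem (vnTensor N₁ N₂)}
    {Φ' : Elem (vnTensor N₁ N₂) →⋆ₐ[ℂ] Elem (vnTensor P₁ P₂)}
    (h' : IsTensorHom α' β' Φ') (h : IsTensorHom α β Φ) :
    IsTensorHom (α'.comp α) (β'.comp β) (Φ'.comp Φ) :=
  ⟨h'.1.comp h.1, fun a b => by
    simp only [StarAlgHom.comp_apply, h.2, h'.2]⟩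

theorem IsTensorHom.eq_id {α : Elem M₁ →⋆ₐ[ℂ] Elem M₁} {β : Elem M₂ →⋆ₐ[ℂ] Elem M₂}
    {Φ : Elem (vnTensor M₁ M₂) →⋆ₐ[ℂ] Elem (vnTensor M₁ M₂)} (h : IsTensorHom α β Φ)
    (hα : ∀ a, α a = a) (hβ : ∀ b, β b = b) : ∀ x, Φ x = x := by
  have : Φ = StarAlgHom.id ℂ _ := IsNormalHom.vnTensor_ext h.1 (isNormalHom_id _) fun a b => by
    rw [h.2, hα, hβ]
    rfl
  intro x
  rw [this]
  rfl

end TensorHom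

/-! ### Bessel sets of operators -/

section Bessel

variable {H : Type*} [NormedAddCommGroup H] [InnerProductSpace ℂ H]
variable {K : Type*} [NormedAddCommGroup K] [InnerProductSpace ℂ K]

theorem norm_column_apply_le {κ : Type*} (w : κ → K →L[ℂ] H) (C : ℝ) (hC : 0 ≤ C)
    (h : ∀ (η : K) (F : Finset κ), ∑ i ∈ F, ‖w i η‖ ^ 2 ≤ (C * ‖η‖) ^ 2) (η : K) :
    ‖column w C hC h η‖ ≤ C * ‖η‖ := by
  refine lp.norm_le_of_forall_sum_le (by norm_num) (by positivity) fun s => ?_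
  simpa [column_apply] using h η s

theorem norm_adjoint_apply_le [CompleteSpace H] [CompleteSpace K] {V : K →L[ℂ] H}
    (hV : ∀ η, ‖V η‖ ≤ ‖η‖) (ξ : H) : ‖V.adjoint ξ‖ ≤ ‖ξ‖ := by
  have h1 : ‖V‖ ≤ 1 := V.opNorm_le_bound zero_le_one fun η => by simpa using hV η
  have h2 := V.adjoint.le_opNorm ξ
  rw [LinearIsometryEquiv.norm_map] at h2
  nlinarith [norm_nonneg ξ]

/-- For P = V*V ≤ 1 this is (1 - P)² + P = 1 - P + P² ≤ 1. It leaves room to enlarge a Bessel set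
with column V by an operator dominated by 1 - P. -/
theorem norm_sub_adjoint_apply_le [CompleteSpace H] [CompleteSpace K] {V : K →L[ℂ] H}
    (hV : ∀ η, ‖V η‖ ≤ ‖η‖) (η : K) :
    ‖η - V.adjoint (V η)‖ ^ 2 + ‖V η‖ ^ 2 ≤ ‖η‖ ^ 2 := by
  have h1 : ‖η - V.adjoint (V η)‖ ^ 2 =
      ‖η‖ ^ 2 - 2 * RCLike.re ⟪η, V.adjoint (V η)⟫_ℂ + ‖V.adjoint (V η)‖ ^ 2 :=
    norm_sub_sq (𝕜 := ℂ) η (V.adjoint (V η))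
  rw [ContinuousLinearMap.adjoint_inner_right, inner_self_eq_norm_sq] at h1
  have h3 := pow_le_pow_left₀ (norm_nonneg _) (norm_adjoint_apply_le hV (V η)) 2
  linarith

/-- Sets of operators with `∑ w* w ≤ 1`. -/
def IsBesselSet (m : Set (K →L[ℂ] H)) : Prop :=
  ∀ F : Finset (K →L[ℂ] H), (F : Set (K →L[ℂ] H)) ⊆ m → ∀ η, ∑ w ∈ F, ‖w η‖ ^ 2 ≤ ‖η‖ ^ 2

theorem exists_maximal_isBesselSet (I : Set (K →L[ℂ] H)) :
    ∃ m, Maximal (· ∈ {m : Set (K →L[ℂ] H) | m ⊆ I ∧ IsBesselSet m}) m := by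
  refine zorn_subset _ fun c hc hchain => ?_
  rcases c.eq_empty_or_nonempty with rfl | hne
  · refine ⟨∅, ⟨Set.empty_subset _, fun F hF η => ?_⟩, by simp⟩
    have : F = ∅ := by simpa using hF
    simp [this]
  · refine ⟨⋃₀ c, ⟨Set.sUnion_subset fun s hs => (hc hs).1, fun F hF η => ?_⟩,
      fun s hs => Set.subset_sUnion_of_mem hs⟩
    obtain ⟨s, hs, hFs⟩ := hchain.directedOn.exists_mem_subset_of_finite_of_subset_sUnion hne
      F.finite_toSet hF
    exact (hc hs).2 F hFs η

theorem IsBesselSet.insert {m : Set (K →L[ℂ] H)} {T : K →L[ℂ] H}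
    (h : ∀ F : Finset (K →L[ℂ] H), (F : Set (K →L[ℂ] H)) ⊆ m → ∀ η,
      ‖T η‖ ^ 2 + ∑ w ∈ F, ‖w η‖ ^ 2 ≤ ‖η‖ ^ 2) : IsBesselSet (insert T m) := by
  classical
  intro F hF η
  refine le_trans ?_ (h (F.erase T) (fun w hw => ?_) η)
  · by_cases hTF : T ∈ F
    · rw [Finset.add_sum_erase F (fun w => ‖w η‖ ^ 2) hTF]
    · rw [Finset.erase_eq_of_notMem hTF]
      nlinarith [sq_nonneg ‖T η‖]
  · exact (hF (Finset.mem_of_mem_erase hw)).resolve_left (Finset.ne_of_mem_erase hw)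

/-- Bessel sets are sets, so an operator already present cannot be added again and must be rescaled.
If all multiples with scalar in (0, 1] belonged to m, infinitely many of them bounded below at one
vector would break the Bessel bound. -/
theorem exists_smul_notMem {m : Set (K →L[ℂ] H)} (hm : IsBesselSet m) {T : K →L[ℂ] H}
    (hT : T ≠ 0) : ∃ c : ℝ, 0 < c ∧ c ≤ 1 ∧ (c : ℂ) • T ∉ m := by
  by_contra! h
  obtain ⟨η, hη⟩ : ∃ η, T η ≠ 0 := by
    by_contra! h0
    exact hT (ContinuousLinearMap.ext h0)
  -- Distinct scalars in [1/2, 1], so that each multiple contributes at least ‖T η‖² / 4.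
  let c : ℕ → ℝ := fun k => 1 / 2 + 1 / (k + 2)
  have hc1 : ∀ k, 1 / 2 ≤ c k := fun k => by
    have : (0 : ℝ) ≤ 1 / ((k : ℝ) + 2) := by positivity
    simp only [c]
    linarith
  have hc2 : ∀ k, c k ≤ 1 := fun k => by
    have : 1 / ((k : ℝ) + 2) ≤ 1 / 2 := one_div_le_one_div_of_le (by norm_num) (by
      have : (0 : ℝ) ≤ k := by positivity
      linarith)
    simp only [c]
    linarith
  have hinj : Function.Injective fun k => (c k : ℂ) • T := by
    intro k l hkl
    have h1 := smul_left_injective ℂ hT hkl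
    have h2 : c k = c l := by exact_mod_cast h1
    have h3 : (k : ℝ) + 2 = l + 2 := by simpa [c] using h2
    exact_mod_cast add_right_cancel h3
  have hn : ∀ n : ℕ, n * (‖T η‖ ^ 2 / 4) ≤ ‖η‖ ^ 2 := by
    intro n
    refine le_trans ?_ (hm ((Finset.range n).map ⟨_, hinj⟩) ?_ η)
    · have e : (n : ℝ) * (‖T η‖ ^ 2 / 4) = ∑ _k ∈ Finset.range n, ‖T η‖ ^ 2 / 4 := by simp
      rw [Finset.sum_map, e]
      refine Finset.sum_le_sum fun k _ => ?_
      simp only [Function.Embedding.coeFn_mk, _root_.smul_apply, norm_smul, Complex.norm_real,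
        mul_pow, Real.norm_eq_abs, sq_abs]
      nlinarith [hc1 k, sq_nonneg ‖T η‖, mul_le_mul (hc1 k) (hc1 k) (by norm_num)
        (by linarith [hc1 k])]
    · intro w hw
      obtain ⟨k, -, rfl⟩ := Finset.mem_map.mp hw
      exact h (c k) (by linarith [hc1 k]) (hc2 k)
  have hpos : 0 < ‖T η‖ ^ 2 / 4 := by positivity
  obtain ⟨n, hn'⟩ := exists_nat_gt (‖η‖ ^ 2 / (‖T η‖ ^ 2 / 4))
  rw [div_lt_iff₀ hpos] at hn'
  exact absurd (hn n) (not_le.mpr hn')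

end Bessel

/-! ### A separating family of intertwiners can be made Parseval -/

section Separating

variable {H : Type u} [NormedAddCommGroup H] [InnerProductSpace ℂ H] [CompleteSpace H]
variable {K : Type v} [NormedAddCommGroup K] [InnerProductSpace ℂ K] [CompleteSpace K]

theorem IsIntertwiner.adjoint_apply {M : VonNeumannAlgebra H} {N : VonNeumannAlgebra K}
    {f : Elem M →⋆ₐ[ℂ] Elem N} {w : K →L[ℂ] H} (hw : IsIntertwiner f w) (x : Elem M) (ξ : H) :
    w.adjoint ((x : H →L[ℂ] H) ξ) = (f x : K →L[ℂ] K) (w.adjoint ξ) := by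
  refine ext_inner_right ℂ fun η => ?_
  have h := hw (star x) η
  rw [map_star] at h
  have e1 : ((star (f x) : Elem N) : K →L[ℂ] K) = (f x : K →L[ℂ] K).adjoint := rfl
  have e2 : ((star x : Elem M) : H →L[ℂ] H) = (x : H →L[ℂ] H).adjoint := rfl
  rw [e1, e2] at h
  rw [ContinuousLinearMap.adjoint_inner_left, ← ContinuousLinearMap.adjoint_inner_right, ← h,
    ← ContinuousLinearMap.adjoint_inner_left, ContinuousLinearMap.adjoint_inner_right]

set_option maxHeartbeats 1000000 in
/-- A *-homomorphism with a separating family of intertwiners is spatial. -/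
theorem isSpatial_of_separating {M : VonNeumannAlgebra H} {N : VonNeumannAlgebra K}
    {f : Elem M →⋆ₐ[ℂ] Elem N}
    (h : ∀ η : K, (∀ w : K →L[ℂ] H, IsIntertwiner f w → w η = 0) → η = 0) : IsSpatial f := by
  -- The column V of a maximal Bessel set of intertwiners satisfies V*V ≤ 1; maximality will force
  -- V*V = 1.
  obtain ⟨m, ⟨hmI, hmB⟩, hmax⟩ := exists_maximal_isBesselSet {w : K →L[ℂ] H | IsIntertwiner f w}
  have hbd : ∀ (η : K) (F : Finset m), ∑ i ∈ F, ‖(i : K →L[ℂ] H) η‖ ^ 2 ≤ (1 * ‖η‖) ^ 2 := by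
    intro η F
    rw [one_mul]
    have := hmB (F.map (Function.Embedding.subtype _)) (by
      intro w hw
      obtain ⟨w', -, rfl⟩ := Finset.mem_map.mp hw
      exact w'.2) η
    rwa [Finset.sum_map] at this
  obtain ⟨V, hV, hVnorm⟩ : ∃ V : K →L[ℂ] lp (fun _ : m => H) 2,
      (∀ η i, V η i = (i : K →L[ℂ] H) η) ∧ ∀ η, ‖V η‖ ≤ ‖η‖ :=
    ⟨column (fun i : m => (i : K →L[ℂ] H)) 1 zero_le_one hbd, fun _ _ => rfl,
      fun η => by simpa using norm_column_apply_le _ 1 zero_le_one hbd η⟩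
  have hVsum : ∀ η, HasSum (fun i : m => ‖(i : K →L[ℂ] H) η‖ ^ 2) (‖V η‖ ^ 2) := fun η => by
    simpa only [hV] using lp_hasSum_norm_sq (V η)
  have hVx : ∀ (x : Elem M) η, V ((f x : K →L[ℂ] K) η) = diag m (x : H →L[ℂ] H) (V η) := by
    intro x η
    refine lp.ext (funext fun i => ?_)
    rw [diag_apply, hV, hV]
    exact hmI i.2 x η
  have hVx' : ∀ (x : Elem M) v, V.adjoint (diag m (x : H →L[ℂ] H) v) =
      (f x : K →L[ℂ] K) (V.adjoint v) := by
    intro x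
    have h1 : V ∘L (f x : K →L[ℂ] K).adjoint = (diag m (x : H →L[ℂ] H)).adjoint ∘L V := by
      have e := hVx (star x)
      rw [map_star] at e
      rw [diag_adjoint]
      exact ContinuousLinearMap.ext e
    have h2 := congrArg ContinuousLinearMap.adjoint h1
    rw [ContinuousLinearMap.adjoint_comp, ContinuousLinearMap.adjoint_comp,
      ContinuousLinearMap.adjoint_adjoint, ContinuousLinearMap.adjoint_adjoint] at h2
    exact fun v => (DFunLike.congr_fun h2 v).symm
  obtain ⟨D, hDapp⟩ : ∃ D : K →L[ℂ] K, ∀ η, D η = η - V.adjoint (V η) :=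
    ⟨1 - V.adjoint ∘L V, fun η => rfl⟩
  have hDx : ∀ (x : Elem M) η, D ((f x : K →L[ℂ] K) η) = (f x : K →L[ℂ] K) (D η) := by
    intro x η
    rw [hDapp, hDapp, hVx, hVx', map_sub]
  have hDnorm : ∀ η, ‖D η‖ ^ 2 + ‖V η‖ ^ 2 ≤ ‖η‖ ^ 2 := fun η => by
    rw [hDapp]
    exact norm_sub_adjoint_apply_le hVnorm η
  -- The defect D = 1 - V*V commutes with f(M). If D ≠ 0, some intertwiner S has S D ≠ 0, and S D is
  -- again an intertwiner. Dividing by ‖S‖ gives ‖T η‖ ≤ ‖D η‖, which keeps the Bessel bound, and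
  -- the scalar c ensures T ∉ m, against maximality.
  have hD : D = 0 := by
    by_contra hne
    obtain ⟨η₀, hη₀⟩ : ∃ η, D η ≠ 0 := by
      by_contra! h0
      exact hne (ContinuousLinearMap.ext h0)
    obtain ⟨S, hS, hSη⟩ : ∃ w : K →L[ℂ] H, IsIntertwiner f w ∧ w (D η₀) ≠ 0 := by
      by_contra! h0
      exact hη₀ (h _ h0)
    have hS0 : 0 < ‖S‖ := norm_pos_iff.mpr fun h0 => hSη (by simp [h0])
    have hT0 : S ∘L D ≠ 0 := fun h0 => hSη (DFunLike.congr_fun h0 η₀)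
    have hT1 : ((‖S‖⁻¹ : ℝ) : ℂ) • (S ∘L D) ≠ 0 :=
      smul_ne_zero (by exact_mod_cast (inv_pos.mpr hS0).ne') hT0
    obtain ⟨c, hc0, hc1, hcm⟩ := exists_smul_notMem hmB hT1
    set T : K →L[ℂ] H := (c : ℂ) • ((‖S‖⁻¹ : ℝ) : ℂ) • (S ∘L D) with hT
    have hTn : ∀ η, ‖T η‖ ≤ ‖D η‖ := by
      intro η
      have e : ‖T η‖ = c * (‖S‖⁻¹ * ‖S (D η)‖) := by
        simp [hT, norm_smul, abs_of_pos hc0]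
      have h1 : ‖S‖⁻¹ * ‖S (D η)‖ ≤ ‖D η‖ := by
        rw [inv_mul_le_iff₀ hS0]
        exact S.le_opNorm _
      rw [e]
      nlinarith [norm_nonneg (D η), norm_nonneg (S (D η)), inv_pos.mpr hS0]
    refine hcm (hmax ⟨Set.insert_subset ?_ hmI, ?_⟩ (Set.subset_insert T m)
      (Set.mem_insert T m))
    · intro x η
      simp only [hT, _root_.smul_apply, ContinuousLinearMap.comp_apply, hDx, map_smul, hS x (D η)]
    · refine IsBesselSet.insert fun F hF η => ?_
      have h1 : ∑ w ∈ F, ‖w η‖ ^ 2 ≤ ‖V η‖ ^ 2 := by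
        classical
        rw [← Finset.sum_subtype_of_mem (p := (· ∈ m)) (fun w => ‖w η‖ ^ 2) hF]
        exact sum_le_hasSum _ (fun _ _ => by positivity) (hVsum η)
      have h3 := pow_le_pow_left₀ (norm_nonneg _) (hTn η) 2
      linarith [hDnorm η]
  refine ⟨m, fun i => i, fun η => ?_, fun i => hmI i.2⟩
  have h1 : ‖V η‖ ^ 2 = ‖η‖ ^ 2 := by
    have h2 : V.adjoint (V η) = η := by
      have := DFunLike.congr_fun hD η
      rw [hDapp] at this
      exact (sub_eq_zero.mp this).symm
    have h3 := norm_adjoint_apply_le hVnorm (V η)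
    rw [h2] at h3
    rw [le_antisymm (hVnorm η) h3]
  rw [← h1]
  exact hVsum η

end Separating

/-! ### Tracial vectors and the icc argument -/

section HilbertBasisLemmas

variable {E : Type*} [NormedAddCommGroup E] [InnerProductSpace ℂ E]
variable {F : Type*} [NormedAddCommGroup F] [InnerProductSpace ℂ F]
variable {ι : Type*}

theorem basis_vec_ext (b : HilbertBasis ι ℂ E) {x y : E}
    (h : ∀ i, ⟪b i, x⟫_ℂ = ⟪b i, y⟫_ℂ) : x = y :=
  b.repr.injective (lp.ext (funext fun i => by
    rw [b.repr_apply_apply, b.repr_apply_apply, h i]))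

theorem basis_inner (b : HilbertBasis ι ℂ E) [DecidableEq ι] (i j : ι) :
    ⟪b i, b j⟫_ℂ = if i = j then 1 else 0 :=
  orthonormal_iff_ite.mp b.orthonormal i j

theorem hasSum_basis (b : HilbertBasis ι ℂ E) (x : E) :
    HasSum (fun i => ⟪b i, x⟫_ℂ • b i) x := by
  simpa only [b.repr_apply_apply] using b.hasSum_repr x

/-- The isometry mapping a Hilbert basis to an orthonormal family. -/
theorem exists_linearIsometry [CompleteSpace F] (b : HilbertBasis ι ℂ E) {v : ι → F}
    (hv : Orthonormal ℂ v) : ∃ U : E →ₗᵢ[ℂ] F, ∀ i, U (b i) = v i := by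
  classical
  have hV : OrthogonalFamily ℂ (fun _ : ι => ℂ) fun i =>
      LinearIsometry.toSpanSingleton ℂ F (hv.1 i) := hv.orthogonalFamily
  refine ⟨hV.linearIsometry.comp b.repr.toLinearIsometry, fun i => ?_⟩
  change hV.linearIsometry (b.repr (b i)) = v i
  rw [b.repr_self, hV.linearIsometry_apply_single]
  simp

theorem adjoint_apply_basis_eq [CompleteSpace E] {P : Type*} [Group P] (b : HilbertBasis P ℂ E)
    {c : E →L[ℂ] E} {f : Equiv.Perm P} (h : ∀ p, c (b p) = b (f p)) (p : P) :
    c.adjoint (b p) = b (f.symm p) := by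
  classical
  refine basis_vec_ext b fun q => ?_
  rw [ContinuousLinearMap.adjoint_inner_right, h, basis_inner, basis_inner]
  simp [Equiv.eq_symm_apply]

/-- The vector state of a cyclic trace vector is tracial on the commutant. -/
theorem inner_mul_comm_of_commute [CompleteSpace E] {P : Type*} [Group P]
    (b : HilbertBasis P ℂ E) {C : P → E →L[ℂ] E} (hC : ∀ p, C p (b 1) = b p)
    (hC' : ∀ p, (C p).adjoint (b 1) = b p⁻¹) {X Y : E →L[ℂ] E} (hX : ∀ p, Commute X (C p))
    (hY : ∀ p, Commute Y (C p)) : ⟪b 1, X (Y (b 1))⟫_ℂ = ⟪b 1, Y (X (b 1))⟫_ℂ := by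
  -- Commutation with C p moves the basis vector to the other side: ⟪X* b₁, b_p⟫ = ⟪b₁, C_p X b₁⟫ =
  -- ⟪b_{p⁻¹}, X b₁⟫. The resulting sum is symmetric in X and Y under p ↦ p⁻¹.
  have key : ∀ {X Y : E →L[ℂ] E}, (∀ p, Commute X (C p)) →
      HasSum (fun p => ⟪b p⁻¹, X (b 1)⟫_ℂ * ⟪b p, Y (b 1)⟫_ℂ) ⟪b 1, X (Y (b 1))⟫_ℂ := by
    intro X Y hX
    rw [← ContinuousLinearMap.adjoint_inner_left]
    refine (b.hasSum_inner_mul_inner (X.adjoint (b 1)) (Y (b 1))).congr_fun fun p => ?_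
    rw [ContinuousLinearMap.adjoint_inner_left, ← hC', ContinuousLinearMap.adjoint_inner_left,
      ← mul_apply_eq_comp (C p), ← (hX p).eq, mul_apply_eq_comp, hC]
  refine (key hX).unique ?_
  rw [← (Equiv.inv P).hasSum_iff]
  refine (key hY).congr_fun fun p => ?_
  simp [mul_comm]

/-- For an icc group, an operator normalizing a representation only pairs with one of its
elements. -/
theorem inner_eq_zero_of_isICC [CompleteSpace E] {G : Type*} [Group G] (hG : IsICC G)
    {P : Type*} [Group P] (b : HilbertBasis P ℂ E) {C : P → E →L[ℂ] E}
    (hC : ∀ p, C p (b 1) = b p) (hC' : ∀ p, (C p).adjoint (b 1) = b p⁻¹)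
    {D : G → E →L[ℂ] E}
    (hDmul : ∀ g h, D g * D h = D (g * h))
    (hDstar : ∀ g, star (D g) = D g⁻¹) (hDC : ∀ g p, Commute (D g) (C p))
    (hDo : Orthonormal ℂ fun g => D g (b 1)) {l : E →L[ℂ] E} (hlC : ∀ p, Commute (star l) (C p))
    {s : G} (hl : ∀ r, l * D r = D (s * r * s⁻¹) * l) {h : G} (hhs : h ≠ s) :
    ⟪l (b 1), D h (b 1)⟫_ℂ = 0 := by
  have hl' : ∀ r, D r * star l = star l * D (s * r * s⁻¹) := by
    intro r
    have := congrArg star (hl r⁻¹)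
    rw [star_mul, star_mul, hDstar, hDstar] at this
    simpa [mul_assoc] using this
  -- Both l and D s carry D r to D (s r s⁻¹), so their quotient v commutes with every D r.
  set v : E →L[ℂ] E := star l * D s with hv
  have hvD : ∀ r, D r * v = v * D r := by
    intro r
    rw [hv, ← mul_assoc, hl', mul_assoc (star l), mul_assoc (star l), hDmul, hDmul,
      inv_mul_cancel_right]
  have hvC : ∀ p, Commute v (C p) := fun p => (hlC p).mul_left (hDC s p)
  set φ : G → ℂ := fun r => ⟪l (b 1), D (s * r) (b 1)⟫_ℂ with hφ
  have hφv : ∀ r, φ r = ⟪b 1, (v * D r) (b 1)⟫_ℂ := by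
    intro r
    rw [hv, mul_assoc, hDmul, mul_apply_eq_comp, ContinuousLinearMap.star_eq_adjoint,
      ContinuousLinearMap.adjoint_inner_right]
  -- Traciality of the vector state on the commutant of C, together with v commuting with D p, makes
  -- φ a class function.
  have hconj : ∀ p r, φ (p * r * p⁻¹) = φ r := by
    intro p r
    have e : v * D (p * r * p⁻¹) = D p * (v * D (r * p⁻¹)) := by
      rw [← mul_assoc (D p), hvD, mul_assoc v, hDmul, mul_assoc p]
    rw [hφv, hφv, e, mul_apply_eq_comp, inner_mul_comm_of_commute b hC hC' (hDC p)
      fun q => (hvC q).mul_left (hDC _ q), ← mul_apply_eq_comp (v * D _), mul_assoc v, hDmul,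
      inv_mul_cancel_right]
  -- Bessel's inequality for the orthonormal family D (s r) b₁.
  have hsum : Summable fun r => ‖φ r‖ ^ 2 := by
    have := (hDo.comp (s * ·) (mul_right_injective s)).inner_products_summable (l (b 1))
    refine this.congr fun r => ?_
    rw [norm_inner_symm]
    rfl
  -- A square summable function cannot take a constant nonzero value on the infinite conjugacy class
  -- of s⁻¹ h ≠ 1.
  have hz : φ (s⁻¹ * h) = 0 := by
    by_contra hne
    have hr : s⁻¹ * h ≠ 1 := fun h1 => hhs (inv_mul_eq_one.mp h1).symm
    have hpos : 0 < ‖φ (s⁻¹ * h)‖ ^ 2 := by positivity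
    have hev := hsum.tendsto_cofinite_zero.eventually (gt_mem_nhds hpos)
    refine hG _ hr ((Filter.eventually_cofinite.mp hev).subset fun r hr' => ?_)
    obtain ⟨p, rfl⟩ := isConj_iff.mp hr'
    simp only [Set.mem_ofPred_eq, hconj, lt_irrefl, not_false_eq_true]
  simpa [hφ] using hz

end HilbertBasisLemmas

section TensorBasis

variable {G : Type u}

theorem opTensor_delta2 {S T : L2 G →L[ℂ] L2 G} {a b a' b' : G} (hS : S (delta G a) = delta G a')
    (hT : T (delta G b) = delta G b') : opTensor S T (delta2 G (a, b)) = delta2 G (a', b') := by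
  rw [delta2_apply, opTensor_vtmul, hS, hT, delta2_apply]

theorem commute_opTensor {S S' T T' : L2 G →L[ℂ] L2 G} (hS : Commute S S') (hT : Commute T T') :
    Commute (opTensor S T) (opTensor S' T') := by
  rw [commute_iff_eq, opTensor_mul, opTensor_mul, hS.eq, hT.eq]

end TensorBasis

/-! ### Left and right translations -/

section RightRegular

variable {G : Type u} [Group G]

/-- The right translations `δ_h ↦ δ_{hg}`. -/
def rightReg (g : G) : L2 G →L[ℂ] L2 G :=
  (permUnitary (delta G) (Equiv.mulRight g)).toContinuousLinearEquiv

theorem rightReg_apply (g h : G) : rightReg g (delta G h) = delta G (h * g) :=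
  permUnitary_apply (delta G) (Equiv.mulRight g) h

theorem leftReg_mul (g h : G) : leftReg g * leftReg h = leftReg (g * h) :=
  basis_op_ext (delta G) fun k => by
    rw [mul_apply_eq_comp, leftReg_apply, leftReg_apply, leftReg_apply, mul_assoc]

theorem leftReg_one : leftReg (1 : G) = 1 :=
  basis_op_ext (delta G) fun k => by
    rw [leftReg_apply, one_mul]
    rfl

theorem rightReg_mul (g h : G) : rightReg g * rightReg h = rightReg (h * g) :=
  basis_op_ext (delta G) fun k => by
    rw [mul_apply_eq_comp, rightReg_apply, rightReg_apply, rightReg_apply, mul_assoc]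

theorem rightReg_one : rightReg (1 : G) = 1 :=
  basis_op_ext (delta G) fun k => by
    rw [rightReg_apply, mul_one]
    rfl

theorem leftReg_mul_rightReg (g h : G) : leftReg g * rightReg h = rightReg h * leftReg g :=
  basis_op_ext (delta G) fun k => by
    rw [mul_apply_eq_comp, mul_apply_eq_comp, rightReg_apply, leftReg_apply, leftReg_apply,
      rightReg_apply, mul_assoc]

theorem star_leftReg (g : G) : star (leftReg g) = leftReg g⁻¹ :=
  basis_op_ext (delta G) fun k => by
    rw [ContinuousLinearMap.star_eq_adjoint, adjoint_apply_basis_eq (delta G) (leftReg_apply g)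
      (f := Equiv.mulLeft g), leftReg_apply]
    rfl

theorem star_rightReg (g : G) : star (rightReg g) = rightReg g⁻¹ :=
  basis_op_ext (delta G) fun k => by
    rw [ContinuousLinearMap.star_eq_adjoint, adjoint_apply_basis_eq (delta G) (rightReg_apply g)
      (f := Equiv.mulRight g), rightReg_apply]
    rfl

end RightRegular

/-! ### Dual structures on L(G) and the vanishing of c(g;s,s) -/

section Core

variable {G : Type u} [Group G]

/-- The coefficients of `D g` in the basis `u_h ⊗ u_k`. -/
def coef (D : G → HTensor (L2 G) (L2 G) →L[ℂ] HTensor (L2 G) (L2 G)) (g h k : G) : ℂ :=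
  ⟪delta2 G (h, k), D g (delta2 G (1, 1))⟫_ℂ

/-- The images `D g` of the canonical unitaries `u_g` under a comultiplication on `L(G)` that has
the canonical trace as its Haar state and that commutes with the inner automorphisms. -/
structure IsDual (D : G → HTensor (L2 G) (L2 G) →L[ℂ] HTensor (L2 G) (L2 G)) : Prop where
  one : D 1 = 1
  mul : ∀ g h, D g * D h = D (g * h)
  star_eq : ∀ g, star (D g) = D g⁻¹
  commute : ∀ g x y, Commute (D g) (opTensor (rightReg x) (rightReg y))
  conj : ∀ s g, opTensor (leftReg s) (leftReg s) * D g =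
    D (s * g * s⁻¹) * opTensor (leftReg s) (leftReg s)
  coef_one_left : ∀ g h, g ≠ 1 → coef D g 1 h = 0
  coef_one_right : ∀ g h, g ≠ 1 → coef D g h 1 = 0
  coassoc : ∀ g h l m, ∃ c, HasSum (fun k => coef D g k l * coef D k h m) c ∧
    HasSum (fun k => coef D g h k * coef D k m l) c

variable {D : G → HTensor (L2 G) (L2 G) →L[ℂ] HTensor (L2 G) (L2 G)}

/-- Since D g commutes with all right translations, its matrix is determined by the column at δ_1 ⊗
δ_1. -/
theorem IsDual.inner_eq_coef (hD : IsDual D) (g : G) (h k x y : G) :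
    ⟪delta2 G (h, k), D g (delta2 G (x, y))⟫_ℂ = coef D g (h * x⁻¹) (k * y⁻¹) := by
  have h1 : delta2 G (x, y) = opTensor (rightReg x) (rightReg y) (delta2 G (1, 1)) :=
    (opTensor_delta2 (by rw [rightReg_apply, one_mul]) (by rw [rightReg_apply, one_mul])).symm
  have h2 : opTensor (rightReg x⁻¹) (rightReg y⁻¹) (delta2 G (h, k)) =
      delta2 G (h * x⁻¹, k * y⁻¹) :=
    opTensor_delta2 (rightReg_apply _ _) (rightReg_apply _ _)
  rw [h1, ← mul_apply_eq_comp, (hD.commute g x y).eq, mul_apply_eq_comp, inner_opTensor_right,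
    star_rightReg, star_rightReg, h2, coef]

theorem IsDual.inner_apply_apply (hD : IsDual D) (g h : G) (ξ η : HTensor (L2 G) (L2 G)) :
    ⟪D g ξ, D h η⟫_ℂ = ⟪ξ, D (g⁻¹ * h) η⟫_ℂ := by
  rw [← ContinuousLinearMap.adjoint_inner_right, ← ContinuousLinearMap.star_eq_adjoint, hD.star_eq,
    ← mul_apply_eq_comp, hD.mul]

theorem IsDual.coef_one (hD : IsDual D) [DecidableEq G] (h k : G) :
    coef D 1 h k = if (h, k) = (1, 1) then 1 else 0 := by
  rw [coef, hD.one, ← basis_inner (delta2 G)]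
  rfl

/-- Left invariance: the inner product of the vectors at (g,k) and (h,l) is c(g⁻¹h; 1, k l⁻¹), which
vanishes unless g = h. -/
theorem IsDual.orthonormal_left (hD : IsDual D) :
    Orthonormal ℂ fun p : G × G => D p.1 (delta2 G (1, p.2)) := by
  classical
  rw [orthonormal_iff_ite]
  rintro ⟨g, k⟩ ⟨h, l⟩
  rw [hD.inner_apply_apply, hD.inner_eq_coef, mul_inv_cancel]
  by_cases hgh : g = h
  · subst hgh
    rw [inv_mul_cancel, hD.coef_one]
    simp [mul_inv_eq_one]
  · rw [hD.coef_one_left _ _ fun h1 => hgh (inv_mul_eq_one.mp h1)]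
    simp [hgh]

theorem IsDual.orthonormal (hD : IsDual D) :
    Orthonormal ℂ fun g : G => D g (delta2 G (1, 1)) :=
  hD.orthonormal_left.comp (fun g => (g, 1)) fun _ _ h => congrArg Prod.fst h

theorem IsDual.conj_coef (hD : IsDual D) (g h k : G) :
    starRingEnd ℂ (coef D g h k) = coef D g⁻¹ h⁻¹ k⁻¹ := by
  rw [coef, inner_conj_symm, ← ContinuousLinearMap.adjoint_inner_right,
    ← ContinuousLinearMap.star_eq_adjoint, hD.star_eq, hD.inner_eq_coef, one_mul, one_mul]

/-- The translations `δ_g ⊗ δ_h ↦ δ_{gx} ⊗ δ_{hy}` -/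
theorem rightReg_tensor_delta2 (p : G × G) :
    opTensor (rightReg p.1) (rightReg p.2) (delta2 G 1) = delta2 G p :=
  opTensor_delta2 (by rw [rightReg_apply, one_mul]) (by rw [rightReg_apply, one_mul])

theorem adjoint_rightReg_tensor_delta2 (p : G × G) :
    (opTensor (rightReg p.1) (rightReg p.2)).adjoint (delta2 G 1) = delta2 G p⁻¹ := by
  rw [← ContinuousLinearMap.star_eq_adjoint, star_opTensor, star_rightReg, star_rightReg]
  exact rightReg_tensor_delta2 p⁻¹

/-- The icc argument with l = u_s ⊗ u_s: by equivariance under conjugation by s, it acts on the D r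
as D s does. -/
theorem IsDual.coef_self (hD : IsDual D) (hG : IsICC G) {g s : G} (hgs : g ≠ s) :
    coef D g s s = 0 := by
  have h1 : opTensor (leftReg s) (leftReg s) (delta2 G 1) = delta2 G (s, s) :=
    opTensor_delta2 (by rw [leftReg_apply, mul_one]) (by rw [leftReg_apply, mul_one])
  have := inner_eq_zero_of_isICC hG (delta2 G) (l := opTensor (leftReg s) (leftReg s))
    rightReg_tensor_delta2 adjoint_rightReg_tensor_delta2 hD.mul hD.star_eq
    (fun g p => hD.commute g p.1 p.2) hD.orthonormal (fun p => ?_) (hD.conj s) hgs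
  · rw [h1] at this
    exact this
  · rw [star_opTensor, star_leftReg]
    exact commute_opTensor (leftReg_mul_rightReg _ _) (leftReg_mul_rightReg _ _)

end Core

/-! ### The flip of the two legs -/

section Flip

/-- The operator `η ↦ ξ ⊗ η`. -/
def leftCreation {H : Type*} [NormedAddCommGroup H] [InnerProductSpace ℂ H]
    {K : Type*} [NormedAddCommGroup K] [InnerProductSpace ℂ K] (ξ : H) : K →L[ℂ] HTensor H K :=
  UniformSpace.Completion.toComplL ∘L TensorProduct.mkL ℂ H K ξ

theorem leftCreation_apply {H : Type*} [NormedAddCommGroup H] [InnerProductSpace ℂ H]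
    {K : Type*} [NormedAddCommGroup K] [InnerProductSpace ℂ K] (ξ : H) (η : K) :
    leftCreation ξ η = vtmul ξ η := rfl

theorem basis_clm_ext {E F : Type*} [NormedAddCommGroup E] [InnerProductSpace ℂ E]
    [NormedAddCommGroup F] [NormedSpace ℂ F] {ι : Type*}
    (b : HilbertBasis ι ℂ E) {S T : E →L[ℂ] F} (h : ∀ i, S (b i) = T (b i)) : S = T := by
  refine ContinuousLinearMap.ext_on
    (Submodule.dense_iff_topologicalClosure_eq_top.mpr b.dense_span) ?_
  rintro _ ⟨i, rfl⟩
  exact h i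

variable {G : Type u}

variable (G) in
/-- The flip `δ_g ⊗ δ_h ↦ δ_h ⊗ δ_g`. -/
def flip : HTensor (L2 G) (L2 G) ≃ₗᵢ[ℂ] HTensor (L2 G) (L2 G) :=
  permUnitary (delta2 G) (Equiv.prodComm G G)

theorem flip_delta2 (g h : G) : flip G (delta2 G (g, h)) = delta2 G (h, g) :=
  permUnitary_apply (delta2 G) (Equiv.prodComm G G) (g, h)

theorem inner_flip (g h : G) (ξ : HTensor (L2 G) (L2 G)) :
    ⟪delta2 G (g, h), flip G ξ⟫_ℂ = ⟪delta2 G (h, g), ξ⟫_ℂ := by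
  rw [← flip_delta2, LinearIsometryEquiv.inner_map_map]

theorem flip_symm_delta2 (g h : G) : (flip G).symm (delta2 G (g, h)) = delta2 G (h, g) := by
  rw [LinearIsometryEquiv.symm_apply_eq, flip_delta2]

theorem flip_conj_opTensor (S T : L2 G →L[ℂ] L2 G) :
    (flip G).conjStarAlgEquiv (opTensor S T) = opTensor T S := by
  have h1 : ∀ ξ η : L2 G, flip G (vtmul ξ η) = vtmul η ξ := by
    intro ξ η
    refine basis_vec_ext (delta2 G) fun p => ?_
    obtain ⟨g, h⟩ := p
    rw [inner_flip, delta2_apply, delta2_apply, inner_vtmul, inner_vtmul, mul_comm]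
  refine op_ext fun ξ η => ?_
  have h2 : (flip G).symm (vtmul ξ η) = vtmul η ξ := by
    rw [LinearIsometryEquiv.symm_apply_eq, h1]
  rw [LinearIsometryEquiv.conjStarAlgEquiv_apply_apply, h2, opTensor_vtmul, opTensor_vtmul, h1]

end Flip

/-! ### Slices, the antipode identity and surjectivity of the dual isometry -/

section Core

variable {G : Type u} [Group G]
variable {D : G → HTensor (L2 G) (L2 G) →L[ℂ] HTensor (L2 G) (L2 G)}

/-- The slice `∑_h coef D g h m • δ_h`. -/
def slice (D : G → HTensor (L2 G) (L2 G) →L[ℂ] HTensor (L2 G) (L2 G)) (g m : G) : L2 G :=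
  (creation (delta G m)).adjoint (D g (delta2 G (1, 1)))

theorem inner_slice (g h m : G) : ⟪delta G h, slice D g m⟫_ℂ = coef D g h m := by
  rw [slice, ContinuousLinearMap.adjoint_inner_right, creation_apply, ← delta2_apply, coef]

theorem IsDual.hasSum_norm_slice_sq (hD : IsDual D) (g : G) :
    HasSum (fun m => ‖slice D g m‖ ^ 2) 1 := by
  have := isParseval_adjoint_creation (H₁ := L2 G) (delta G) (D g (delta2 G (1, 1)))
  rwa [hD.orthonormal.1 g, one_pow] at this

/-- T is the comultiplication seen on ℓ²(G), where δ_g stands for u_g. -/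
theorem IsDual.exists_isometry (hD : IsDual D) :
    ∃ T : L2 G →ₗᵢ[ℂ] HTensor (L2 G) (L2 G), ∀ g, T (delta G g) = D g (delta2 G (1, 1)) :=
  exists_linearIsometry (delta G) hD.orthonormal

theorem hasSum_inner_isometry {T : L2 G →ₗᵢ[ℂ] HTensor (L2 G) (L2 G)}
    (hT : ∀ g, T (delta G g) = D g (delta2 G (1, 1))) (a : L2 G) (h m : G) :
    HasSum (fun k => ⟪delta G k, a⟫_ℂ * coef D k h m) ⟪delta2 G (h, m), T a⟫_ℂ := by
  have := (hasSum_basis (delta G) a).mapL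
    (innerSL ℂ (delta2 G (h, m)) ∘L T.toContinuousLinearMap)
  refine this.congr_fun fun k => ?_
  simp [hT, coef]

/-- Write D g as ∑_m s_m ⊗ u_m and as ∑_j u_j ⊗ r_j. Both sides are the coefficient of the double
comultiplication of u_g at u_j ⊗ u_z ⊗ u_m, read from the two bracketings. -/
theorem IsDual.inner_isometry_slice (hD : IsDual D) {T : L2 G →ₗᵢ[ℂ] HTensor (L2 G) (L2 G)}
    (hT : ∀ g, T (delta G g) = D g (delta2 G (1, 1))) {g j : G} {r : L2 G}
    (hr : ∀ k, ⟪delta G k, r⟫_ℂ = coef D g j k) (m z : G) :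
    ⟪delta2 G (j, z), T (slice D g m)⟫_ℂ = ⟪delta2 G (z, m), T r⟫_ℂ := by
  obtain ⟨c, h1, h2⟩ := hD.coassoc g j m z
  have h3 := hasSum_inner_isometry hT (slice D g m) j z
  have h4 := hasSum_inner_isometry hT r z m
  simp only [inner_slice, hr] at h3 h4
  rw [h3.unique h1, h4.unique h2]

/-- Right invariance in disguise: by traciality the pairing for r = δ_h equals c(h k⁻¹; x, 1), which
vanishes unless h = k. -/
theorem IsDual.inner_leftReg_isometry (hD : IsDual D) [DecidableEq G]
    {T : L2 G →ₗᵢ[ℂ] HTensor (L2 G) (L2 G)}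
    (hT : ∀ g, T (delta G g) = D g (delta2 G (1, 1))) (k x : G) (r : L2 G) :
    ⟪D k (delta2 G (1, 1)), opTensor (leftReg x⁻¹) 1 (T r)⟫_ℂ =
      if x = 1 then ⟪delta G k, r⟫_ℂ else 0 := by
  have h : innerSL ℂ (D k (delta2 G (1, 1))) ∘L opTensor (leftReg x⁻¹) 1 ∘L
      T.toContinuousLinearMap = (if x = 1 then (1 : ℂ) else 0) • innerSL ℂ (delta G k) := by
    refine basis_clm_ext (delta G) fun h => ?_
    have h1 : ⟪D k (delta2 G (1, 1)), opTensor (leftReg x⁻¹) 1 (D h (delta2 G (1, 1)))⟫_ℂ =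
        coef D (h * k⁻¹) x 1 := by
      have hc : ∀ p : G × G, Commute (opTensor (leftReg x⁻¹) 1 * D h)
          (opTensor (rightReg p.1) (rightReg p.2)) := fun p =>
        (commute_opTensor (leftReg_mul_rightReg _ _) (Commute.one_left _)).mul_left
          (hD.commute h p.1 p.2)
      have h2 := inner_mul_comm_of_commute (delta2 G) rightReg_tensor_delta2
        adjoint_rightReg_tensor_delta2 (fun p => hD.commute k⁻¹ p.1 p.2) hc
      have h3 : ⟪D k (delta2 G (1, 1)), opTensor (leftReg x⁻¹) 1 (D h (delta2 G (1, 1)))⟫_ℂ =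
          ⟪delta2 G 1, D k⁻¹ ((opTensor (leftReg x⁻¹) 1 * D h :
            HTensor (L2 G) (L2 G) →L[ℂ] HTensor (L2 G) (L2 G)) (delta2 G 1))⟫_ℂ := by
        rw [← hD.star_eq, ContinuousLinearMap.star_eq_adjoint,
          ContinuousLinearMap.adjoint_inner_right]
        rfl
      refine (h3.trans h2).trans ?_
      rw [← mul_apply_eq_comp _ (D k⁻¹), mul_assoc, hD.mul, mul_apply_eq_comp,
        inner_opTensor_right, star_leftReg, star_one, inv_inv]
      rw [coef]
      congr 1
      exact opTensor_delta2 (by rw [leftReg_apply, mul_one]) rfl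
    change ⟪D k (delta2 G (1, 1)), opTensor (leftReg x⁻¹) 1 (T (delta G h))⟫_ℂ =
      (if x = 1 then (1 : ℂ) else 0) * ⟪delta G k, delta G h⟫_ℂ
    rw [hT, h1, basis_inner]
    by_cases hhk : k = h
    · subst hhk
      rw [mul_inv_cancel, hD.coef_one]
      simp
    · rw [hD.coef_one_right _ _ fun h2 => hhk (mul_inv_eq_one.mp h2).symm]
      simp [hhk]
  have := DFunLike.congr_fun h r
  change ⟪D k (delta2 G (1, 1)), opTensor (leftReg x⁻¹) 1 (T r)⟫_ℂ =
      (if x = 1 then (1 : ℂ) else 0) * ⟪delta G k, r⟫_ℂ at this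
  simpa using this

theorem IsDual.exists_isometry_left (hD : IsDual D) :
    ∃ U : HTensor (L2 G) (L2 G) →ₗᵢ[ℂ] HTensor (L2 G) (L2 G),
      ∀ g k, U (delta2 G (g, k)) = D g (delta2 G (1, k)) := by
  obtain ⟨U, hU⟩ := exists_linearIsometry (delta2 G) hD.orthonormal_left
  exact ⟨U, fun g k => hU (g, k)⟩

/-- On vectors, U is a ⊗ b ↦ Δ(a)(1 ⊗ b), and right multiplication by u_y is `rightReg y`. -/
theorem IsDual.isometry_left_vtmul (hD : IsDual D)
    {U : HTensor (L2 G) (L2 G) →ₗᵢ[ℂ] HTensor (L2 G) (L2 G)}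
    (hU : ∀ g k, U (delta2 G (g, k)) = D g (delta2 G (1, k)))
    {T : L2 G →ₗᵢ[ℂ] HTensor (L2 G) (L2 G)}
    (hT : ∀ g, T (delta G g) = D g (delta2 G (1, 1))) (a : L2 G) (y : G) :
    U (vtmul a (delta G y)) = opTensor 1 (rightReg y) (T a) := by
  refine DFunLike.congr_fun (f := U.toContinuousLinearMap ∘L creation (delta G y))
    (g := opTensor 1 (rightReg y) ∘L T.toContinuousLinearMap)
    (basis_clm_ext (delta G) fun g => ?_) a
  change U (vtmul (delta G g) (delta G y)) = opTensor 1 (rightReg y) (T (delta G g))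
  have h1 : delta2 G (1, y) = opTensor (rightReg 1) (rightReg y) (delta2 G (1, 1)) :=
    (opTensor_delta2 (by rw [rightReg_apply, one_mul]) (by rw [rightReg_apply, one_mul])).symm
  rw [← delta2_apply, hU, hT, h1, ← mul_apply_eq_comp, (hD.commute g 1 y).eq, rightReg_one]
  rfl

/-- The part of the antipode identity with m fixed: expand the second tensor factor and bring U of
each term to T r by coassociativity. -/
theorem IsDual.hasSum_inner_isometry_left (hD : IsDual D)
    {U : HTensor (L2 G) (L2 G) →ₗᵢ[ℂ] HTensor (L2 G) (L2 G)}
    (hU : ∀ g k, U (delta2 G (g, k)) = D g (delta2 G (1, k)))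
    {T : L2 G →ₗᵢ[ℂ] HTensor (L2 G) (L2 G)}
    (hT : ∀ g, T (delta G g) = D g (delta2 G (1, 1))) {g j : G} {r : L2 G}
    (hr : ∀ k, ⟪delta G k, r⟫_ℂ = coef D g j k) (k m x : G) :
    HasSum (fun l => ⟪D k (delta2 G (1, 1)), delta2 G (l, m)⟫_ℂ *
      ⟪delta2 G (l, m), opTensor (leftReg x⁻¹) 1 (T r)⟫_ℂ)
      ⟪delta2 G (j, x), U (vtmul (slice D g m) (slice D k⁻¹ m⁻¹))⟫_ℂ := by
  have h1 := (hasSum_basis (delta G) (slice D k⁻¹ m⁻¹)).mapL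
    (innerSL ℂ (delta2 G (j, x)) ∘L U.toContinuousLinearMap ∘L
      leftCreation (slice D g m))
  -- The reindexing l ↦ l⁻¹ turns the coefficients of D k⁻¹ into complex conjugates of those of D k.
  rw [← (Equiv.inv G).hasSum_iff] at h1
  refine h1.congr_fun fun l => ?_
  have h2 : opTensor (leftReg x) 1 (delta2 G (l, m)) = delta2 G (x * l, m) :=
    opTensor_delta2 (leftReg_apply _ _) rfl
  have h3 : opTensor 1 (rightReg l) (delta2 G (j, x)) = delta2 G (j, x * l) :=
    opTensor_delta2 rfl (rightReg_apply _ _)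
  have h4 : ⟪delta2 G (j, x), U (vtmul (slice D g m) (delta G l⁻¹))⟫_ℂ =
      ⟪delta2 G (l, m), opTensor (leftReg x⁻¹) 1 (T r)⟫_ℂ := by
    rw [hD.isometry_left_vtmul hU hT, inner_opTensor_right, inner_opTensor_right, star_one,
      star_leftReg, star_rightReg, inv_inv, inv_inv, h2, h3, hD.inner_isometry_slice hT hr]
  have h5 : ⟪D k (delta2 G (1, 1)), delta2 G (l, m)⟫_ℂ = coef D k⁻¹ l⁻¹ m⁻¹ := by
    rw [← hD.conj_coef, coef, inner_conj_symm]
  rw [← h4, h5, ← inner_slice]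
  simp only [Function.comp_apply, Equiv.inv_apply, ContinuousLinearMap.comp_apply, map_smul,
    leftCreation_apply, smul_eq_mul]
  rfl

/-- The antipode identity, for the isometry `δ_g ⊗ δ_k ↦ D g (δ_1 ⊗ δ_k)`. -/
theorem IsDual.exists_isometry_left_apply_eq (hD : IsDual D)
    {U : HTensor (L2 G) (L2 G) →ₗᵢ[ℂ] HTensor (L2 G) (L2 G)}
    (hU : ∀ g k, U (delta2 G (g, k)) = D g (delta2 G (1, k))) (g k : G) :
    ∃ η, HasSum (fun m => vtmul (slice D g m) (slice D k⁻¹ m⁻¹)) η ∧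
      U η = vtmul (slice D g k) (delta G 1) := by
  classical
  -- In leg notation η is (id ⊗ id ⊗ τ)(Δ(u_g)₁₃ Δ(u_k*)₂₃). Applying U gives (id ⊗ id ⊗ τ) of (Δ ⊗
  -- id)Δ(u_g) · (1 ⊗ Δ(u_k*)). By coassociativity this is the image of Δ(u_g)(1 ⊗ u_k*) under id ⊗
  -- Δ and id ⊗ id ⊗ τ, and right invariance leaves the slice of D g at k, tensored with 1. The
  -- proof below checks the coordinates at δ_j ⊗ δ_x.
  obtain ⟨T, hT⟩ := hD.exists_isometry
  have hsum : Summable fun m => vtmul (slice D g m) (slice D k⁻¹ m⁻¹) := by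
    have h1 := (hD.hasSum_norm_slice_sq g).summable
    have h2 := (Equiv.inv G).summable_iff.mpr (hD.hasSum_norm_slice_sq k⁻¹).summable
    refine Summable.of_norm_bounded (h1.add h2) fun m => ?_
    rw [norm_vtmul]
    change _ ≤ ‖slice D g m‖ ^ 2 + ‖slice D k⁻¹ m⁻¹‖ ^ 2
    nlinarith [sq_nonneg (‖slice D g m‖ - ‖slice D k⁻¹ m⁻¹‖), sq_nonneg ‖slice D g m‖,
      sq_nonneg ‖slice D k⁻¹ m⁻¹‖]
  obtain ⟨η, hη⟩ := hsum
  refine ⟨η, hη, basis_vec_ext (delta2 G) ?_⟩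
  rintro ⟨j, x⟩
  -- Here r is the right leg of D g opposite to u_j, obtained as a left slice after flipping.
  obtain ⟨r, hr⟩ : ∃ r : L2 G, ∀ k, ⟪delta G k, r⟫_ℂ = coef D g j k := by
    refine ⟨(creation (delta G j)).adjoint (flip G (D g (delta2 G (1, 1)))), fun k => ?_⟩
    rw [ContinuousLinearMap.adjoint_inner_right, creation_apply, ← delta2_apply, inner_flip, coef]
  have h1 := hη.mapL (innerSL ℂ (delta2 G (j, x)) ∘L U.toContinuousLinearMap)
  -- Parseval over all pairs (l, m), regrouped so that the sum over l is inner and matches the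
  -- expansion for fixed m.
  have h2 := (delta2 G).hasSum_inner_mul_inner (D k (delta2 G (1, 1)))
    (opTensor (leftReg x⁻¹) 1 (T r))
  rw [hD.inner_leftReg_isometry hT, ← (Equiv.prodComm G G).hasSum_iff] at h2
  have h3 := h2.prod_fiberwise fun m => hD.hasSum_inner_isometry_left hU hT hr k m x
  refine (h1.unique h3).trans ?_
  rw [delta2_apply, inner_vtmul, inner_slice, hr, basis_inner]
  simp

/-- Let Z be the closed span of the vectors slice ⊗ δ_y. The range of U lies in Z, because D g (δ_1
⊗ δ_k) is the sum over m of slices tensored with δ_{mk}, and the antipode identity gives Z ⊆ U(Z).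
For any ξ one gets U ξ = U ζ with ζ ∈ Z, so ξ ∈ Z by injectivity. Thus Z is the whole space and U is
onto. -/
theorem IsDual.surjective_isometry_left (hD : IsDual D)
    {U : HTensor (L2 G) (L2 G) →ₗᵢ[ℂ] HTensor (L2 G) (L2 G)}
    (hU : ∀ g k, U (delta2 G (g, k)) = D g (delta2 G (1, k))) : Function.Surjective U := by
  set Z : Submodule ℂ (HTensor (L2 G) (L2 G)) := (Submodule.span ℂ
    (Set.range fun p : G × G × G => vtmul (slice D p.1 p.2.1) (delta G p.2.2))).topologicalClosure
    with hZ
  have hZc : IsClosed (Z : Set (HTensor (L2 G) (L2 G))) := Submodule.isClosed_topologicalClosure _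
  have hZmem : ∀ g m y, vtmul (slice D g m) (delta G y) ∈ Z := fun g m y =>
    Submodule.le_topologicalClosure _ (Submodule.subset_span ⟨(g, m, y), rfl⟩)
  have hZvec : ∀ g m c, vtmul (slice D g m) c ∈ Z := by
    intro g m c
    refine hZc.mem_of_tendsto ((hasSum_basis (delta G) c).mapL (leftCreation (slice D g m)))
      (Filter.Eventually.of_forall fun F => Z.sum_mem fun i _ => ?_)
    rw [map_smul]
    exact Z.smul_mem _ (hZmem g m i)
  have hUtrans : ∀ y ξ, U (opTensor 1 (rightReg y) ξ) = opTensor 1 (rightReg y) (U ξ) := by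
    intro y ξ
    refine DFunLike.congr_fun (f := U.toContinuousLinearMap ∘L opTensor 1 (rightReg y))
      (g := opTensor 1 (rightReg y) ∘L U.toContinuousLinearMap)
      (basis_clm_ext (delta2 G) fun p => ?_) ξ
    obtain ⟨g, k⟩ := p
    have h1 : ∀ x, opTensor 1 (rightReg y) (delta2 G (x, k)) = delta2 G (x, k * y) := fun x =>
      opTensor_delta2 rfl (rightReg_apply _ _)
    change U (opTensor 1 (rightReg y) (delta2 G (g, k))) =
      opTensor 1 (rightReg y) (U (delta2 G (g, k)))
    rw [h1, hU, hU, ← h1, ← rightReg_one, ← mul_apply_eq_comp, (hD.commute g 1 y).eq]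
    rfl
  have hZU : ∀ z ∈ Z, ∃ z' ∈ Z, U z' = z := by
    have h1 : Z ≤ Z.map (U.toLinearMap) := by
      refine Submodule.topologicalClosure_minimal _ (Submodule.span_le.mpr ?_) ?_
      · rintro _ ⟨⟨g, k, y⟩, rfl⟩
        obtain ⟨η, hη, hUη⟩ := hD.exists_isometry_left_apply_eq hU g k
        refine ⟨opTensor 1 (rightReg y) η, ?_, ?_⟩
        · refine hZc.mem_of_tendsto (hη.mapL (opTensor 1 (rightReg y)))
            (Filter.Eventually.of_forall fun F => Z.sum_mem fun m _ => ?_)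
          rw [opTensor_vtmul]
          exact hZvec _ _ _
        · refine (hUtrans y η).trans ?_
          rw [hUη, opTensor_vtmul, rightReg_apply, one_mul]
          rfl
      · exact (U.isometry.isClosedEmbedding.isClosedMap _ hZc)
    exact fun z hz => h1 hz
  have hUZ : ∀ ξ, U ξ ∈ Z := by
    intro ξ
    have h1 : ∀ p, U (delta2 G p) ∈ Z := by
      rintro ⟨g, k⟩
      have h2 : (delta2 G (1, k)) = opTensor (rightReg 1) (rightReg k) (delta2 G (1, 1)) :=
        (opTensor_delta2 (by rw [rightReg_apply, one_mul]) (by rw [rightReg_apply, one_mul])).symm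
      have h3 := ((isParseval_adjoint_creation (H₁ := L2 G) (delta G)).hasSum
        (D g (delta2 G (1, 1)))).mapL (opTensor (rightReg 1) (rightReg k))
      rw [hU, h2, ← mul_apply_eq_comp, (hD.commute g 1 k).eq]
      refine hZc.mem_of_tendsto h3 (Filter.Eventually.of_forall fun F => Z.sum_mem fun m _ => ?_)
      rw [ContinuousLinearMap.adjoint_adjoint, creation_apply, opTensor_vtmul, rightReg_one,
        rightReg_apply]
      exact hZmem g m (m * k)
    refine hZc.mem_of_tendsto ((hasSum_basis (delta2 G) ξ).mapL U.toContinuousLinearMap)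
      (Filter.Eventually.of_forall fun F => Z.sum_mem fun p _ => ?_)
    rw [map_smul]
    exact Z.smul_mem _ (h1 p)
  intro ξ
  obtain ⟨ζ, hζ, h1⟩ := hZU _ (hUZ ξ)
  have h2 : ξ ∈ Z := U.injective h1 ▸ hζ
  obtain ⟨ζ', -, h3⟩ := hZU ξ h2
  exact ⟨ζ', h3⟩

/-- Pair the vector η of the antipode identity with δ_h ⊗ δ_{l⁻¹}. Expanding η termwise gives the
sum; computing the pairing after the isometry U gives the inner product of slices. -/
theorem IsDual.inner_slice_slice (hD : IsDual D) (g h k l : G) :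
    HasSum (fun m => starRingEnd ℂ (coef D k l m) * coef D g h m)
      ⟪slice D h l, slice D g k⟫_ℂ := by
  obtain ⟨U, hU⟩ := hD.exists_isometry_left
  obtain ⟨η, hη, hUη⟩ := hD.exists_isometry_left_apply_eq hU g k
  have h1 := hη.mapL (innerSL ℂ (delta2 G (h, l⁻¹)))
  have h2 : innerSL ℂ (delta2 G (h, l⁻¹)) η = ⟪slice D h l, slice D g k⟫_ℂ := by
    have h3 : D h (delta2 G (1, l⁻¹)) = opTensor 1 (rightReg l⁻¹) (D h (delta2 G (1, 1))) := by
      have h1 : delta2 G (1, l⁻¹) = opTensor (rightReg 1) (rightReg l⁻¹) (delta2 G (1, 1)) :=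
        (opTensor_delta2 (by rw [rightReg_apply, one_mul]) (by rw [rightReg_apply, one_mul])).symm
      rw [h1, ← mul_apply_eq_comp, (hD.commute h 1 l⁻¹).eq, rightReg_one]
      rfl
    have h5 : ∀ v : L2 G, ⟪slice D h l, v⟫_ℂ = ⟪D h (delta2 G (1, 1)), vtmul v (delta G l)⟫_ℂ :=
      fun v => ContinuousLinearMap.adjoint_inner_left _ _ _
    change ⟪delta2 G (h, l⁻¹), η⟫_ℂ = _
    rw [← U.inner_map_map, hUη, hU, h3, h5]
    have h4 : vtmul (slice D g k) (delta G l) =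
        opTensor 1 (rightReg l) (vtmul (slice D g k) (delta G 1)) := by
      rw [opTensor_vtmul, rightReg_apply, one_mul]
      rfl
    rw [h4, inner_opTensor_right, star_one, star_rightReg]
  rw [h2] at h1
  refine h1.congr_fun fun m => ?_
  change _ = ⟪delta2 G (h, l⁻¹), vtmul (slice D g m) (slice D k⁻¹ m⁻¹)⟫_ℂ
  rw [delta2_apply, inner_vtmul, inner_slice, inner_slice, hD.conj_coef, mul_comm]

end Core

/-! ### The remaining coefficients vanish -/

section Core

variable {G : Type u} [Group G]
variable {D : G → HTensor (L2 G) (L2 G) →L[ℂ] HTensor (L2 G) (L2 G)}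

theorem IsDual.apply_delta2 (hD : IsDual D) (g x y z : G) :
    D g (delta2 G (x, y * z)) = opTensor 1 (rightReg z) (D g (delta2 G (x, y))) := by
  have h1 : opTensor (rightReg 1) (rightReg z) (delta2 G (x, y)) = delta2 G (x, y * z) :=
    opTensor_delta2 (by rw [rightReg_apply, mul_one]) (rightReg_apply _ _)
  rw [← h1, ← mul_apply_eq_comp, (hD.commute g 1 z).eq, rightReg_one]
  rfl

/-- Otherwise δ_k ⊗ δ_1 would be orthogonal to the range of the unitary U. -/
theorem IsDual.exists_coef_ne_zero (hD : IsDual D) (k : G) : ∃ g l, coef D g k l ≠ 0 := by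
  obtain ⟨U, hU⟩ := hD.exists_isometry_left
  obtain ⟨ξ, hξ⟩ := hD.surjective_isometry_left hU (delta2 G (k, 1))
  by_contra! h0
  have h1 : ξ = 0 := basis_vec_ext (delta2 G) fun p => by
    obtain ⟨g, y⟩ := p
    rw [inner_zero_right, ← U.inner_map_map, hξ, hU, ← inner_conj_symm, hD.inner_eq_coef,
      inv_one, mul_one, h0, map_zero]
  have h2 := (delta2 G).orthonormal.1 (k, 1)
  rw [← hξ, h1, map_zero, norm_zero] at h2
  exact zero_ne_one h2

theorem leftReg_tensor_rightReg_delta2 (p : G × G) :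
    opTensor (leftReg p.1) (rightReg p.2) (delta2 G 1) = delta2 G p :=
  opTensor_delta2 (by rw [leftReg_apply, mul_one]) (by rw [rightReg_apply, one_mul])

theorem adjoint_leftReg_tensor_rightReg_delta2 (p : G × G) :
    (opTensor (leftReg p.1) (rightReg p.2)).adjoint (delta2 G 1) = delta2 G p⁻¹ := by
  rw [← ContinuousLinearMap.star_eq_adjoint, star_opTensor, star_leftReg, star_rightReg]
  exact leftReg_tensor_rightReg_delta2 p⁻¹

-- The icc argument on the dual side. Conjugating right translations of the first leg by V gives a
-- representation R of G whose orbit of δ_1 ⊗ δ_1 has coefficients conj c(g; h⁻¹, k⁻¹), with h fixed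
-- and (g,k) varying. The roles of g and h are thus exchanged compared with `IsDual.coef_self`.
set_option maxHeartbeats 800000 in
theorem IsDual.coef_right (hD : IsDual D) (hG : IsICC G) {h s : G} (hhs : h ≠ s) :
    coef D s h s = 0 := by
  obtain ⟨U, hU⟩ := hD.exists_isometry_left
  set V : HTensor (L2 G) (L2 G) ≃ₗᵢ[ℂ] HTensor (L2 G) (L2 G) :=
    LinearIsometryEquiv.ofSurjective U (hD.surjective_isometry_left hU) with hV
  have hVb : ∀ g k, V (delta2 G (g, k)) = D g (delta2 G (1, k)) := hU
  have hP : ∀ h x y, (opTensor (rightReg h) 1 : HTensor (L2 G) (L2 G) →L[ℂ] _)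
      (delta2 G (x, y)) = delta2 G (x * h, y) := fun h x y =>
    opTensor_delta2 (rightReg_apply _ _) rfl
  -- The inverse makes R multiplicative, since `rightReg` reverses products.
  set R : G → HTensor (L2 G) (L2 G) →L[ℂ] HTensor (L2 G) (L2 G) := fun h =>
    V.symm.conjStarAlgEquiv (opTensor (rightReg h⁻¹) 1) with hR
  have hVR : ∀ h ξ, V (R h ξ) = opTensor (rightReg h⁻¹) 1 (V ξ) := by
    intro h ξ
    rw [hR]
    simp [LinearIsometryEquiv.conjStarAlgEquiv_apply_apply]
  have hRb : ∀ h, R h (delta2 G 1) = V.symm (delta2 G (h⁻¹, 1)) := by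
    intro h
    refine V.injective ?_
    rw [hVR, V.apply_symm_apply]
    change opTensor (rightReg h⁻¹) 1 (V (delta2 G (1, 1))) = _
    rw [hVb, hD.one]
    refine (hP h⁻¹ 1 1).trans ?_
    rw [one_mul]
  have hRmul : ∀ g h, R g * R h = R (g * h) := by
    intro g h
    rw [hR]
    simp only
    rw [← map_mul, opTensor_mul, rightReg_mul, mul_inv_rev, one_mul]
  have hRstar : ∀ g, star (R g) = R g⁻¹ := by
    intro g
    have h1 : star (opTensor (rightReg g⁻¹) (1 : L2 G →L[ℂ] L2 G)) =
        opTensor (rightReg g⁻¹⁻¹) 1 := by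
      rw [star_opTensor, star_rightReg, star_one]
    exact (V.symm.conjStarAlgEquiv.map_star' _).symm.trans (congrArg _ h1)
  have hVC : ∀ (x y : G) ξ, V (opTensor (leftReg x) (rightReg y) ξ) =
      D x (opTensor 1 (rightReg y) (V ξ)) := by
    intro x y ξ
    refine DFunLike.congr_fun
      (f := (V.toContinuousLinearEquiv : HTensor (L2 G) (L2 G) →L[ℂ] HTensor (L2 G) (L2 G)) ∘L
        opTensor (leftReg x) (rightReg y))
      (g := D x ∘L opTensor 1 (rightReg y) ∘L
        (V.toContinuousLinearEquiv : HTensor (L2 G) (L2 G) →L[ℂ] HTensor (L2 G) (L2 G)))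
      (basis_clm_ext (delta2 G) fun p => ?_) ξ
    obtain ⟨g, k⟩ := p
    change V (opTensor (leftReg x) (rightReg y) (delta2 G (g, k))) =
      D x (opTensor 1 (rightReg y) (V (delta2 G (g, k))))
    rw [opTensor_delta2 (leftReg_apply _ _) (rightReg_apply _ _), hVb, hVb, ← hD.apply_delta2,
      ← mul_apply_eq_comp, hD.mul]
  have hDP : ∀ g h, Commute (D g) (opTensor (rightReg h) 1) := fun g h => by
    have := hD.commute g h 1
    rwa [rightReg_one] at this
  -- V turns left translations of the first leg into the D x, and these commute with right
  -- translations. So here the regular family for the trace argument is `leftReg` ⊗ `rightReg`.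
  have hRC : ∀ g (p : G × G), Commute (R g) (opTensor (leftReg p.1) (rightReg p.2)) := by
    intro g p
    refine ContinuousLinearMap.ext fun ξ => V.injective ?_
    rw [mul_apply_eq_comp, mul_apply_eq_comp, hVR, hVC, hVC, hVR, ← mul_apply_eq_comp _ (D p.1),
      ← (hDP _ _).eq, mul_apply_eq_comp, ← mul_apply_eq_comp (opTensor (rightReg g⁻¹) 1),
      ← mul_apply_eq_comp (opTensor 1 (rightReg p.2)), opTensor_mul, opTensor_mul, one_mul,
      mul_one, one_mul, mul_one]
  have hRo : Orthonormal ℂ fun g => R g (delta2 G 1) := by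
    simp only [hRb]
    exact ((delta2 G).orthonormal.comp (fun g : G => (g⁻¹, 1)) fun _ _ h =>
      inv_injective (congrArg Prod.fst h)).comp_linearIsometry V.symm.toLinearIsometry
  -- The unitary l sends δ_1 ⊗ δ_1 to δ_{s⁻¹} ⊗ δ_s. Through V it becomes A, whose factors D s⁻¹,
  -- λ_s and λ_s on the second leg commute with right translation of the first leg; only ρ_{s⁻¹}
  -- remains, and it conjugates r to s r s⁻¹.
  set l : HTensor (L2 G) (L2 G) →L[ℂ] HTensor (L2 G) (L2 G) :=
    opTensor (rightReg s⁻¹) (leftReg s) with hl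
  set A : HTensor (L2 G) (L2 G) →L[ℂ] HTensor (L2 G) (L2 G) :=
    D s⁻¹ * opTensor (leftReg s * rightReg s⁻¹) (leftReg s) with hA
  have hlb : ∀ g k, l (delta2 G (g, k)) = delta2 G (g * s⁻¹, s * k) := fun g k =>
    opTensor_delta2 (rightReg_apply _ _) (leftReg_apply _ _)
  have hVl : ∀ ξ, V (l ξ) = A (V ξ) := by
    intro ξ
    refine DFunLike.congr_fun
      (f := (V.toContinuousLinearEquiv : HTensor (L2 G) (L2 G) →L[ℂ] HTensor (L2 G) (L2 G)) ∘L l)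
      (g := A ∘L
        (V.toContinuousLinearEquiv : HTensor (L2 G) (L2 G) →L[ℂ] HTensor (L2 G) (L2 G)))
      (basis_clm_ext (delta2 G) fun p => ?_) ξ
    obtain ⟨g, k⟩ := p
    change V (l (delta2 G (g, k))) = A (V (delta2 G (g, k)))
    have e1 : opTensor (leftReg s * rightReg s⁻¹) (leftReg s) =
        opTensor (leftReg s) (leftReg s) * opTensor (rightReg s⁻¹) 1 := by
      rw [opTensor_mul, mul_one]
    have e2 : A * D g = D (g * s⁻¹) * opTensor (leftReg s * rightReg s⁻¹) (leftReg s) := by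
      rw [hA, mul_assoc, e1, mul_assoc, ← (hDP g s⁻¹).eq, ← mul_assoc (opTensor _ _) (D g),
        hD.conj, mul_assoc (D (s * g * s⁻¹)), ← mul_assoc (D s⁻¹), hD.mul]
      simp [mul_assoc]
    rw [hlb, hVb, hVb, ← mul_apply_eq_comp, e2, mul_apply_eq_comp]
    congr 1
    refine (opTensor_delta2 ?_ (leftReg_apply _ _)).symm
    rw [mul_apply_eq_comp, rightReg_apply, leftReg_apply]
    simp
  have hAP : ∀ r, A * opTensor (rightReg r⁻¹) 1 =
      opTensor (rightReg (s * r * s⁻¹)⁻¹) 1 * A := by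
    intro r
    rw [hA, ← mul_assoc, ← (hDP _ _).eq, mul_assoc, mul_assoc, opTensor_mul, opTensor_mul, mul_one,
      one_mul, mul_assoc, rightReg_mul, ← mul_assoc (rightReg _), ← leftReg_mul_rightReg,
      mul_assoc (leftReg s), rightReg_mul]
    simp [mul_assoc]
  have hlR : ∀ r, l * R r = R (s * r * s⁻¹) * l := by
    intro r
    refine ContinuousLinearMap.ext fun ξ => V.injective ?_
    have h1 := DFunLike.congr_fun (hAP r) (V ξ)
    rw [mul_apply_eq_comp, mul_apply_eq_comp] at h1
    rw [mul_apply_eq_comp, mul_apply_eq_comp, hVR, hVl, hVl, hVR]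
    exact h1
  have h0 := inner_eq_zero_of_isICC hG (delta2 G) leftReg_tensor_rightReg_delta2
    adjoint_leftReg_tensor_rightReg_delta2 hRmul hRstar hRC hRo (l := l) (fun p => by
      rw [hl, star_opTensor, star_leftReg, star_rightReg]
      exact commute_opTensor (leftReg_mul_rightReg _ _).symm (leftReg_mul_rightReg _ _)) hlR hhs
  have h1 : l (delta2 G 1) = delta2 G (s⁻¹, s) := by
    refine (hlb 1 1).trans ?_
    rw [one_mul, mul_one]
  rw [hRb, h1, ← V.inner_map_map, V.apply_symm_apply, hVb, ← inner_conj_symm, hD.inner_eq_coef,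
    hD.conj_coef] at h0
  simpa using h0

theorem coef_flip (g h k : G) :
    coef (fun g => (flip G).conjStarAlgEquiv (D g)) g h k = coef D g k h := by
  rw [coef, LinearIsometryEquiv.conjStarAlgEquiv_apply_apply, inner_flip, flip_symm_delta2, coef]

/-- The axioms are symmetric in the two legs. Flipping makes the slice relation available with its
legs exchanged. -/
theorem IsDual.flip (hD : IsDual D) :
    IsDual fun g => (QGroup.flip G).conjStarAlgEquiv (D g) where
  one := by rw [hD.one, map_one]
  mul g h := by rw [← map_mul, hD.mul]
  star_eq g := by
    rw [← hD.star_eq]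
    exact ((QGroup.flip G).conjStarAlgEquiv.map_star' (D g)).symm
  commute g x y := by
    rw [← flip_conj_opTensor, commute_iff_eq, ← map_mul, ← map_mul, (hD.commute g y x).eq]
  conj s g := by
    rw [← flip_conj_opTensor, ← map_mul, ← map_mul, hD.conj]
  coef_one_left g h hg := by
    rw [coef_flip, hD.coef_one_right g h hg]
  coef_one_right g h hg := by
    rw [coef_flip, hD.coef_one_left g h hg]
  coassoc g h l m := by
    obtain ⟨c, h1, h2⟩ := hD.coassoc g l h m
    refine ⟨c, ?_, ?_⟩
    · simpa only [coef_flip] using h2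
    · simpa only [coef_flip] using h1

/-- Coassociativity gives ∑_m c(k;l,m) c(m;l,k) = 0, and the slice relation identifies c(k;l,m), up
to a phase depending only on l, with the conjugate of c(m;l,k). -/
theorem IsDual.coef_eq_zero (hD : IsDual D) (hG : IsICC G) {m l k : G} (hlk : l ≠ k) :
    coef D m l k = 0 := by
  set D' : G → HTensor (L2 G) (L2 G) →L[ℂ] HTensor (L2 G) (L2 G) :=
    fun g => (QGroup.flip G).conjStarAlgEquiv (D g) with hD'
  -- In the slice relation for the flipped structure the sum runs over conj c(k;m,k) c(g;m,h), and
  -- `IsDual.coef_right` leaves only m = k.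
  have hs : ∀ g h k, ⟪slice D' h k, slice D' g k⟫_ℂ =
      starRingEnd ℂ (coef D k k k) * coef D g k h := by
    intro g h k
    have h1 := hD.flip.inner_slice_slice g h k k
    simp only [coef_flip] at h1
    refine h1.unique (_root_.hasSum_single k fun m hm => ?_)
    rw [hD.coef_right hG hm, map_zero, zero_mul]
  have hherm : ∀ g h k, starRingEnd ℂ (coef D k k k) * coef D g k h =
      starRingEnd ℂ (starRingEnd ℂ (coef D k k k) * coef D h k g) := by
    intro g h k
    rw [← hs, ← hs, inner_conj_symm]
  -- If c(k;k,k) = 0, every slice of the flipped structure at k has norm zero, so no c(g;k,j) is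
  -- nonzero, against `IsDual.exists_coef_ne_zero`.
  have hne : ∀ k, coef D k k k ≠ 0 := by
    intro k h0
    obtain ⟨g, j, hgj⟩ := hD.exists_coef_ne_zero k
    have h1 := hs g g k
    rw [h0, map_zero, zero_mul, inner_self_eq_zero] at h1
    have h2 := inner_slice (D := D') g j k
    rw [h1, inner_zero_right, hD', coef_flip] at h2
    exact hgj h2.symm
  -- Coassociativity at u_l ⊗ u_l ⊗ u_k. In the other bracketing the terms are c(k;m,k) c(m;l,l):
  -- zero for m ≠ k by `IsDual.coef_right`, and for m = k by `IsDual.coef_self`.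
  have hz : HasSum (fun m => coef D k l m * coef D m l k) 0 := by
    obtain ⟨c, h1, h2⟩ := hD.coassoc k l k l
    have h3 : (fun m => coef D k m k * coef D m l l) = fun _ => 0 := by
      funext m
      by_cases hm : m = k
      · rw [hm, hD.coef_self hG hlk.symm, mul_zero]
      · rw [hD.coef_right hG hm, zero_mul]
    rw [h3] at h1
    rwa [h1.unique hasSum_zero] at h2
  -- The phase conj(c(l;l,l)) / c(l;l,l) turns each product into a squared modulus.
  have hz2 : HasSum (fun m => ((‖coef D m l k‖ ^ 2 : ℝ) : ℂ)) 0 := by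
    have := hz.mul_left ((starRingEnd ℂ (coef D l l l)) / coef D l l l)
    rw [mul_zero] at this
    refine this.congr_fun fun m => ?_
    have h1 := hherm k m l
    rw [map_mul, Complex.conj_conj] at h1
    rw [div_mul_eq_mul_div, ← mul_assoc, h1, eq_div_iff (hne l), ← Complex.normSq_eq_norm_sq,
      Complex.normSq_eq_conj_mul_self]
    ring
  have hz3 : HasSum (fun m => ‖coef D m l k‖ ^ 2) 0 := Complex.hasSum_ofReal.mp (by simpa using hz2)
  have := (hasSum_zero_iff_of_nonneg fun _ => by positivity).mp hz3
  simpa using congrFun this m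

/-- The classification of the dual structures on `L(G)`. -/
theorem IsDual.apply_eq_smul (hD : IsDual D) (hG : IsICC G) (g : G) :
    D g (delta2 G (1, 1)) = coef D g g g • delta2 G (g, g) := by
  classical
  refine basis_vec_ext (delta2 G) fun p => ?_
  obtain ⟨h, k⟩ := p
  rw [inner_smul_right, basis_inner]
  change coef D g h k = _
  by_cases hhk : h = k
  · subst hhk
    by_cases hg : h = g
    · simp [hg]
    · rw [hD.coef_self hG (Ne.symm hg)]
      simp [hg]
  · rw [hD.coef_eq_zero hG hhk, if_neg, mul_zero]
    rintro ⟨⟩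
    exact hhk rfl

end Core

/-! ### Tensor bases and the associativity unitary -/

section TensorBasis

variable {H : Type*} [NormedAddCommGroup H] [InnerProductSpace ℂ H]
  {K : Type*} [NormedAddCommGroup K] [InnerProductSpace ℂ K]
  {ι κ : Type*}

theorem exists_tensor_basis (b : HilbertBasis ι ℂ H) (c : HilbertBasis κ ℂ K) :
    ∃ d : HilbertBasis (ι × κ) ℂ (HTensor H K), ∀ p, d p = vtmul (b p.1) (c p.2) := by
  classical
  have h1 : Orthonormal ℂ fun p : ι × κ => vtmul (b p.1) (c p.2) := by
    rw [orthonormal_iff_ite]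
    rintro ⟨i, j⟩ ⟨i', j'⟩
    rw [inner_vtmul, basis_inner, basis_inner]
    by_cases hi : i = i' <;> by_cases hj : j = j' <;> simp [hi, hj]
  refine ⟨HilbertBasis.mkOfOrthogonalEqBot h1 ?_, fun p => by
    rw [HilbertBasis.coe_mkOfOrthogonalEqBot]⟩
  rw [Submodule.eq_bot_iff]
  intro x hx
  have hx' : ∀ i j, ⟪x, vtmul (b i) (c j)⟫_ℂ = 0 := fun i j =>
    (Submodule.mem_orthogonal' _ _).mp hx _ (Submodule.subset_span ⟨(i, j), rfl⟩)
  have h2 : ∀ j, innerSL ℂ x ∘L creation (c j) = 0 := fun j => basis_clm_ext b fun i => hx' i j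
  have h3 : ∀ ξ, innerSL ℂ x ∘L leftCreation ξ = 0 := fun ξ =>
    basis_clm_ext c fun j => DFunLike.congr_fun (h2 j) ξ
  have h4 : innerSL ℂ x = 0 := op_ext fun ξ η => DFunLike.congr_fun (h3 ξ) η
  exact inner_self_eq_zero.mp (DFunLike.congr_fun h4 x)

theorem exists_basis_equiv [CompleteSpace K] (b : HilbertBasis ι ℂ H) (c : HilbertBasis κ ℂ K) (e : ι ≃ κ) :
    ∃ U : H ≃ₗᵢ[ℂ] K, ∀ i, U (b i) = c (e i) := by
  classical
  refine ⟨b.repr.trans (HilbertBasis.mk (c.orthonormal.comp e e.injective) (by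
    rw [Set.range_comp, e.surjective.range_eq, Set.image_univ, c.dense_span])).repr.symm,
      fun i => ?_⟩
  rw [LinearIsometryEquiv.trans_apply, b.repr_self, HilbertBasis.repr_symm_single]
  simp

theorem exists_assoc_unitary (H : Type*) [NormedAddCommGroup H] [InnerProductSpace ℂ H]
    [CompleteSpace H] (K : Type*) [NormedAddCommGroup K] [InnerProductSpace ℂ K] [CompleteSpace K]
    (L : Type*) [NormedAddCommGroup L] [InnerProductSpace ℂ L] [CompleteSpace L] :
    ∃ A : HTensor (HTensor H K) L ≃ₗᵢ[ℂ] HTensor H (HTensor K L),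
      ∀ ξ η ζ, A (vtmul (vtmul ξ η) ζ) = vtmul ξ (vtmul η ζ) := by
  obtain ⟨_, b, -⟩ := exists_hilbertBasis ℂ H
  obtain ⟨_, c, -⟩ := exists_hilbertBasis ℂ K
  obtain ⟨_, d, -⟩ := exists_hilbertBasis ℂ L
  obtain ⟨bc, hbc⟩ := exists_tensor_basis b c
  obtain ⟨bcd, hbcd⟩ := exists_tensor_basis bc d
  obtain ⟨cd, hcd⟩ := exists_tensor_basis c d
  obtain ⟨bcd', hbcd'⟩ := exists_tensor_basis b cd
  obtain ⟨A, hA⟩ := exists_basis_equiv bcd bcd' (Equiv.prodAssoc _ _ _)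
  refine ⟨A, fun ξ η ζ => basis_vec_ext bcd' fun p => ?_⟩
  obtain ⟨i, j, k⟩ := p
  have h1 : bcd' (i, j, k) = A (bcd ((i, j), k)) := (hA ((i, j), k)).symm
  rw [h1, A.inner_map_map, ← h1, hbcd, hbcd', hbc, hcd, inner_vtmul, inner_vtmul, inner_vtmul,
    inner_vtmul, mul_assoc]

end TensorBasis

/-! ### Associativity of the von Neumann algebra tensor product -/

section Assoc

variable {H₁ : Type*} [NormedAddCommGroup H₁] [InnerProductSpace ℂ H₁] [CompleteSpace H₁]
  {H₂ : Type*} [NormedAddCommGroup H₂] [InnerProductSpace ℂ H₂] [CompleteSpace H₂]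
  {H₃ : Type*} [NormedAddCommGroup H₃] [InnerProductSpace ℂ H₃] [CompleteSpace H₃]

theorem map_mem_of_eq_mul (Φ : (H₁ →L[ℂ] H₁) ≃⋆ₐ[ℂ] (H₂ →L[ℂ] H₂)) {N : VonNeumannAlgebra H₂}
    {x y z : H₁ →L[ℂ] H₁} (hz : z = x * y) (hx : Φ x ∈ N.toStarSubalgebra)
    (hy : Φ y ∈ N.toStarSubalgebra) : Φ z ∈ N.toStarSubalgebra := by
  rw [hz, map_mul]
  exact mul_mem hx hy

theorem conj_opTensor_one_mem (M₁ : VonNeumannAlgebra H₁) (M₂ : VonNeumannAlgebra H₂)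
    (M₃ : VonNeumannAlgebra H₃) {A : HTensor (HTensor H₁ H₂) H₃ ≃ₗᵢ[ℂ] HTensor H₁ (HTensor H₂ H₃)}
    (hconj : ∀ (a : H₁ →L[ℂ] H₁) (b : H₂ →L[ℂ] H₂) (c : H₃ →L[ℂ] H₃),
      A.conjStarAlgEquiv (opTensor (opTensor a b) c) = opTensor a (opTensor b c))
    (x : Elem (vnTensor M₁ M₂)) :
    A.conjStarAlgEquiv (opTensor (x : HTensor H₁ H₂ →L[ℂ] HTensor H₁ H₂) 1) ∈
      (vnTensor M₁ (vnTensor M₂ M₃)).toStarSubalgebra := by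
  set S : Set (HTensor H₁ H₂ →L[ℂ] HTensor H₁ H₂) := {x | ∃ a ∈ M₁, ∃ b ∈ M₂, x = opTensor a b}
  have h1 : amplify H₃ (x : HTensor H₁ H₂ →L[ℂ] HTensor H₁ H₂) ∈
      (generated (amplify H₃ '' S)).toStarSubalgebra :=
    amplify_mem_generated (S := S) (T := amplify H₃ '' S)
      (fun s hs => subset_generated (Set.mem_image_of_mem _ hs)) x.2
  refine map_mem_generated A.conjStarAlgEquiv
    (T := {x | ∃ a ∈ M₁, ∃ b ∈ vnTensor M₂ M₃, x = opTensor a b}) ?_ h1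
  rintro _ ⟨s, ⟨a, ha, b, hb, rfl⟩, rfl⟩
  have e : A.conjStarAlgEquiv (amplify H₃ (opTensor a b)) = opTensor a (opTensor b 1) :=
    hconj a b 1
  rw [e]
  exact subset_generated ⟨a, ha, _, (tmul (⟨b, hb⟩ : Elem M₂) (1 : Elem M₃)).2, rfl⟩

theorem conj_opTensor_mem (M₁ : VonNeumannAlgebra H₁) (M₂ : VonNeumannAlgebra H₂)
    (M₃ : VonNeumannAlgebra H₃) {A : HTensor (HTensor H₁ H₂) H₃ ≃ₗᵢ[ℂ] HTensor H₁ (HTensor H₂ H₃)}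
    (hconj : ∀ (a : H₁ →L[ℂ] H₁) (b : H₂ →L[ℂ] H₂) (c : H₃ →L[ℂ] H₃),
      A.conjStarAlgEquiv (opTensor (opTensor a b) c) = opTensor a (opTensor b c))
    (x : Elem (vnTensor M₁ M₂)) (c : Elem M₃) :
    A.conjStarAlgEquiv (opTensor (x : HTensor H₁ H₂ →L[ℂ] HTensor H₁ H₂) (c : H₃ →L[ℂ] H₃)) ∈
      (vnTensor M₁ (vnTensor M₂ M₃)).toStarSubalgebra := by
  have h1 : opTensor (x : HTensor H₁ H₂ →L[ℂ] HTensor H₁ H₂) (c : H₃ →L[ℂ] H₃) =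
      opTensor (x : HTensor H₁ H₂ →L[ℂ] HTensor H₁ H₂) 1 * opTensor 1 (c : H₃ →L[ℂ] H₃) := by
    rw [opTensor_mul, mul_one, one_mul]
  have h2 : A.conjStarAlgEquiv (opTensor 1 (c : H₃ →L[ℂ] H₃)) ∈
      (vnTensor M₁ (vnTensor M₂ M₃)).toStarSubalgebra := by
    rw [← opTensor_one, hconj]
    exact (tmul (1 : Elem M₁) (tmul (1 : Elem M₂) c)).2
  exact map_mem_of_eq_mul A.conjStarAlgEquiv h1 (conj_opTensor_one_mem M₁ M₂ M₃ hconj x) h2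

theorem conj_assoc_mem (M₁ : VonNeumannAlgebra H₁) (M₂ : VonNeumannAlgebra H₂)
    (M₃ : VonNeumannAlgebra H₃) {A : HTensor (HTensor H₁ H₂) H₃ ≃ₗᵢ[ℂ] HTensor H₁ (HTensor H₂ H₃)}
    (hconj : ∀ (a : H₁ →L[ℂ] H₁) (b : H₂ →L[ℂ] H₂) (c : H₃ →L[ℂ] H₃),
      A.conjStarAlgEquiv (opTensor (opTensor a b) c) = opTensor a (opTensor b c))
    (x : Elem (vnTensor (vnTensor M₁ M₂) M₃)) : A.conjStarAlgEquiv
      (x : HTensor (HTensor H₁ H₂) H₃ →L[ℂ] HTensor (HTensor H₁ H₂) H₃) ∈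
      (vnTensor M₁ (vnTensor M₂ M₃)).toStarSubalgebra := by
  refine map_mem_generated A.conjStarAlgEquiv
    (S := {x | ∃ a ∈ vnTensor M₁ M₂, ∃ b ∈ M₃, x = opTensor a b})
    (T := {x | ∃ a ∈ M₁, ∃ b ∈ vnTensor M₂ M₃, x = opTensor a b}) ?_ x.2
  rintro _ ⟨a, ha, b, hb, rfl⟩
  exact conj_opTensor_mem M₁ M₂ M₃ hconj ⟨a, ha⟩ ⟨b, hb⟩

variable (H₁ H₂ H₃) in
theorem exists_conj_opTensor_assoc :
    ∃ A : HTensor (HTensor H₁ H₂) H₃ ≃ₗᵢ[ℂ] HTensor H₁ (HTensor H₂ H₃),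
      ∀ (a : H₁ →L[ℂ] H₁) (b : H₂ →L[ℂ] H₂) (c : H₃ →L[ℂ] H₃),
      A.conjStarAlgEquiv (opTensor (opTensor a b) c) = opTensor a (opTensor b c) := by
  obtain ⟨A, hA⟩ := exists_assoc_unitary H₁ H₂ H₃
  have hA' : ∀ ξ η ζ, A.symm (vtmul ξ (vtmul η ζ)) = vtmul (vtmul ξ η) ζ := fun ξ η ζ => by
    rw [LinearIsometryEquiv.symm_apply_eq, hA]
  refine ⟨A, fun a b c => op_ext fun ξ x => ?_⟩
  refine DFunLike.congr_fun
    (f := A.conjStarAlgEquiv (opTensor (opTensor a b) c) ∘L leftCreation ξ)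
    (g := opTensor a (opTensor b c) ∘L leftCreation ξ) (op_ext fun η ζ => ?_) x
  change A.conjStarAlgEquiv (opTensor (opTensor a b) c) (vtmul ξ (vtmul η ζ)) =
    opTensor a (opTensor b c) (vtmul ξ (vtmul η ζ))
  rw [LinearIsometryEquiv.conjStarAlgEquiv_apply_apply, hA', opTensor_vtmul, opTensor_vtmul, hA,
    opTensor_vtmul, opTensor_vtmul]

/-- A unitary conjugating `M` into `N` gives a normal *-homomorphism. -/
theorem exists_normalHom_of_unitary {M : VonNeumannAlgebra H₁} {N : VonNeumannAlgebra H₂}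
    (U : H₁ ≃ₗᵢ[ℂ] H₂)
    (h : ∀ x : Elem M, U.conjStarAlgEquiv (x : H₁ →L[ℂ] H₁) ∈ N.toStarSubalgebra) :
    ∃ f : Elem M →⋆ₐ[ℂ] Elem N, IsNormalHom f ∧
      ∀ x : Elem M, (f x : H₂ →L[ℂ] H₂) = U.conjStarAlgEquiv (x : H₁ →L[ℂ] H₁) := by
  obtain ⟨f, hf⟩ : ∃ f : Elem M →⋆ₐ[ℂ] Elem N,
      ∀ x : Elem M, (f x : H₂ →L[ℂ] H₂) = U.conjStarAlgEquiv (x : H₁ →L[ℂ] H₁) :=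
    ⟨StarAlgHom.codRestrict (U.conjStarAlgEquiv.toStarAlgHom.comp
      M.toStarSubalgebra.subtype) _ h, fun x => rfl⟩
  refine ⟨f, (isSpatial_of_unitary U fun x η => ?_).isNormalHom, hf⟩
  rw [hf, LinearIsometryEquiv.conjStarAlgEquiv_apply_apply]

/-- The canonical identification `(M₁ ⊗ M₂) ⊗ M₃ = M₁ ⊗ (M₂ ⊗ M₃)`. -/
theorem exists_assoc (M₁ : VonNeumannAlgebra H₁) (M₂ : VonNeumannAlgebra H₂)
    (M₃ : VonNeumannAlgebra H₃) :
    ∃ f : Elem (vnTensor (vnTensor M₁ M₂) M₃) →⋆ₐ[ℂ] Elem (vnTensor M₁ (vnTensor M₂ M₃)),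
      IsNormalHom f ∧ ∀ a b c, f (tmul (tmul a b) c) = tmul a (tmul b c) := by
  obtain ⟨A, hconj⟩ := exists_conj_opTensor_assoc H₁ H₂ H₃
  obtain ⟨f, hf, hfA⟩ := exists_normalHom_of_unitary A (conj_assoc_mem M₁ M₂ M₃ hconj)
  exact ⟨f, hf, fun a b c => Subtype.ext ((hfA _).trans (hconj _ _ _))⟩

end Assoc

/-! ### Slice maps of vector functionals -/

section Slices

variable {H : Type*} [NormedAddCommGroup H] [InnerProductSpace ℂ H] [CompleteSpace H]
  {K : Type*} [NormedAddCommGroup K] [InnerProductSpace ℂ K] [CompleteSpace K]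
  {L : Type*} [NormedAddCommGroup L] [InnerProductSpace ℂ L] [CompleteSpace L]

theorem coe_tmul {M : VonNeumannAlgebra H} {N : VonNeumannAlgebra K} (a : Elem M) (b : Elem N) :
    ((tmul a b : Elem (vnTensor M N)) : HTensor H K →L[ℂ] HTensor H K) =
      opTensor (a : H →L[ℂ] H) (b : K →L[ℂ] K) := rfl

theorem coe_smul {M : VonNeumannAlgebra H} (c : ℂ) (a : Elem M) :
    ((c • a : Elem M) : H →L[ℂ] H) = c • (a : H →L[ℂ] H) := rfl

/-- Compressions `x ↦ S* x S` between von Neumann algebras are normal. -/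
theorem exists_compression (P : VonNeumannAlgebra L) (M : VonNeumannAlgebra H)
    (S T : H →L[ℂ] L) (h : ∀ x ∈ P.toStarSubalgebra, S.adjoint ∘L x ∘L T ∈ M.toStarSubalgebra) :
    ∃ R : Elem P →ₗ[ℂ] Elem M, IsNormalMap R ∧
      ∀ x ξ η, ⟪ξ, (R x : H →L[ℂ] H) η⟫_ℂ = ⟪S ξ, (x : L →L[ℂ] L) (T η)⟫_ℂ := by
  refine ⟨{ toFun := fun x => ⟨S.adjoint ∘L (x : L →L[ℂ] L) ∘L T, h x x.2⟩
            map_add' := fun x y => Subtype.ext (by ext; simp)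
            map_smul' := fun c x => Subtype.ext (by ext; simp) }, ?_,
    fun x ξ η => ContinuousLinearMap.adjoint_inner_right S ξ ((x : L →L[ℂ] L) (T η))⟩
  rintro ω ⟨ξ, η, hξ, hη, hs⟩
  have hsum : ∀ (S : H →L[ℂ] L) (ζ : ℕ → H), Summable (fun n => ‖ζ n‖ ^ 2) →
      Summable fun n => ‖S (ζ n)‖ ^ 2 := by
    intro S ζ hζ
    refine Summable.of_nonneg_of_le (fun _ => by positivity) (fun n => ?_) (hζ.mul_left (‖S‖ ^ 2))
    rw [← mul_pow]
    exact pow_le_pow_left₀ (norm_nonneg _) (S.le_opNorm _) 2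
  refine ⟨_, _, hsum S ξ hξ, hsum T η hη, fun x => ?_⟩
  refine (hs _).congr_fun fun n => ?_
  exact (ContinuousLinearMap.adjoint_inner_right _ _ _).symm

theorem commute_opTensor_one_of_mem {M : VonNeumannAlgebra H} {N : VonNeumannAlgebra K}
    {y : H →L[ℂ] H} (hy : y ∈ Set.centralizer (M.toStarSubalgebra : Set (H →L[ℂ] H)))
    {x : HTensor H K →L[ℂ] HTensor H K} (hx : x ∈ (vnTensor M N).toStarSubalgebra) :
    x * opTensor y 1 = opTensor y 1 * x := by
  refine mem_commutant_generated hx ?_ ?_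
  · rintro _ ⟨a, ha, b, hb, rfl⟩
    rw [opTensor_mul, opTensor_mul, hy a ha, one_mul, mul_one]
  · rintro _ ⟨a, ha, b, hb, rfl⟩
    rw [star_opTensor, opTensor_mul, opTensor_mul, hy _ (star_mem ha), one_mul, mul_one]

theorem commute_one_opTensor_of_mem {M : VonNeumannAlgebra H} {N : VonNeumannAlgebra K}
    {y : K →L[ℂ] K} (hy : y ∈ Set.centralizer (N.toStarSubalgebra : Set (K →L[ℂ] K)))
    {x : HTensor H K →L[ℂ] HTensor H K} (hx : x ∈ (vnTensor M N).toStarSubalgebra) :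
    x * opTensor 1 y = opTensor 1 y * x := by
  refine mem_commutant_generated hx ?_ ?_
  · rintro _ ⟨a, ha, b, hb, rfl⟩
    rw [opTensor_mul, opTensor_mul, hy b hb, one_mul, mul_one]
  · rintro _ ⟨a, ha, b, hb, rfl⟩
    rw [star_opTensor, opTensor_mul, opTensor_mul, hy _ (star_mem hb), one_mul, mul_one]

/-- The slice is compression by the operators ξ ↦ ξ ⊗ η. It lands in M because x commutes with y ⊗ 1
for each y in the commutant of M. -/
theorem exists_sliceRight (M : VonNeumannAlgebra H) (N : VonNeumannAlgebra K) (η η' : K) :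
    ∃ R, IsSliceRight (M := M) (vectorFunctional N η η') R ∧ ∀ x ξ ξ',
      ⟪ξ, (R x : H →L[ℂ] H) ξ'⟫_ℂ =
        ⟪vtmul ξ η, (x : HTensor H K →L[ℂ] HTensor H K) (vtmul ξ' η')⟫_ℂ := by
  obtain ⟨R, hR, hRx⟩ := exists_compression (vnTensor M N) M (creation η) (creation η')
    fun x hx => M.centralizer_centralizer'.subset fun y hy => by
      refine ContinuousLinearMap.ext fun ξ' => ext_inner_left ℂ fun ξ => ?_
      have h1 : ∀ (z : H →L[ℂ] H) (ζ : H) (χ : K), vtmul (z ζ) χ = opTensor z 1 (vtmul ζ χ) :=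
        fun z ζ χ => (opTensor_vtmul z 1 ζ χ).symm
      simp only [mul_apply_eq_comp, ContinuousLinearMap.comp_apply]
      rw [← ContinuousLinearMap.adjoint_inner_left, ContinuousLinearMap.adjoint_inner_right,
        ContinuousLinearMap.adjoint_inner_right, creation_apply, creation_apply, creation_apply,
        creation_apply, h1, h1, ← mul_apply_eq_comp, commute_opTensor_one_of_mem hy hx,
        mul_apply_eq_comp, inner_opTensor_right, star_one, ContinuousLinearMap.star_eq_adjoint]
  have h2 : ∀ x ξ ξ', ⟪ξ, (R x : H →L[ℂ] H) ξ'⟫_ℂ =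
        ⟪vtmul ξ η, (x : HTensor H K →L[ℂ] HTensor H K) (vtmul ξ' η')⟫_ℂ := hRx
  refine ⟨R, ⟨hR, fun a b => Subtype.ext ?_⟩, h2⟩
  refine ContinuousLinearMap.ext fun ξ' => ext_inner_left ℂ fun ξ => ?_
  rw [h2]
  rw [coe_tmul, coe_smul, opTensor_vtmul, inner_vtmul, _root_.smul_apply, inner_smul_right,
    mul_comm, vectorFunctional_apply]

theorem exists_sliceLeft (M : VonNeumannAlgebra H) (N : VonNeumannAlgebra K) (η η' : H) :
    ∃ R, IsSliceLeft (N := N) (vectorFunctional M η η') R ∧ ∀ x ξ ξ',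
      ⟪ξ, (R x : K →L[ℂ] K) ξ'⟫_ℂ =
        ⟪vtmul η ξ, (x : HTensor H K →L[ℂ] HTensor H K) (vtmul η' ξ')⟫_ℂ := by
  obtain ⟨R, hR, hRx⟩ := exists_compression (vnTensor M N) N (leftCreation η) (leftCreation η')
    fun x hx => N.centralizer_centralizer'.subset fun y hy => by
      refine ContinuousLinearMap.ext fun ξ' => ext_inner_left ℂ fun ξ => ?_
      have h1 : ∀ (z : K →L[ℂ] K) (ζ : K) (χ : H), vtmul χ (z ζ) = opTensor 1 z (vtmul χ ζ) :=
        fun z ζ χ => (opTensor_vtmul 1 z χ ζ).symm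
      simp only [mul_apply_eq_comp, ContinuousLinearMap.comp_apply]
      rw [← ContinuousLinearMap.adjoint_inner_left, ContinuousLinearMap.adjoint_inner_right,
        ContinuousLinearMap.adjoint_inner_right, leftCreation_apply, leftCreation_apply,
        leftCreation_apply, leftCreation_apply, h1, h1, ← mul_apply_eq_comp,
        commute_one_opTensor_of_mem hy hx, mul_apply_eq_comp, inner_opTensor_right, star_one,
        ContinuousLinearMap.star_eq_adjoint]
  have h2 : ∀ x ξ ξ', ⟪ξ, (R x : K →L[ℂ] K) ξ'⟫_ℂ =
        ⟪vtmul η ξ, (x : HTensor H K →L[ℂ] HTensor H K) (vtmul η' ξ')⟫_ℂ := hRx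
  refine ⟨R, ⟨hR, fun a b => Subtype.ext ?_⟩, h2⟩
  refine ContinuousLinearMap.ext fun ξ' => ext_inner_left ℂ fun ξ => ?_
  rw [h2]
  rw [coe_tmul, coe_smul, opTensor_vtmul, inner_vtmul, _root_.smul_apply, inner_smul_right,
    vectorFunctional_apply]

end Slices

/-! ### L(G) as a Kac type compact quantum group -/

section GroupVN

variable {G : Type u} [Group G]

theorem isStarMonoid_leftReg : IsStarMonoid (Set.range (leftReg (G := G))) where
  mul_mem := by
    rintro _ ⟨g, rfl⟩ _ ⟨h, rfl⟩
    exact ⟨g * h, (leftReg_mul g h).symm⟩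
  star_mem := by
    rintro _ ⟨g, rfl⟩
    exact ⟨g⁻¹, (star_leftReg g).symm⟩
  one_mem := ⟨1, leftReg_one⟩

theorem IsNormalHom.groupVN_ext {K : Type*} [NormedAddCommGroup K] [InnerProductSpace ℂ K]
    [CompleteSpace K] {N : VonNeumannAlgebra K} {f g : Elem (groupVN G) →⋆ₐ[ℂ] Elem N}
    (hf : IsNormalHom f) (hg : IsNormalHom g)
    (h : ∀ s, f (canonicalUnitary s) = g (canonicalUnitary s)) : f = g := by
  refine IsNormalHom.ext isStarMonoid_leftReg hf hg ?_
  rintro _ ⟨s, rfl⟩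
  exact h s

theorem canonicalUnitary_mul (g h : G) :
    canonicalUnitary g * canonicalUnitary h = canonicalUnitary (g * h) :=
  Subtype.ext (leftReg_mul g h)

theorem canonicalUnitary_one : canonicalUnitary (1 : G) = 1 := Subtype.ext leftReg_one

theorem star_canonicalUnitary (g : G) : star (canonicalUnitary g) = canonicalUnitary g⁻¹ :=
  Subtype.ext (star_leftReg g)

theorem commute_rightReg (x : Elem (groupVN G)) (h : G) :
    Commute (x : L2 G →L[ℂ] L2 G) (rightReg h) := by
  refine mem_commutant_generated x.2 ?_ ?_
  · rintro _ ⟨g, rfl⟩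
    exact (leftReg_mul_rightReg g h).symm
  · rintro _ ⟨g, rfl⟩
    rw [star_leftReg]
    exact (leftReg_mul_rightReg _ h).symm

theorem rightReg_mem_centralizer (h : G) :
    rightReg h ∈ Set.centralizer ((groupVN G).toStarSubalgebra : Set (L2 G →L[ℂ] L2 G)) :=
  fun x hx => commute_rightReg ⟨x, hx⟩ h

theorem groupVN_apply_delta (x : Elem (groupVN G)) (h : G) :
    (x : L2 G →L[ℂ] L2 G) (delta G h) = rightReg h ((x : L2 G →L[ℂ] L2 G) (delta G 1)) := by
  rw [← mul_apply_eq_comp, ← (commute_rightReg x h).eq, mul_apply_eq_comp, rightReg_apply, one_mul]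

/-- δ_1 is separating: right translations commute with L(G) and carry δ_1 to every δ_g. -/
theorem groupVN_ext {x y : Elem (groupVN G)}
    (h : (x : L2 G →L[ℂ] L2 G) (delta G 1) = (y : L2 G →L[ℂ] L2 G) (delta G 1)) : x = y :=
  Subtype.ext (basis_op_ext (delta G) fun g => by
    rw [groupVN_apply_delta, groupVN_apply_delta y, h])

theorem groupTrace_eq_vectorFunctional :
    groupTrace G = vectorFunctional (groupVN G) (delta G 1) (delta G 1) := rfl

theorem groupTrace_canonicalUnitary [DecidableEq G] (g : G) :
    groupTrace G (canonicalUnitary g) = if g = 1 then 1 else 0 := by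
  change ⟪delta G 1, leftReg g (delta G 1)⟫_ℂ = _
  rw [leftReg_apply, mul_one, basis_inner]
  simp [eq_comm]

theorem groupTrace_star_mul (a : Elem (groupVN G)) :
    groupTrace G (star a * a) = ((‖(a : L2 G →L[ℂ] L2 G) (delta G 1)‖ ^ 2 : ℝ) : ℂ) := by
  change ⟪delta G 1, (a : L2 G →L[ℂ] L2 G).adjoint ((a : L2 G →L[ℂ] L2 G) (delta G 1))⟫_ℂ = _
  rw [ContinuousLinearMap.adjoint_inner_right, inner_self_eq_norm_sq_to_K]
  push_cast
  rfl

theorem isFaithfulNormalState_groupTrace : IsFaithfulNormalState (groupVN G) (groupTrace G) where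
  normal := isNormalFunctional_vectorFunctional _ _ _
  map_one := by
    classical
    rw [← canonicalUnitary_one, groupTrace_canonicalUnitary, if_pos rfl]
  nonneg a := by
    rw [groupTrace_star_mul]
    exact Complex.zero_le_real.mpr (by positivity)
  faithful a ha := by
    rw [groupTrace_star_mul] at ha
    have h1 : ‖(a : L2 G →L[ℂ] L2 G) (delta G 1)‖ ^ 2 = 0 := by exact_mod_cast ha
    refine groupVN_ext ?_
    have h2 : (a : L2 G →L[ℂ] L2 G) (delta G 1) = 0 := by simpa using h1
    rw [h2]
    rfl

theorem groupTrace_mul_comm (a b : Elem (groupVN G)) :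
    groupTrace G (a * b) = groupTrace G (b * a) :=
  inner_mul_comm_of_commute (delta G) (C := rightReg)
    (fun p => by rw [rightReg_apply, one_mul])
    (fun p => by rw [← ContinuousLinearMap.star_eq_adjoint, star_rightReg, rightReg_apply, one_mul])
    (commute_rightReg a) (commute_rightReg b)

theorem isParseval_groupComul :
    IsParseval fun g : G => (creation (delta G g)).adjoint ∘L
      ((groupW G).symm.toContinuousLinearEquiv :
        HTensor (L2 G) (L2 G) →L[ℂ] HTensor (L2 G) (L2 G)) := by
  intro η
  have := isParseval_adjoint_creation (H₁ := L2 G) (delta G) ((groupW G).symm η)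
  rw [LinearIsometryEquiv.norm_map] at this
  exact this

theorem isIntertwiner_groupComul (g : G) :
    IsIntertwiner (groupComul G) ((creation (delta G g)).adjoint ∘L
      ((groupW G).symm.toContinuousLinearEquiv :
        HTensor (L2 G) (L2 G) →L[ℂ] HTensor (L2 G) (L2 G))) := by
  intro x η
  change (creation (delta G g)).adjoint ((groupW G).symm ((groupW G).conjStarAlgEquiv
    (amplify (L2 G) (x : L2 G →L[ℂ] L2 G)) η)) =
    (x : L2 G →L[ℂ] L2 G) ((creation (delta G g)).adjoint ((groupW G).symm η))
  rw [LinearIsometryEquiv.conjStarAlgEquiv_apply_apply, LinearIsometryEquiv.symm_apply_apply]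
  exact adjoint_creation_opTensor_one _ _ _

theorem isSpatial_groupComul : IsSpatial (groupComul G) :=
  isParseval_groupComul.isSpatial isIntertwiner_groupComul (Equiv.refl G)

theorem injective_groupComul : Function.Injective (groupComul G) := by
  intro x y hxy
  refine groupVN_ext ?_
  have h1 : ((creation (delta G 1)).adjoint ∘L ((groupW G).symm.toContinuousLinearEquiv :
      HTensor (L2 G) (L2 G) →L[ℂ] HTensor (L2 G) (L2 G)))
      (groupW G (vtmul (delta G 1) (delta G 1))) = delta G 1 := by
    change (creation (delta G 1)).adjoint ((groupW G).symm (groupW G _)) = _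
    rw [LinearIsometryEquiv.symm_apply_apply, adjoint_creation_vtmul, inner_self_eq_norm_sq_to_K,
      (delta G).orthonormal.1]
    simp
  rw [← h1, ← isIntertwiner_groupComul, ← isIntertwiner_groupComul, hxy]

theorem isCoassociative_groupComul : IsCoassociative (groupComul G) := by
  obtain ⟨Δl, hl, -⟩ := (isSpatial_groupComul (G := G)).exists_tensor (isSpatial_id (groupVN G))
  obtain ⟨Δr, hr, -⟩ := (isSpatial_id (groupVN G)).exists_tensor (isSpatial_groupComul (G := G))
  obtain ⟨as, has, has'⟩ := exists_assoc (groupVN G) (groupVN G) (groupVN G)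
  refine ⟨Δl, Δr, as, hl, hr, ⟨has, has'⟩, fun a => ?_⟩
  have hΔ := (isSpatial_groupComul (G := G)).isNormalHom
  have h1 : (as.comp Δl).comp (groupComul G) = Δr.comp (groupComul G) := by
    refine IsNormalHom.groupVN_ext ((has.comp hl.1).comp hΔ) (hr.1.comp hΔ) fun s => ?_
    simp only [StarAlgHom.comp_apply, groupComul_canonicalUnitary, hl.2, hr.2, has',
      StarAlgHom.coe_id, id_eq]
  exact DFunLike.congr_fun h1 a

theorem IsNormalFunctional.isNormalMap_smul_one {H : Type*} [NormedAddCommGroup H]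
    [InnerProductSpace ℂ H] [CompleteSpace H] {K : Type*} [NormedAddCommGroup K]
    [InnerProductSpace ℂ K] [CompleteSpace K] {M : VonNeumannAlgebra H} {φ : Elem M →ₗ[ℂ] ℂ}
    (h : IsNormalFunctional M φ) (N : VonNeumannAlgebra K) :
    IsNormalMap (N := N) (φ.smulRight (1 : Elem N)) := by
  intro ω _
  obtain ⟨ξ, η, hξ, hη, hs⟩ := h
  refine ⟨ξ, fun n => ω 1 • η n, hξ, ?_, fun x => ?_⟩
  · simpa only [norm_smul, mul_pow] using hη.mul_left (‖ω 1‖ ^ 2)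
  · simpa [inner_smul_right, mul_comm] using (hs x).mul_left (ω 1)

theorem isHaarState_groupTrace : IsHaarState (groupComul G) (groupTrace G) := by
  classical
  refine ⟨isFaithfulNormalState_groupTrace, ?_⟩
  obtain ⟨R, hR, -⟩ := exists_sliceRight (groupVN G) (groupVN G) (delta G 1) (delta G 1)
  obtain ⟨L, hL, -⟩ := exists_sliceLeft (groupVN G) (groupVN G) (delta G 1) (delta G 1)
  rw [← groupTrace_eq_vectorFunctional] at hR hL
  refine ⟨R, L, hR, hL, fun a => ?_⟩
  have hΔ : IsNormalMap (groupComul G).toAlgHom.toLinearMap :=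
    (isSpatial_groupComul (G := G)).isNormalHom
  have hτ := (isFaithfulNormalState_groupTrace (G := G)).normal.isNormalMap_smul_one (groupVN G)
  have key : ∀ s : G, groupTrace G (canonicalUnitary s) • canonicalUnitary s =
      groupTrace G (canonicalUnitary s) • (1 : Elem (groupVN G)) := by
    intro s
    rw [groupTrace_canonicalUnitary]
    by_cases hs : s = 1
    · rw [hs, canonicalUnitary_one]
    · rw [if_neg hs, zero_smul, zero_smul]
  constructor
  · have h1 : R ∘ₗ (groupComul G).toAlgHom.toLinearMap =
        (groupTrace G).smulRight (1 : Elem (groupVN G)) := by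
      refine IsNormalMap.ext isStarMonoid_leftReg (hR.1.comp hΔ) hτ ?_
      rintro _ ⟨s, rfl⟩
      change R (groupComul G (canonicalUnitary s)) = groupTrace G (canonicalUnitary s) • 1
      rw [groupComul_canonicalUnitary, hR.2, key]
    exact DFunLike.congr_fun h1 a
  · have h1 : L ∘ₗ (groupComul G).toAlgHom.toLinearMap =
        (groupTrace G).smulRight (1 : Elem (groupVN G)) := by
      refine IsNormalMap.ext isStarMonoid_leftReg (hL.1.comp hΔ) hτ ?_
      rintro _ ⟨s, rfl⟩
      change L (groupComul G (canonicalUnitary s)) = groupTrace G (canonicalUnitary s) • 1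
      rw [groupComul_canonicalUnitary, hL.2, key]
    exact DFunLike.congr_fun h1 a

theorem isKacQuantumGroup_groupVN : IsKacQuantumGroup (groupComul G) (groupTrace G) where
  isCompactQuantumGroup :=
    { injective := injective_groupComul
      normal := isSpatial_groupComul.isNormalHom
      coassociative := isCoassociative_groupComul
      exists_haar := ⟨_, isHaarState_groupTrace⟩ }
  isHaarState := isHaarState_groupTrace
  tracial := groupTrace_mul_comm

theorem isSpatial_groupVNAut (θ : MulAut G) :
    IsSpatial (groupVNAut θ).toStarAlgHom :=
  isSpatial_of_unitary (autUnitary θ) fun x η => by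
    change (autUnitary θ).conjStarAlgEquiv (x : L2 G →L[ℂ] L2 G) η = _
    rw [LinearIsometryEquiv.conjStarAlgEquiv_apply_apply]

theorem isQuantumGroupIso_groupVNAut (θ : MulAut G) :
    IsQuantumGroupIso (groupComul G) (groupComul G) (groupVNAut θ) := by
  obtain ⟨Φ, hΦ, -⟩ := (isSpatial_groupVNAut θ).exists_tensor (isSpatial_groupVNAut θ)
  refine ⟨Φ, hΦ, fun a => ?_⟩
  have hΔ := (isSpatial_groupComul (G := G)).isNormalHom
  have h1 : (groupComul G).comp (groupVNAut θ).toStarAlgHom = Φ.comp (groupComul G) := by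
    refine IsNormalHom.groupVN_ext (hΔ.comp (isSpatial_groupVNAut θ).isNormalHom)
      (hΦ.1.comp hΔ) fun s => ?_
    have h2 : ∀ s, (groupVNAut θ).toStarAlgHom (canonicalUnitary s) = canonicalUnitary (θ s) :=
      groupVNAut_canonicalUnitary θ
    simp only [StarAlgHom.comp_apply, groupComul_canonicalUnitary, hΦ.2, h2]
  exact DFunLike.congr_fun h1 a

end GroupVN

/-! ### State preserving isomorphisms are spatial -/

section StatePreserving

variable {H : Type u} [NormedAddCommGroup H] [InnerProductSpace ℂ H]
  {K : Type v} [NormedAddCommGroup K] [InnerProductSpace ℂ K] [CompleteSpace K]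

/-- If `‖x δ‖ ≤ ‖f(x) Ξ‖`, then `f(x) Ξ ↦ x δ` extends to an intertwiner. -/
theorem exists_intertwiner_of_norm_le [CompleteSpace H] {M : VonNeumannAlgebra H} {N : VonNeumannAlgebra K}
    {f : Elem M →⋆ₐ[ℂ] Elem N} {κ : Type*} {δ : H} {Ξ : lp (fun _ : κ => K) 2}
    (h : ∀ x : Elem M, ‖(x : H →L[ℂ] H) δ‖ ≤ ‖diag κ (f x : K →L[ℂ] K) Ξ‖) :
    ∃ Q : lp (fun _ : κ => K) 2 →L[ℂ] H, Q Ξ = δ ∧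
      ∀ (x : Elem M) v, Q (diag κ (f x : K →L[ℂ] K) v) = (x : H →L[ℂ] H) (Q v) := by
  obtain ⟨e₀, he₀⟩ : ∃ e₀ : Elem M →ₗ[ℂ] lp (fun _ : κ => K) 2,
      ∀ x, e₀ x = diag κ (f x : K →L[ℂ] K) Ξ := by
    refine ⟨{ toFun := fun x => diag κ (f x : K →L[ℂ] K) Ξ
              map_add' := fun x y => ?_
              map_smul' := fun c x => ?_ }, fun x => rfl⟩
    · refine lp.ext (funext fun i => ?_)
      rw [map_add]
      rfl
    · refine lp.ext (funext fun i => ?_)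
      rw [map_smul]
      rfl
  obtain ⟨g, hg⟩ : ∃ g : Elem M →ₗ[ℂ] H, ∀ x, g x = (x : H →L[ℂ] H) δ :=
    ⟨{ toFun := fun x => (x : H →L[ℂ] H) δ
       map_add' := fun x y => rfl
       map_smul' := fun c x => rfl }, fun x => rfl⟩
  -- Q is defined on Z, the closed span of the f(x) Ξ, and extended by zero on the complement. It
  -- stays an intertwiner because the projection onto Z commutes with the amplified f(x).
  set Z : Submodule ℂ (lp (fun _ : κ => K) 2) := (LinearMap.range e₀).topologicalClosure with hZ
  have hZc : IsClosed (Z : Set (lp (fun _ : κ => K) 2)) := Submodule.isClosed_topologicalClosure _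
  have : CompleteSpace Z := hZc.completeSpace_coe
  have hmem : ∀ x, e₀ x ∈ Z := fun x => Submodule.le_topologicalClosure _ ⟨x, rfl⟩
  have hinv : ∀ x, ∀ z ∈ Z, diag κ (f x : K →L[ℂ] K) z ∈ Z := by
    intro x
    have : Z ≤ Z.comap (diag κ (f x : K →L[ℂ] K) :
        lp (fun _ : κ => K) 2 →ₗ[ℂ] lp (fun _ : κ => K) 2) := by
      refine Submodule.topologicalClosure_minimal _ ?_ (hZc.preimage (diag κ _).continuous)
      rintro _ ⟨y, rfl⟩
      have e : diag κ (f x : K →L[ℂ] K) (e₀ y) = e₀ (x * y) := by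
        rw [he₀, he₀, map_mul]
        rfl
      change diag κ (f x : K →L[ℂ] K) (e₀ y) ∈ Z
      rw [e]
      exact hmem (x * y)
    exact this
  have hcomm : ∀ x v, Z.starProjection (diag κ (f x : K →L[ℂ] K) v) =
      diag κ (f x : K →L[ℂ] K) (Z.starProjection v) := by
    intro x v
    refine (Submodule.eq_starProjection_of_mem_of_inner_eq_zero
      (hinv x _ (Z.starProjection_apply_mem v)) fun z hz => ?_)
    rw [← map_sub, ← ContinuousLinearMap.adjoint_inner_right, diag_adjoint]
    refine Z.starProjection_inner_eq_zero v _ ?_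
    have := hinv (star x) z hz
    rwa [map_star] at this
  obtain ⟨Q₀, hQ₀⟩ : ∃ Q₀ : Z →L[ℂ] H, ∀ x, Q₀ ⟨e₀ x, hmem x⟩ = (x : H →L[ℂ] H) δ := by
    obtain ⟨e, he⟩ : ∃ e : Elem M →ₗ[ℂ] Z, ∀ x, e x = ⟨e₀ x, hmem x⟩ :=
      ⟨e₀.codRestrict Z hmem, fun x => rfl⟩
    have hd : DenseRange e := by
      intro z
      rw [closure_subtype]
      refine closure_mono ?_ z.2
      rintro _ ⟨y, rfl⟩
      exact ⟨e y, ⟨y, rfl⟩, congrArg Subtype.val (he y)⟩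
    refine ⟨g.extendOfNorm e, fun x => ?_⟩
    rw [← he, LinearMap.extendOfNorm_eq hd, hg]
    refine ⟨1, fun x => ?_⟩
    rw [hg, he, one_mul]
    exact (h x).trans_eq (congrArg _ (he₀ x).symm)
  obtain ⟨Q, hQ⟩ : ∃ Q : lp (fun _ : κ => K) 2 →L[ℂ] H, ∀ v,
      Q v = Q₀ ⟨Z.starProjection v, Z.starProjection_apply_mem v⟩ :=
    ⟨Q₀ ∘L Z.orthogonalProjectionOnto, fun v => rfl⟩
  have hQe : ∀ x, Q (diag κ (f x : K →L[ℂ] K) Ξ) = (x : H →L[ℂ] H) δ := by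
    intro x
    rw [← hQ₀, hQ]
    congr 2
    rw [← he₀]
    exact Z.starProjection_eq_self_iff.mpr (hmem x)
  have hQproj : ∀ v, Q (Z.starProjection v) = Q v := by
    intro v
    rw [hQ, hQ]
    congr 2
    exact Z.starProjection_eq_self_iff.mpr (Z.starProjection_apply_mem v)
  refine ⟨Q, ?_, fun x v => ?_⟩
  · have := hQe 1
    rw [map_one] at this
    exact this
  · have h1 : ∀ z ∈ Z, Q (diag κ (f x : K →L[ℂ] K) z) = (x : H →L[ℂ] H) (Q z) := by
      have : Z ≤ LinearMap.eqLocus ((Q ∘L diag κ (f x : K →L[ℂ] K) : _ →L[ℂ] H) :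
          lp (fun _ : κ => K) 2 →ₗ[ℂ] H) (((x : H →L[ℂ] H) ∘L Q : _ →L[ℂ] H) :
          lp (fun _ : κ => K) 2 →ₗ[ℂ] H) := by
        refine Submodule.topologicalClosure_minimal _ ?_ (isClosed_eq
          (Q ∘L diag κ (f x : K →L[ℂ] K)).continuous ((x : H →L[ℂ] H) ∘L Q).continuous)
        rintro _ ⟨y, rfl⟩
        change Q (diag κ (f x : K →L[ℂ] K) (e₀ y)) = (x : H →L[ℂ] H) (Q (e₀ y))
        have e : diag κ (f x : K →L[ℂ] K) (diag κ (f y : K →L[ℂ] K) Ξ) =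
            diag κ (f (x * y) : K →L[ℂ] K) Ξ := by
          rw [map_mul]
          rfl
        rw [he₀, e, hQe, hQe]
        rfl
      exact this
    rw [← hQproj, hcomm, h1 _ (Z.starProjection_apply_mem v), hQproj]

/-- The difference of the two sides is ‖(a - b)/2‖². -/
theorem norm_sq_half_add_ge (a b : H) : RCLike.re ⟪a, b⟫_ℂ ≤ ‖(2⁻¹ : ℂ) • (a + b)‖ ^ 2 := by
  have h1 : ‖a + b‖ ^ 2 = ‖a‖ ^ 2 + 2 * RCLike.re ⟪a, b⟫_ℂ + ‖b‖ ^ 2 := norm_add_sq (𝕜 := ℂ) a b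
  have h2 : ‖a - b‖ ^ 2 = ‖a‖ ^ 2 - 2 * RCLike.re ⟪a, b⟫_ℂ + ‖b‖ ^ 2 := norm_sub_sq (𝕜 := ℂ) a b
  have h3 : ‖(2⁻¹ : ℂ)‖ ^ 2 = 1 / 4 := by norm_num
  rw [norm_smul, mul_pow, h1, h3]
  nlinarith [sq_nonneg ‖a - b‖]

/-- If φ = ⟪ξ, · η⟫ on the amplification, then Ξ = (ξ + η)/2 works: φ(y*y) = ⟪yξ, yη⟫, whose real
part is bounded by `norm_sq_half_add_ge`. -/
theorem IsNormalFunctional.exists_norm_sq_le {N : VonNeumannAlgebra K} {φ : Elem N →ₗ[ℂ] ℂ}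
    (h : IsNormalFunctional N φ) : ∃ Ξ : lp (fun _ : ℕ => K) 2,
      ∀ y : Elem N, (φ (star y * y)).re ≤ ‖diag ℕ (y : K →L[ℂ] K) Ξ‖ ^ 2 := by
  obtain ⟨ξ, η, hξ, hη, hs⟩ := h
  let ξ' : lp (fun _ : ℕ => K) 2 := ⟨ξ, memℓp_two_of_summable hξ⟩
  let η' : lp (fun _ : ℕ => K) 2 := ⟨η, memℓp_two_of_summable hη⟩
  refine ⟨(2⁻¹ : ℂ) • (ξ' + η'), fun y => ?_⟩
  have h1 : φ (star y * y) = ⟪diag ℕ (y : K →L[ℂ] K) ξ', diag ℕ (y : K →L[ℂ] K) η'⟫_ℂ := by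
    have h2 : HasSum (fun n => ⟪diag ℕ (y : K →L[ℂ] K) ξ' n, diag ℕ (y : K →L[ℂ] K) η' n⟫_ℂ)
        ⟪diag ℕ (y : K →L[ℂ] K) ξ', diag ℕ (y : K →L[ℂ] K) η'⟫_ℂ :=
      lp.hasSum_inner (diag ℕ (y : K →L[ℂ] K) ξ') (diag ℕ (y : K →L[ℂ] K) η')
    have h3 : ∀ n, ⟪ξ n, ((star y * y : Elem N) : K →L[ℂ] K) (η n)⟫_ℂ =
        ⟪diag ℕ (y : K →L[ℂ] K) ξ' n, diag ℕ (y : K →L[ℂ] K) η' n⟫_ℂ := fun n =>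
      ContinuousLinearMap.adjoint_inner_right (y : K →L[ℂ] K) (ξ n) ((y : K →L[ℂ] K) (η n))
    exact (hs (star y * y)).unique (h2.congr_fun h3)
  rw [h1, map_smul, map_add]
  exact norm_sq_half_add_ge _ _

/-- The projection onto the closure of `N' η` belongs to `N`. -/
theorem exists_projection_cyclic (N : VonNeumannAlgebra K) (η : K) :
    ∃ p : Elem N, (p : K →L[ℂ] K) η = η ∧ ∀ w : K →L[ℂ] H,
      (∀ s ∈ Set.centralizer (N.toStarSubalgebra : Set (K →L[ℂ] K)), w (s η) = 0) →
        ∀ ζ, w ((p : K →L[ℂ] K) ζ) = 0 := by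
  set S : Set (K →L[ℂ] K) := Set.centralizer (N.toStarSubalgebra : Set (K →L[ℂ] K)) with hS
  set Z : Submodule ℂ K := (Submodule.span ℂ ((fun s : K →L[ℂ] K => s η) '' S)).topologicalClosure
    with hZ
  have hZc : IsClosed (Z : Set K) := Submodule.isClosed_topologicalClosure _
  have : CompleteSpace Z := hZc.completeSpace_coe
  have hstar : ∀ s ∈ S, star s ∈ S := by
    intro s hs y hy
    have := congrArg star (hs _ (star_mem hy))
    rw [star_mul, star_mul, star_star] at this
    exact this.symm
  have hinv : ∀ s ∈ S, ∀ z ∈ Z, s z ∈ Z := by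
    intro s hs
    have : Z ≤ Z.comap (s : K →ₗ[ℂ] K) := by
      refine Submodule.topologicalClosure_minimal _ (Submodule.span_le.mpr ?_)
        (hZc.preimage s.continuous)
      rintro _ ⟨t, ht, rfl⟩
      exact Submodule.le_topologicalClosure _ (Submodule.subset_span
        ⟨s * t, Set.mul_mem_centralizer hs ht, rfl⟩)
    exact this
  have hcomm : ∀ s ∈ S, ∀ v, Z.starProjection (s v) = s (Z.starProjection v) := by
    intro s hs v
    refine (Submodule.eq_starProjection_of_mem_of_inner_eq_zero
      (hinv s hs _ (Z.starProjection_apply_mem v)) fun z hz => ?_)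
    rw [← map_sub, ← ContinuousLinearMap.adjoint_inner_right]
    exact Z.starProjection_inner_eq_zero v _ (hinv _ (hstar s hs) z hz)
  have hp : Z.starProjection ∈ N.toStarSubalgebra := N.centralizer_centralizer'.subset fun s hs =>
    ContinuousLinearMap.ext fun v => (hcomm s hs v).symm
  refine ⟨⟨Z.starProjection, hp⟩, ?_, fun w hw ζ => ?_⟩
  · exact Z.starProjection_eq_self_iff.mpr (Submodule.le_topologicalClosure _
      (Submodule.subset_span ⟨1, Set.one_mem_centralizer, rfl⟩))
  · have hle : Z ≤ LinearMap.ker (w : K →ₗ[ℂ] H) := by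
      refine Submodule.topologicalClosure_minimal _ (Submodule.span_le.mpr ?_) w.isClosed_ker
      rintro _ ⟨s, hs, rfl⟩
      exact hw s hs
    exact hle (Z.starProjection_apply_mem ζ)

variable {G : Type u} [Group G]

/-- Since τ(x*x) = φ(π(x)*π(x)) ≤ ‖π(x)Ξ‖², the map π(x)Ξ ↦ x δ_1 is bounded and extends to Q. The
components of Q are intertwiners for π and their adjoints are intertwiners for π⁻¹; both families of
intertwiners are separating. -/
theorem isSpatial_of_statePreserving {N : VonNeumannAlgebra K} {φ : Elem N →ₗ[ℂ] ℂ}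
    (hφ : IsNormalFunctional N φ) (π : Elem (groupVN G) ≃⋆ₐ[ℂ] Elem N)
    (hπ : ∀ a, φ (π a) = groupTrace G a) :
    IsSpatial π.toStarAlgHom ∧ IsSpatial π.symm.toStarAlgHom := by
  obtain ⟨Ξ, hΞ⟩ := hφ.exists_norm_sq_le
  obtain ⟨Q, hQΞ, hQ⟩ := exists_intertwiner_of_norm_le (f := π.toStarAlgHom) (δ := delta G 1)
    (Ξ := Ξ) fun x => by
      have h1 := hΞ (π x)
      have h2 : star (π x) * π x = π (star x * x) := 
        (congrArg (· * π x) (π.map_star' x).symm).trans (π.map_mul' (star x) x).symm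
      rw [h2, hπ, groupTrace_star_mul, Complex.ofReal_re] at h1
      exact le_of_sq_le_sq h1 (norm_nonneg _)
  have hw : ∀ n, IsIntertwiner π.toStarAlgHom (Q ∘L single n) := fun n x η => by
    change Q (single n ((π.toStarAlgHom x : K →L[ℂ] K) η)) = _
    rw [← diag_single, hQ]
    rfl
  constructor
  -- If all intertwiners kill η, they kill N'η, as composing with N' gives intertwiners again. So Q
  -- vanishes on the range of the projection p ∈ N onto the closure of N'η, which means π⁻¹(p) δ_1 =
  -- 0. Hence p = 0 and η = p η = 0.
  · refine isSpatial_of_separating fun η hη => ?_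
    obtain ⟨p, hpη, hp⟩ := exists_projection_cyclic (H := L2 G) N η
    have h1 : ∀ n ζ, Q (single n ((p : K →L[ℂ] K) ζ)) = 0 := by
      intro n
      refine hp (Q ∘L single n) fun s hs => hη (Q ∘L single n ∘L s) fun x ζ => ?_
      have h2 := DFunLike.congr_fun (hs _ (π.toStarAlgHom x).2) ζ
      change Q (single n ((s * (π.toStarAlgHom x : K →L[ℂ] K)) ζ)) = _
      rw [← h2]
      exact hw n x (s ζ)
    have h2 : π.symm p = 0 := by
      refine groupVN_ext ?_
      have h3 : π.toStarAlgHom (π.symm p) = p := π.apply_symm_apply p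
      have h4 := hQ (π.symm p) Ξ
      rw [hQΞ, h3] at h4
      rw [← h4]
      refine (((hasSum_single (diag ℕ (p : K →L[ℂ] K) Ξ)).mapL Q).unique ?_)
      refine hasSum_zero.congr_fun fun n => ?_
      exact h1 n (Ξ n)
    have h3 : p = 0 := by
      rw [← π.apply_symm_apply p, h2, map_zero]
    rw [← hpη, h3]
    rfl
  -- A vector killed by all the adjoints is orthogonal to the range of Q, which contains every u_g
  -- δ_1 = δ_g.
  · refine isSpatial_of_separating fun ξ hξ => ?_
    have h1 : ∀ n, (Q ∘L single n).adjoint ξ = 0 := fun n => hξ _ fun y ζ => by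
      have h2 := (hw n).adjoint_apply (π.symm y) ζ
      have h3 : π.toStarAlgHom (π.symm y) = y := π.apply_symm_apply y
      rw [h3] at h2
      exact h2
    have h2 : ∀ v, ⟪ξ, Q v⟫_ℂ = 0 := by
      intro v
      have h3 := ((hasSum_single v).mapL Q).mapL (innerSL ℂ ξ)
      refine h3.unique (hasSum_zero.congr_fun fun n => ?_)
      change ⟪ξ, (Q ∘L single n) (v n)⟫_ℂ = 0
      rw [← ContinuousLinearMap.adjoint_inner_left, h1, inner_zero_left]
    refine basis_vec_ext (delta G) fun g => ?_
    have h3 := hQ (canonicalUnitary g) Ξ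
    rw [hQΞ] at h3
    have h4 : (canonicalUnitary g : L2 G →L[ℂ] L2 G) (delta G 1) = delta G g := by
      change leftReg g (delta G 1) = _
      rw [leftReg_apply, mul_one]
    rw [← h4, ← h3, ← inner_conj_symm, h2, map_zero, inner_zero_right]

end StatePreserving

/-! ### Normal maps on triple tensor products -/

section Transport

variable {H : Type*} [NormedAddCommGroup H] [InnerProductSpace ℂ H] [CompleteSpace H]
  {K : Type*} [NormedAddCommGroup K] [InnerProductSpace ℂ K] [CompleteSpace K]
  {L : Type*} [NormedAddCommGroup L] [InnerProductSpace ℂ L] [CompleteSpace L]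
  {E : Type*} [NormedAddCommGroup E] [InnerProductSpace ℂ E] [CompleteSpace E]

theorem IsNormalFunctional.comp_mulRight {M : VonNeumannAlgebra H} {ω : Elem M →ₗ[ℂ] ℂ}
    (h : IsNormalFunctional M ω) (c : Elem M) :
    IsNormalFunctional M (ω ∘ₗ LinearMap.mulRight ℂ c) := by
  obtain ⟨ξ, η, hξ, hη, hs⟩ := h
  refine ⟨ξ, fun n => (c : H →L[ℂ] H) (η n), hξ, ?_, fun x => hs (x * c)⟩
  refine Summable.of_nonneg_of_le (fun _ => by positivity) (fun n => ?_)
    (hη.mul_left (‖(c : H →L[ℂ] H)‖ ^ 2))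
  rw [← mul_pow]
  exact pow_le_pow_left₀ (norm_nonneg _) (ContinuousLinearMap.le_opNorm _ _) 2

theorem tmulLeft_mul_tmul {M : VonNeumannAlgebra H} {N : VonNeumannAlgebra K} (a : Elem M)
    (c : Elem N) : tmulLeft M N a * tmul 1 c = tmul a c := by
  rw [tmulLeft_apply, tmul_mul, mul_one, one_mul]

/-- With c fixed, y ↦ ω(y ⊗ c) = ω((y ⊗ 1)(1 ⊗ c)) is normal, so uniqueness on two legs can be
applied twice. -/
theorem IsNormalFunctional.vnTensor_vnTensor_ext {M : VonNeumannAlgebra H}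
    {N : VonNeumannAlgebra K} {P : VonNeumannAlgebra L}
    {ω ω' : Elem (vnTensor (vnTensor M N) P) →ₗ[ℂ] ℂ} (h : IsNormalFunctional _ ω)
    (h' : IsNormalFunctional _ ω')
    (h0 : ∀ a b c, ω (tmul (tmul a b) c) = ω' (tmul (tmul a b) c)) : ω = ω' := by
  refine IsNormalFunctional.vnTensor_ext h h' fun x c => ?_
  have hn : ∀ {ω : Elem (vnTensor (vnTensor M N) P) →ₗ[ℂ] ℂ}, IsNormalFunctional _ ω →
      IsNormalFunctional _ ((ω ∘ₗ LinearMap.mulRight ℂ (tmul (1 : Elem (vnTensor M N)) c)) ∘ₗ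
        (tmulLeft (vnTensor M N) P).toAlgHom.toLinearMap) := fun hω =>
    isNormalHom_tmulLeft (vnTensor M N) P _ (hω.comp_mulRight _)
  have happ : ∀ (ω : Elem (vnTensor (vnTensor M N) P) →ₗ[ℂ] ℂ) (y : Elem (vnTensor M N)),
      ((ω ∘ₗ LinearMap.mulRight ℂ (tmul (1 : Elem (vnTensor M N)) c)) ∘ₗ
        (tmulLeft (vnTensor M N) P).toAlgHom.toLinearMap) y = ω (tmul y c) := fun ω y =>
    congrArg ω (tmulLeft_mul_tmul y c)
  have h1 := IsNormalFunctional.vnTensor_ext (hn h) (hn h') fun a b => by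
    rw [happ, happ, h0]
  have h2 := DFunLike.congr_fun h1 x
  rwa [happ, happ] at h2

theorem IsNormalHom.vnTensor_vnTensor_ext {M : VonNeumannAlgebra H}
    {N : VonNeumannAlgebra K} {P : VonNeumannAlgebra L} {Q : VonNeumannAlgebra E}
    {f g : Elem (vnTensor (vnTensor M N) P) →⋆ₐ[ℂ] Elem Q} (hf : IsNormalHom f)
    (hg : IsNormalHom g) (h0 : ∀ a b c, f (tmul (tmul a b) c) = g (tmul (tmul a b) c)) :
    ∀ x, f x = g x := by
  intro x
  refine Subtype.ext (ContinuousLinearMap.ext fun η => ext_inner_left ℂ fun ξ => ?_)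
  have h := IsNormalFunctional.vnTensor_vnTensor_ext
    (hf _ (isNormalFunctional_vectorFunctional Q ξ η))
    (hg _ (isNormalFunctional_vectorFunctional Q ξ η)) fun a b c =>
      congrArg (vectorFunctional Q ξ η) (h0 a b c)
  exact DFunLike.congr_fun h x

end Transport

/-! ### Transport of a quantum group structure along an isomorphism -/

section Transport

variable {H : Type*} [NormedAddCommGroup H] [InnerProductSpace ℂ H] [CompleteSpace H]
  {K : Type*} [NormedAddCommGroup K] [InnerProductSpace ℂ K] [CompleteSpace K]
  {M : VonNeumannAlgebra H} {N : VonNeumannAlgebra K}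

/-- The comultiplication `Ψ ∘ Δ ∘ π` on `M`, where `Ψ = π⁻¹ ⊗ π⁻¹`. -/
def transport (ΔN : Elem N →⋆ₐ[ℂ] Elem (vnTensor N N)) (π : Elem M ≃⋆ₐ[ℂ] Elem N)
    (Ψ : Elem (vnTensor N N) →⋆ₐ[ℂ] Elem (vnTensor M M)) : Elem M →⋆ₐ[ℂ] Elem (vnTensor M M) :=
  (Ψ.comp ΔN).comp π.toStarAlgHom

variable {ΔN : Elem N →⋆ₐ[ℂ] Elem (vnTensor N N)} {π : Elem M ≃⋆ₐ[ℂ] Elem N}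
  {Ψ : Elem (vnTensor N N) →⋆ₐ[ℂ] Elem (vnTensor M M)}
  {Φ : Elem (vnTensor M M) →⋆ₐ[ℂ] Elem (vnTensor N N)}

theorem transport_apply (a : Elem M) : transport ΔN π Ψ a = Ψ (ΔN (π a)) := rfl

theorem isNormalHom_transport (hΔ : IsNormalHom ΔN) (hπ : IsSpatial π.toStarAlgHom)
    (hΨ : IsTensorHom π.symm.toStarAlgHom π.symm.toStarAlgHom Ψ) :
    IsNormalHom (transport ΔN π Ψ) :=
  (hΨ.1.comp hΔ).comp hπ.isNormalHom

theorem toStarAlgHom_symm_apply (π : Elem M ≃⋆ₐ[ℂ] Elem N) (a : Elem M) :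
    π.symm.toStarAlgHom (π.toStarAlgHom a) = a := π.symm_apply_apply a

theorem toStarAlgHom_apply_symm (π : Elem M ≃⋆ₐ[ℂ] Elem N) (a : Elem N) :
    π.toStarAlgHom (π.symm.toStarAlgHom a) = a := π.apply_symm_apply a

theorem IsTensorHom.apply_symm_apply
    (hΦ : IsTensorHom π.toStarAlgHom π.toStarAlgHom Φ)
    (hΨ : IsTensorHom π.symm.toStarAlgHom π.symm.toStarAlgHom Ψ) (x : Elem (vnTensor N N)) :
    Φ (Ψ x) = x :=
  (hΦ.comp hΨ).eq_id (toStarAlgHom_apply_symm π) (toStarAlgHom_apply_symm π) x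

theorem isCoassociative_transport (hΔ : IsCoassociative ΔN)
    (hπ : IsSpatial π.toStarAlgHom) (hπ' : IsSpatial π.symm.toStarAlgHom)
    (hΨ : IsTensorHom π.symm.toStarAlgHom π.symm.toStarAlgHom Ψ) (hΨs : IsSpatial Ψ) :
    IsCoassociative (transport ΔN π Ψ) := by
  obtain ⟨Φ, hΦ, -⟩ := hπ.exists_tensor hπ
  obtain ⟨Δl, Δr, as, hl, hr, ⟨has, has'⟩, hco⟩ := hΔ
  obtain ⟨Ψl, hΨl, -⟩ := hΨs.exists_tensor hπ'
  obtain ⟨Ψr, hΨr, -⟩ := hπ'.exists_tensor hΨs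
  obtain ⟨as', hn, hn'⟩ := exists_assoc M M M
  have h1 : ∀ x, (as'.comp Ψl) x = (Ψr.comp as) x :=
    IsNormalHom.vnTensor_vnTensor_ext (hn.comp hΨl.1) (hΨr.1.comp has) fun a b c => by
      simp only [StarAlgHom.comp_apply, hΨl.2, hΨr.2, hΨ.2, hn', has']
  -- With Φ = π ⊗ π inverse to Ψ, the transported Δ ⊗ id is Ψl Δl Φ; the factor Φ Ψ cancels, and h1
  -- moves Ψ past the associativity map.
  refine ⟨(Ψl.comp Δl).comp Φ, (Ψr.comp Δr).comp Φ, as', ⟨(hΨl.1.comp hl.1).comp hΦ.1, ?_⟩,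
    ⟨(hΨr.1.comp hr.1).comp hΦ.1, ?_⟩, ⟨hn, hn'⟩, fun a => ?_⟩
  · intro a b
    simp only [StarAlgHom.comp_apply, hΦ.2, hl.2, hΨl.2, StarAlgHom.coe_id, id_eq,
      toStarAlgHom_symm_apply]
    rfl
  · intro a b
    simp only [StarAlgHom.comp_apply, hΦ.2, hr.2, hΨr.2, StarAlgHom.coe_id, id_eq,
      toStarAlgHom_symm_apply]
    rfl
  · have h2 := h1 (Δl (ΔN (π a)))
    simp only [StarAlgHom.comp_apply] at h2
    simp only [transport_apply, StarAlgHom.comp_apply, hΦ.apply_symm_apply hΨ, h2, hco]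

theorem isHaarState_transport {φ : Elem N →ₗ[ℂ] ℂ} {τ : Elem M →ₗ[ℂ] ℂ} (hφ : IsHaarState ΔN φ)
    (hτ : IsFaithfulNormalState M τ) (hφπ : ∀ a, φ (π a) = τ a)
    (hπ : IsSpatial π.toStarAlgHom) (hπ' : IsSpatial π.symm.toStarAlgHom)
    (hΨ : IsTensorHom π.symm.toStarAlgHom π.symm.toStarAlgHom Ψ) :
    IsHaarState (transport ΔN π Ψ) τ := by
  obtain ⟨Φ, hΦ, -⟩ := hπ.exists_tensor hπ
  obtain ⟨-, R, L, hR, hL, hRL⟩ := hφ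
  have hn : IsNormalMap π.symm.toStarAlgHom.toAlgHom.toLinearMap := hπ'.isNormalHom
  have hnΦ : IsNormalMap Φ.toAlgHom.toLinearMap := hΦ.1
  refine ⟨hτ, π.symm.toStarAlgHom.toAlgHom.toLinearMap ∘ₗ R ∘ₗ Φ.toAlgHom.toLinearMap,
    π.symm.toStarAlgHom.toAlgHom.toLinearMap ∘ₗ L ∘ₗ Φ.toAlgHom.toLinearMap,
    ⟨hn.comp (hR.1.comp hnΦ), fun a b => ?_⟩, ⟨hn.comp (hL.1.comp hnΦ), fun a b => ?_⟩,
    fun a => ⟨?_, ?_⟩⟩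
  · change π.symm (R (Φ (tmul a b))) = τ b • a
    have h1 : Φ (tmul a b) = tmul (π a) (π b) := hΦ.2 a b
    rw [h1, hR.2, hφπ, map_smul, π.symm_apply_apply]
  · change π.symm (L (Φ (tmul a b))) = τ a • b
    have h1 : Φ (tmul a b) = tmul (π a) (π b) := hΦ.2 a b
    rw [h1, hL.2, hφπ, map_smul, π.symm_apply_apply]
  · change π.symm (R (Φ (Ψ (ΔN (π a))))) = τ a • 1
    rw [hΦ.apply_symm_apply hΨ, (hRL _).1, hφπ, map_smul, map_one]
  · change π.symm (L (Φ (Ψ (ΔN (π a))))) = τ a • 1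
    rw [hΦ.apply_symm_apply hΨ, (hRL _).2, hφπ, map_smul, map_one]

theorem transport_equivariant {α : Elem M ≃⋆ₐ[ℂ] Elem M}
    (hα : IsQuantumGroupIso ΔN ΔN ((π.symm.trans α).trans π))
    (hΨ : IsTensorHom π.symm.toStarAlgHom π.symm.toStarAlgHom Ψ)
    {A : Elem (vnTensor M M) →⋆ₐ[ℂ] Elem (vnTensor M M)}
    (hA : IsTensorHom α.toStarAlgHom α.toStarAlgHom A) (a : Elem M) :
    transport ΔN π Ψ (α a) = A (transport ΔN π Ψ a) := by
  obtain ⟨B, hB, hBΔ⟩ := hα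
  have h1 : Ψ.comp B = A.comp Ψ := by
    refine IsNormalHom.vnTensor_ext (hΨ.1.comp hB.1) (hA.1.comp hΨ.1) fun x y => ?_
    simp only [StarAlgHom.comp_apply, hB.2, hΨ.2, hA.2]
    have h2 : ∀ x, π.symm.toStarAlgHom (((π.symm.trans α).trans π).toStarAlgHom x) =
        α.toStarAlgHom (π.symm.toStarAlgHom x) := fun x => π.symm_apply_apply _
    rw [h2, h2]
  have h3 : π (α a) = ((π.symm.trans α).trans π) (π a) := by
    change π (α a) = π (α (π.symm (π a)))
    rw [π.symm_apply_apply]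
  rw [transport_apply, transport_apply, h3, hBΔ]
  exact DFunLike.congr_fun h1 (ΔN (π a))

end Transport

/-! ### Vector functionals on elementary tensors -/

section Tensor

variable {H : Type*} [NormedAddCommGroup H] [InnerProductSpace ℂ H] [CompleteSpace H]
  {K : Type*} [NormedAddCommGroup K] [InnerProductSpace ℂ K] [CompleteSpace K]

theorem vectorFunctional_tmul {M : VonNeumannAlgebra H} {N : VonNeumannAlgebra K} (x : Elem M)
    (y : Elem N) (a a' : H) (b b' : K) :
    vectorFunctional (vnTensor M N) (vtmul a b) (vtmul a' b') (tmul x y) =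
      vectorFunctional M a a' x * vectorFunctional N b b' y := by
  rw [vectorFunctional_apply, coe_tmul, opTensor_vtmul, inner_vtmul]
  rfl

end Tensor

/-! ### Coefficients of a comultiplication on L(G) -/

section Dual

variable {G : Type u} [Group G]

/-- The operators `Δ(u_g)`. -/
def dualOp (Δ : Elem (groupVN G) →⋆ₐ[ℂ] Elem (vnTensor (groupVN G) (groupVN G))) (g : G) :
    HTensor (L2 G) (L2 G) →L[ℂ] HTensor (L2 G) (L2 G) := Δ (canonicalUnitary g)

variable {Δ : Elem (groupVN G) →⋆ₐ[ℂ] Elem (vnTensor (groupVN G) (groupVN G))}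

theorem dualOp_mul (g h : G) : dualOp Δ g * dualOp Δ h = dualOp Δ (g * h) := by
  have := map_mul Δ (canonicalUnitary g) (canonicalUnitary h)
  rw [canonicalUnitary_mul] at this
  exact congrArg Subtype.val this.symm

theorem dualOp_one : dualOp Δ 1 = 1 := by
  have := map_one Δ
  rw [← canonicalUnitary_one] at this
  exact congrArg Subtype.val this

theorem star_dualOp (g : G) : star (dualOp Δ g) = dualOp Δ g⁻¹ := by
  have := map_star Δ (canonicalUnitary g)
  rw [star_canonicalUnitary] at this
  exact congrArg Subtype.val this.symm

theorem commute_rightReg_tensor (x : Elem (vnTensor (groupVN G) (groupVN G))) (g h : G) :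
    Commute (x : HTensor (L2 G) (L2 G) →L[ℂ] HTensor (L2 G) (L2 G))
      (opTensor (rightReg g) (rightReg h)) := by
  have h1 : opTensor (rightReg g) (rightReg h) =
      opTensor (rightReg g) 1 * opTensor 1 (rightReg h) := by
    rw [opTensor_mul, mul_one, one_mul]
  rw [h1]
  exact Commute.mul_right (commute_opTensor_one_of_mem (rightReg_mem_centralizer g) x.2)
    (commute_one_opTensor_of_mem (rightReg_mem_centralizer h) x.2)

theorem vnTensor_groupVN_ext {x y : Elem (vnTensor (groupVN G) (groupVN G))}
    (h : (x : HTensor (L2 G) (L2 G) →L[ℂ] HTensor (L2 G) (L2 G)) (delta2 G (1, 1)) =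
      (y : HTensor (L2 G) (L2 G) →L[ℂ] HTensor (L2 G) (L2 G)) (delta2 G (1, 1))) : x = y := by
  refine Subtype.ext (basis_clm_ext (delta2 G) fun p => ?_)
  have h1 : ∀ z : Elem (vnTensor (groupVN G) (groupVN G)),
      (z : HTensor (L2 G) (L2 G) →L[ℂ] HTensor (L2 G) (L2 G)) (delta2 G p) =
      opTensor (rightReg p.1) (rightReg p.2)
        ((z : HTensor (L2 G) (L2 G) →L[ℂ] HTensor (L2 G) (L2 G)) (delta2 G (1, 1))) := by
    intro z
    rw [← rightReg_tensor_delta2 p, ← mul_apply_eq_comp, (commute_rightReg_tensor z p.1 p.2).eq]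
    rfl
  rw [h1, h1, h]

theorem coef_eq (g h k : G) : coef (dualOp Δ) g h k =
    ⟪vtmul (delta G h) (delta G k), (Δ (canonicalUnitary g) :
      HTensor (L2 G) (L2 G) →L[ℂ] HTensor (L2 G) (L2 G)) (vtmul (delta G 1) (delta G 1))⟫_ℂ := by
  rw [← delta2_apply, ← delta2_apply]
  rfl

/-- The slice map in `IsHaarState` is only characterised abstractly. By uniqueness of normal slices
it is the spatial one, whose matrix entries are the coefficients. -/
theorem coef_dualOp_one_right (hH : IsHaarState Δ (groupTrace G)) {g : G} (hg : g ≠ 1) (h : G) :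
    coef (dualOp Δ) g h 1 = 0 := by
  classical
  obtain ⟨-, R, L, hR, hL, hRL⟩ := hH
  obtain ⟨R', hR', hR'i⟩ := exists_sliceRight (groupVN G) (groupVN G) (delta G 1) (delta G 1)
  rw [← groupTrace_eq_vectorFunctional] at hR'
  have h1 : R' = R := IsNormalMap.vnTensor_ext hR'.1 hR.1 fun a b => by rw [hR'.2, hR.2]
  rw [coef_eq, ← hR'i, h1, (hRL _).1, groupTrace_canonicalUnitary, if_neg hg, zero_smul]
  exact inner_zero_right _

theorem coef_dualOp_one_left (hH : IsHaarState Δ (groupTrace G)) {g : G} (hg : g ≠ 1) (h : G) :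
    coef (dualOp Δ) g 1 h = 0 := by
  classical
  obtain ⟨-, R, L, hR, hL, hRL⟩ := hH
  obtain ⟨L', hL', hL'i⟩ := exists_sliceLeft (groupVN G) (groupVN G) (delta G 1) (delta G 1)
  rw [← groupTrace_eq_vectorFunctional] at hL'
  have h1 : L' = L := IsNormalMap.vnTensor_ext hL'.1 hL.1 fun a b => by rw [hL'.2, hL.2]
  rw [coef_eq, ← hL'i, h1, (hRL _).2, groupTrace_canonicalUnitary, if_neg hg, zero_smul]
  exact inner_zero_right _

theorem orthonormal_dualOp (hH : IsHaarState Δ (groupTrace G)) :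
    Orthonormal ℂ fun g => dualOp Δ g (delta2 G (1, 1)) := by
  classical
  rw [orthonormal_iff_ite]
  intro g h
  rw [← ContinuousLinearMap.adjoint_inner_right, ← ContinuousLinearMap.star_eq_adjoint, star_dualOp,
    ← mul_apply_eq_comp, dualOp_mul]
  by_cases hgh : g = h
  · subst hgh
    rw [inv_mul_cancel, dualOp_one, if_pos rfl]
    exact (basis_inner (delta2 G) _ _).trans (if_pos rfl)
  · rw [if_neg hgh]
    exact coef_dualOp_one_left hH (fun h1 => hgh (inv_mul_eq_one.mp h1)) 1

/-- Both sides are normal in y and agree on the u_g. -/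
theorem apply_eq_isometry (hΔ : IsNormalHom Δ) {T : L2 G →ₗᵢ[ℂ] HTensor (L2 G) (L2 G)}
    (hT : ∀ g, T (delta G g) = dualOp Δ g (delta2 G (1, 1))) (y : Elem (groupVN G)) :
    (Δ y : HTensor (L2 G) (L2 G) →L[ℂ] HTensor (L2 G) (L2 G)) (delta2 G (1, 1)) =
      T ((y : L2 G →L[ℂ] L2 G) (delta G 1)) := by
  refine ext_inner_left ℂ fun v => ?_
  have h1 : vectorFunctional (vnTensor (groupVN G) (groupVN G)) v (delta2 G (1, 1)) ∘ₗ
      Δ.toAlgHom.toLinearMap =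
      vectorFunctional (groupVN G) (T.toContinuousLinearMap.adjoint v) (delta G 1) := by
    refine IsNormalFunctional.ext isStarMonoid_leftReg
      (hΔ _ (isNormalFunctional_vectorFunctional _ _ _))
      (isNormalFunctional_vectorFunctional _ _ _) ?_
    rintro _ ⟨s, rfl⟩
    change ⟪v, dualOp Δ s (delta2 G (1, 1))⟫_ℂ =
      ⟪T.toContinuousLinearMap.adjoint v, leftReg s (delta G 1)⟫_ℂ
    rw [ContinuousLinearMap.adjoint_inner_left, leftReg_apply, mul_one, ← hT]
    rfl
  have h2 := DFunLike.congr_fun h1 y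
  have h3 : ⟪T.toContinuousLinearMap.adjoint v, (y : L2 G →L[ℂ] L2 G) (delta G 1)⟫_ℂ =
      ⟪v, T.toContinuousLinearMap ((y : L2 G →L[ℂ] L2 G) (delta G 1))⟫_ℂ :=
    ContinuousLinearMap.adjoint_inner_left T.toContinuousLinearMap _ v
  exact h2.trans h3

/-- Co-associativity in terms of slices. -/
theorem IsCoassociative.inner_slice_eq {H : Type*} [NormedAddCommGroup H] [InnerProductSpace ℂ H]
    [CompleteSpace H] {M : VonNeumannAlgebra H} {Δ : Elem M →⋆ₐ[ℂ] Elem (vnTensor M M)}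
    (hΔ : IsNormalHom Δ) (h : IsCoassociative Δ) {a b c a' b' c' : H}
    {R L : Elem (vnTensor M M) →ₗ[ℂ] Elem M} (hR : IsSliceRight (vectorFunctional M c c') R)
    (hL : IsSliceLeft (vectorFunctional M a a') L) (y : Elem M) :
    ⟪vtmul a b, (Δ (R (Δ y)) : HTensor H H →L[ℂ] HTensor H H) (vtmul a' b')⟫_ℂ =
      ⟪vtmul b c, (Δ (L (Δ y)) : HTensor H H →L[ℂ] HTensor H H) (vtmul b' c')⟫_ℂ := by
  obtain ⟨Δl, Δr, as, hl, hr, ⟨has, has'⟩, hco⟩ := h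
  have hΔ' : IsNormalMap Δ.toAlgHom.toLinearMap := hΔ
  -- Both quantities are vector functionals of the double comultiplication of y: e1 and e2 express
  -- them through the two bracketings, and e3 matches these through the associativity map.
  have e1 : vectorFunctional (vnTensor (vnTensor M M) M) (vtmul (vtmul a b) c)
      (vtmul (vtmul a' b') c') ∘ₗ Δl.toAlgHom.toLinearMap =
      vectorFunctional (vnTensor M M) (vtmul a b) (vtmul a' b') ∘ₗ
        (Δ.toAlgHom.toLinearMap ∘ₗ R) := by
    refine IsNormalFunctional.vnTensor_ext (hl.1 _ (isNormalFunctional_vectorFunctional _ _ _))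
      ((hΔ'.comp hR.1) _ (isNormalFunctional_vectorFunctional _ _ _)) fun x z => ?_
    have h1 : Δl (tmul x z) = tmul (Δ x) z := hl.2 x z
    have h2 : Δ (R (tmul x z)) = vectorFunctional M c c' z • Δ x := by
      rw [hR.2, map_smul]
    have h3 := (congrArg (vectorFunctional (vnTensor (vnTensor M M) M) (vtmul (vtmul a b) c)
      (vtmul (vtmul a' b') c')) h1).trans (vectorFunctional_tmul (Δ x) z (vtmul a b)
        (vtmul a' b') c c')
    have h4 := (congrArg (vectorFunctional (vnTensor M M) (vtmul a b) (vtmul a' b')) h2).trans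
      (map_smul _ _ _)
    exact h3.trans ((mul_comm _ _).trans h4.symm)
  have e2 : vectorFunctional (vnTensor M (vnTensor M M)) (vtmul a (vtmul b c))
      (vtmul a' (vtmul b' c')) ∘ₗ Δr.toAlgHom.toLinearMap =
      vectorFunctional (vnTensor M M) (vtmul b c) (vtmul b' c') ∘ₗ
        (Δ.toAlgHom.toLinearMap ∘ₗ L) := by
    refine IsNormalFunctional.vnTensor_ext (hr.1 _ (isNormalFunctional_vectorFunctional _ _ _))
      ((hΔ'.comp hL.1) _ (isNormalFunctional_vectorFunctional _ _ _)) fun x z => ?_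
    have h1 : Δr (tmul x z) = tmul x (Δ z) := hr.2 x z
    have h2 : Δ (L (tmul x z)) = vectorFunctional M a a' x • Δ z := by
      rw [hL.2, map_smul]
    have h3 := (congrArg (vectorFunctional (vnTensor M (vnTensor M M)) (vtmul a (vtmul b c))
      (vtmul a' (vtmul b' c'))) h1).trans (vectorFunctional_tmul x (Δ z) a a' (vtmul b c)
        (vtmul b' c'))
    have h4 := (congrArg (vectorFunctional (vnTensor M M) (vtmul b c) (vtmul b' c')) h2).trans
      (map_smul _ _ _)
    exact h3.trans h4.symm
  have e3 : vectorFunctional (vnTensor M (vnTensor M M)) (vtmul a (vtmul b c))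
      (vtmul a' (vtmul b' c')) ∘ₗ as.toAlgHom.toLinearMap =
      vectorFunctional (vnTensor (vnTensor M M) M) (vtmul (vtmul a b) c)
        (vtmul (vtmul a' b') c') := by
    refine IsNormalFunctional.vnTensor_vnTensor_ext
      (has _ (isNormalFunctional_vectorFunctional _ _ _))
      (isNormalFunctional_vectorFunctional _ _ _) fun x z t => ?_
    have h1 := (congrArg (vectorFunctional (vnTensor M (vnTensor M M)) (vtmul a (vtmul b c))
      (vtmul a' (vtmul b' c'))) (has' x z t)).trans (vectorFunctional_tmul x (tmul z t) a a'
        (vtmul b c) (vtmul b' c'))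
    have h2 := vectorFunctional_tmul (tmul x z) t (vtmul a b) (vtmul a' b') c c'
    rw [vectorFunctional_tmul z t] at h1
    rw [vectorFunctional_tmul x z] at h2
    exact h1.trans ((mul_assoc _ _ _).symm.trans h2.symm)
  have e4 : as (Δl (Δ y)) = Δr (Δ y) := hco y
  exact (DFunLike.congr_fun e1 (Δ y)).symm.trans ((DFunLike.congr_fun e3 (Δl (Δ y))).symm.trans
    ((congrArg (vectorFunctional (vnTensor M (vnTensor M M)) (vtmul a (vtmul b c))
      (vtmul a' (vtmul b' c'))) e4).trans (DFunLike.congr_fun e2 (Δ y))))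

theorem coassoc_dualOp (hΔ : IsNormalHom Δ) (hco : IsCoassociative Δ)
    (hH : IsHaarState Δ (groupTrace G)) (g h l m : G) :
    ∃ c, HasSum (fun k => coef (dualOp Δ) g k l * coef (dualOp Δ) k h m) c ∧
      HasSum (fun k => coef (dualOp Δ) g h k * coef (dualOp Δ) k m l) c := by
  obtain ⟨T, hT⟩ := exists_linearIsometry (delta G) (orthonormal_dualOp hH)
  -- R extracts the coefficient of u_l in the last leg, L that of u_h in the first.
  obtain ⟨R, hR, hRi⟩ := exists_sliceRight (groupVN G) (groupVN G) (delta G l) (delta G 1)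
  obtain ⟨L, hL, hLi⟩ := exists_sliceLeft (groupVN G) (groupVN G) (delta G h) (delta G 1)
  have key := hco.inner_slice_eq hΔ (b := delta G m) (b' := delta G 1) hR hL (canonicalUnitary g)
  have h1 := hasSum_inner_isometry hT
    ((R (Δ (canonicalUnitary g)) : L2 G →L[ℂ] L2 G) (delta G 1)) h m
  have h2 := hasSum_inner_isometry hT
    ((L (Δ (canonicalUnitary g)) : L2 G →L[ℂ] L2 G) (delta G 1)) m l
  simp only [hRi, hLi, ← apply_eq_isometry hΔ hT, ← coef_eq] at h1 h2
  simp only [delta2_apply] at h1 h2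
  rw [← key] at h2
  exact ⟨_, h1, h2⟩

end Dual

/-! ### Equivariance and the character of G -/

section Conj

variable {G : Type u} [Group G]

theorem inner_star_apply_left {H : Type*} [NormedAddCommGroup H] [InnerProductSpace ℂ H]
    [CompleteSpace H] (w x : H →L[ℂ] H) (ξ η : H) :
    ⟪(star w) ξ, x η⟫_ℂ = ⟪ξ, (w * x) η⟫_ℂ :=
  ContinuousLinearMap.adjoint_inner_left w (x η) ξ

/-- Conjugation by s is implemented by u_s; it suffices to compare both sides on the u_g by
normality. -/
theorem groupVNAut_conj_mul (s : G) (a : Elem (groupVN G)) :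
    groupVNAut (MulAut.conj s) a * canonicalUnitary s = canonicalUnitary s * a := by
  refine Subtype.ext (ContinuousLinearMap.ext fun η => ext_inner_left ℂ fun ξ => ?_)
  have h1 : vectorFunctional (groupVN G) ξ (leftReg s η) ∘ₗ
      (groupVNAut (MulAut.conj s)).toStarAlgHom.toAlgHom.toLinearMap =
      vectorFunctional (groupVN G) (star (leftReg s) ξ) η := by
    refine IsNormalFunctional.ext isStarMonoid_leftReg
      ((isSpatial_groupVNAut _).isNormalHom _ (isNormalFunctional_vectorFunctional _ _ _))
      (isNormalFunctional_vectorFunctional _ _ _) ?_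
    rintro _ ⟨g, rfl⟩
    change ⟪ξ, (groupVNAut (MulAut.conj s) (canonicalUnitary g) : L2 G →L[ℂ] L2 G)
      (leftReg s η)⟫_ℂ = ⟪star (leftReg s) ξ, leftReg g η⟫_ℂ
    rw [inner_star_apply_left, groupVNAut_canonicalUnitary, leftReg_mul]
    change ⟪ξ, (leftReg (MulAut.conj s g) * leftReg s) η⟫_ℂ = _
    rw [leftReg_mul, MulAut.conj_apply, inv_mul_cancel_right]
  have h2 := DFunLike.congr_fun h1 a
  exact h2.trans (inner_star_apply_left (leftReg s) (a : L2 G →L[ℂ] L2 G) ξ η)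

theorem IsTensorHom.groupVNAut_conj_mul {s : G}
    {A : Elem (vnTensor (groupVN G) (groupVN G)) →⋆ₐ[ℂ] Elem (vnTensor (groupVN G) (groupVN G))}
    (hA : IsTensorHom (groupVNAut (MulAut.conj s)).toStarAlgHom
      (groupVNAut (MulAut.conj s)).toStarAlgHom A) (x : Elem (vnTensor (groupVN G) (groupVN G))) :
    A x * tmul (canonicalUnitary s) (canonicalUnitary s) =
      tmul (canonicalUnitary s) (canonicalUnitary s) * x := by
  refine Subtype.ext (ContinuousLinearMap.ext fun η => ext_inner_left ℂ fun ξ => ?_)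
  have h1 : vectorFunctional (vnTensor (groupVN G) (groupVN G)) ξ
      (opTensor (leftReg s) (leftReg s) η) ∘ₗ A.toAlgHom.toLinearMap =
      vectorFunctional (vnTensor (groupVN G) (groupVN G))
        (star (opTensor (leftReg s) (leftReg s)) ξ) η := by
    refine IsNormalFunctional.vnTensor_ext (hA.1 _ (isNormalFunctional_vectorFunctional _ _ _))
      (isNormalFunctional_vectorFunctional _ _ _) fun a b => ?_
    have h3 : A (tmul a b) * tmul (canonicalUnitary s) (canonicalUnitary s) =
        tmul (canonicalUnitary s) (canonicalUnitary s) * tmul a b := by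
      have h4 : A (tmul a b) = tmul (groupVNAut (MulAut.conj s) a)
        (groupVNAut (MulAut.conj s) b) := hA.2 a b
      rw [h4, tmul_mul, tmul_mul, QGroup.groupVNAut_conj_mul, QGroup.groupVNAut_conj_mul]
    have h5 := congrArg (vectorFunctional (vnTensor (groupVN G) (groupVN G)) ξ η) h3
    exact h5.trans (inner_star_apply_left (opTensor (leftReg s) (leftReg s))
      (tmul a b : Elem (vnTensor (groupVN G) (groupVN G))).1 ξ η).symm
  have h2 := DFunLike.congr_fun h1 x
  exact h2.trans (inner_star_apply_left (opTensor (leftReg s) (leftReg s)) x.1 ξ η)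

variable {Δ : Elem (groupVN G) →⋆ₐ[ℂ] Elem (vnTensor (groupVN G) (groupVN G))}

/-- `Δ` commutes with the automorphism `u_g ↦ u_{θ(g)}` of `L(G)`. -/
def IsEquivariant (Δ : Elem (groupVN G) →⋆ₐ[ℂ] Elem (vnTensor (groupVN G) (groupVN G)))
    (θ : MulAut G) : Prop :=
  ∃ A, IsTensorHom (groupVNAut θ).toStarAlgHom (groupVNAut θ).toStarAlgHom A ∧
    ∀ a, Δ (groupVNAut θ a) = A (Δ a)

theorem isDual_dualOp (hΔ : IsNormalHom Δ) (hco : IsCoassociative Δ)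
    (hH : IsHaarState Δ (groupTrace G)) (hconj : ∀ s : G, IsEquivariant Δ (MulAut.conj s)) :
    IsDual (dualOp Δ) where
  one := dualOp_one
  mul := dualOp_mul
  star_eq := star_dualOp
  commute g x y := commute_rightReg_tensor (Δ (canonicalUnitary g)) x y
  conj s g := by
    obtain ⟨A, hA, hAΔ⟩ := hconj s
    have h1 := hA.groupVNAut_conj_mul (Δ (canonicalUnitary g))
    rw [← hAΔ, groupVNAut_canonicalUnitary, MulAut.conj_apply] at h1
    exact congrArg Subtype.val h1.symm
  coef_one_left g h hg := coef_dualOp_one_left hH hg h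
  coef_one_right g h hg := coef_dualOp_one_right hH hg h
  coassoc := coassoc_dualOp hΔ hco hH

theorem coef_tmul_self (c : ℂ) (g : G) :
    vectorFunctional (vnTensor (groupVN G) (groupVN G)) (vtmul (delta G g) (delta G g))
      (vtmul (delta G 1) (delta G 1)) (c • tmul (canonicalUnitary g) (canonicalUnitary g)) = c := by
  classical
  have h1 : vectorFunctional (groupVN G) (delta G g) (delta G 1) (canonicalUnitary g) = 1 := by
    change ⟪delta G g, leftReg g (delta G 1)⟫_ℂ = 1
    rw [leftReg_apply, mul_one, basis_inner, if_pos rfl]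
  rw [map_smul, vectorFunctional_tmul, h1, mul_one, smul_eq_mul, mul_one]

theorem smul_tmul_self_injective {c c' : ℂ} {g : G}
    (h : c • tmul (canonicalUnitary g) (canonicalUnitary g) =
      c' • tmul (canonicalUnitary g) (canonicalUnitary g)) : c = c' := by
  have h1 := congrArg (vectorFunctional (vnTensor (groupVN G) (groupVN G))
    (vtmul (delta G g) (delta G g)) (vtmul (delta G 1) (delta G 1))) h
  rwa [coef_tmul_self, coef_tmul_self] at h1

theorem IsDual.map_eq_smul (hD : IsDual (dualOp Δ)) (hG : IsICC G) (g : G) :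
    Δ (canonicalUnitary g) =
      coef (dualOp Δ) g g g • tmul (canonicalUnitary g) (canonicalUnitary g) := by
  refine vnTensor_groupVN_ext ?_
  refine (hD.apply_eq_smul hG g).trans ?_
  have h1 : opTensor (leftReg g) (leftReg g) (delta2 G (1, 1)) = delta2 G (g, g) :=
    opTensor_delta2 (by rw [leftReg_apply, mul_one]) (by rw [leftReg_apply, mul_one])
  rw [← h1]
  rfl

theorem IsDual.coef_mul (hD : IsDual (dualOp Δ)) (hG : IsICC G) (g h : G) :
    coef (dualOp Δ) (g * h) (g * h) (g * h) =
      coef (dualOp Δ) g g g * coef (dualOp Δ) h h h := by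
  have h1 := map_mul Δ (canonicalUnitary g) (canonicalUnitary h)
  rw [canonicalUnitary_mul, hD.map_eq_smul hG, hD.map_eq_smul hG, hD.map_eq_smul hG,
    smul_mul_smul_comm, tmul_mul, canonicalUnitary_mul] at h1
  exact smul_tmul_self_injective h1

/-- The diagonal coefficients have modulus one because Δ(u_g) maps δ_1 ⊗ δ_1 to a unit vector; they
are multiplicative because Δ is. -/
theorem IsDual.exists_circle (hD : IsDual (dualOp Δ)) (hG : IsICC G)
    (hH : IsHaarState Δ (groupTrace G)) :
    ∃ χ : G →* Circle, ∀ g, Δ (canonicalUnitary g) =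
      (χ g : ℂ) • tmul (canonicalUnitary g) (canonicalUnitary g) := by
  have hn : ∀ g, ‖coef (dualOp Δ) g g g‖ = 1 := by
    intro g
    have h1 : ‖dualOp Δ g (delta2 G (1, 1))‖ = 1 := (orthonormal_dualOp hH).1 g
    rw [hD.apply_eq_smul hG, norm_smul, (delta2 G).orthonormal.1, mul_one] at h1
    exact h1
  refine ⟨MonoidHom.mk' (fun g => ⟨coef (dualOp Δ) g g g, mem_sphere_zero_iff_norm.mpr (hn g)⟩)
    fun g h => Circle.ext (hD.coef_mul hG g h), hD.map_eq_smul hG⟩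

theorem IsEquivariant.apply_eq {χ : G →* Circle} (hχ : ∀ g, Δ (canonicalUnitary g) =
      (χ g : ℂ) • tmul (canonicalUnitary g) (canonicalUnitary g)) {θ : MulAut G}
    (hθ : IsEquivariant Δ θ) (g : G) : χ (θ g) = χ g := by
  obtain ⟨A, hA, hAΔ⟩ := hθ
  have h1 := hAΔ (canonicalUnitary g)
  have h2 : A (tmul (canonicalUnitary g) (canonicalUnitary g)) =
      tmul (groupVNAut θ (canonicalUnitary g)) (groupVNAut θ (canonicalUnitary g)) := hA.2 _ _
  rw [hχ g, map_smul, h2, groupVNAut_canonicalUnitary, hχ] at h1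
  exact Circle.ext (smul_tmul_self_injective h1)

end Conj

/-! ### Scalars in elementary tensors -/

section Tensor

variable {H : Type*} [NormedAddCommGroup H] [InnerProductSpace ℂ H] [CompleteSpace H]
  {K : Type*} [NormedAddCommGroup K] [InnerProductSpace ℂ K] [CompleteSpace K]

theorem smul_tmul_smul {M : VonNeumannAlgebra H} {N : VonNeumannAlgebra K} (c d : ℂ) (a : Elem M)
    (b : Elem N) : tmul (c • a) (d • b) = (c * d) • tmul a b := by
  refine Subtype.ext (op_ext fun ξ η => vec_ext fun ξ' η' => ?_)
  rw [coe_tmul, coe_smul, coe_smul, coe_smul, coe_tmul, _root_.smul_apply, opTensor_vtmul,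
    opTensor_vtmul, inner_smul_right, inner_vtmul, inner_vtmul, _root_.smul_apply,
    _root_.smul_apply, inner_smul_right, inner_smul_right]
  ring

end Tensor

/-! ### Automorphisms of L(G) given by characters of G -/

section Diagonal

variable {G : Type u}

theorem orthonormal_smul_delta (χ : G → Circle) :
    Orthonormal ℂ fun g => (χ g : ℂ) • delta G g := by
  classical
  rw [orthonormal_iff_ite]
  intro g h
  rw [inner_smul_left, inner_smul_right, basis_inner]
  split_ifs with hgh
  · subst hgh
    rw [mul_one, ← Circle.coe_inv_eq_conj, ← Circle.coe_mul, inv_mul_cancel, Circle.coe_one]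
  · rw [mul_zero, mul_zero]

theorem exists_diagonal (χ : G → Circle) :
    ∃ U : L2 G ≃ₗᵢ[ℂ] L2 G, ∀ g, U (delta G g) = (χ g : ℂ) • delta G g := by
  obtain ⟨T, hT⟩ := exists_linearIsometry (delta G) (orthonormal_smul_delta χ)
  obtain ⟨S, hS⟩ := exists_linearIsometry (delta G) (orthonormal_smul_delta fun g => (χ g)⁻¹)
  have h1 : T.toContinuousLinearMap ∘L S.toContinuousLinearMap = ContinuousLinearMap.id ℂ _ := by
    refine basis_op_ext (delta G) fun g => ?_
    change T (S (delta G g)) = delta G g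
    rw [hS, map_smul, hT, smul_smul, ← Circle.coe_mul, inv_mul_cancel, Circle.coe_one, one_smul]
  exact ⟨LinearIsometryEquiv.ofSurjective T fun y => ⟨S y, DFunLike.congr_fun h1 y⟩, hT⟩

variable [Group G]

theorem conj_diagonal_leftReg {χ : G →* Circle} {U : L2 G ≃ₗᵢ[ℂ] L2 G}
    (hU : ∀ g, U (delta G g) = (χ g : ℂ) • delta G g) (g : G) :
    U.conjStarAlgEquiv (leftReg g) = (χ g : ℂ) • leftReg g := by
  refine basis_op_ext (delta G) fun h => ?_
  have h1 : U.symm (delta G h) = ((χ h)⁻¹ : Circle) • delta G h := by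
    rw [LinearIsometryEquiv.symm_apply_eq]
    have h2 := map_smul U (((χ h)⁻¹ : Circle) : ℂ) (delta G h)
    rw [hU, smul_smul, ← Circle.coe_mul, inv_mul_cancel, Circle.coe_one, one_smul] at h2
    exact h2.symm
  have h3 : leftReg g (((χ h)⁻¹ : Circle) • delta G h) =
      (((χ h)⁻¹ : Circle) : ℂ) • delta G (g * h) := by
    rw [← leftReg_apply]
    exact map_smul (leftReg g) (((χ h)⁻¹ : Circle) : ℂ) (delta G h)
  rw [LinearIsometryEquiv.conjStarAlgEquiv_apply_apply, h1, h3, map_smul, hU, smul_smul,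
    ← Circle.coe_mul, map_mul, mul_comm (χ g), inv_mul_cancel_left]
  change _ = (χ g : ℂ) • leftReg g (delta G h)
  rw [leftReg_apply]

theorem conj_diagonal_mem {χ : G →* Circle} {U : L2 G ≃ₗᵢ[ℂ] L2 G}
    (hU : ∀ g, U (delta G g) = (χ g : ℂ) • delta G g) (x : Elem (groupVN G)) :
    U.conjStarAlgEquiv (x : L2 G →L[ℂ] L2 G) ∈ (groupVN G).toStarSubalgebra := by
  refine map_mem_generated _ ?_ x.2
  rintro _ ⟨g, rfl⟩
  rw [conj_diagonal_leftReg hU]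
  exact ((χ g : ℂ) • canonicalUnitary g).2

theorem exists_diagonal_hom (χ : G →* Circle) :
    ∃ f : Elem (groupVN G) →⋆ₐ[ℂ] Elem (groupVN G), IsSpatial f ∧
      ∀ g, f (canonicalUnitary g) = (χ g : ℂ) • canonicalUnitary g := by
  obtain ⟨U, hU⟩ := exists_diagonal χ
  obtain ⟨f, hf⟩ : ∃ f : Elem (groupVN G) →⋆ₐ[ℂ] Elem (groupVN G),
      ∀ x, (f x : L2 G →L[ℂ] L2 G) = U.conjStarAlgEquiv (x : L2 G →L[ℂ] L2 G) :=
    ⟨StarAlgHom.codRestrict (U.conjStarAlgEquiv.toStarAlgHom.comp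
      (groupVN G).toStarSubalgebra.subtype) _ (conj_diagonal_mem hU), fun x => rfl⟩
  refine ⟨f, isSpatial_of_unitary U fun x η => ?_, fun g => Subtype.ext ?_⟩
  · rw [hf, LinearIsometryEquiv.conjStarAlgEquiv_apply_apply]
  · rw [hf]
    exact conj_diagonal_leftReg hU g

/-- The automorphism `u_g ↦ χ(g) u_g` of `L(G)` given by a character `χ` of `G`. -/
theorem exists_diagonal_aut (χ : G →* Circle) :
    ∃ μ : Elem (groupVN G) ≃⋆ₐ[ℂ] Elem (groupVN G), IsSpatial μ.toStarAlgHom ∧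
      (∀ g, μ (canonicalUnitary g) = (χ g : ℂ) • canonicalUnitary g) ∧
      ∀ g, μ.symm (canonicalUnitary g) = (χ g⁻¹ : ℂ) • canonicalUnitary g := by
  obtain ⟨f, hf, hfu⟩ := exists_diagonal_hom χ
  obtain ⟨f', hf', hfu'⟩ := exists_diagonal_hom χ⁻¹
  have h1 : f.comp f' = StarAlgHom.id ℂ _ := by
    refine IsNormalHom.groupVN_ext (hf.isNormalHom.comp hf'.isNormalHom) (isNormalHom_id _)
      fun g => ?_
    rw [StarAlgHom.comp_apply, hfu', map_smul, hfu, smul_smul, MonoidHom.inv_apply,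
      ← Circle.coe_mul, inv_mul_cancel, Circle.coe_one, one_smul]
    rfl
  have h2 : f'.comp f = StarAlgHom.id ℂ _ := by
    refine IsNormalHom.groupVN_ext (hf'.isNormalHom.comp hf.isNormalHom) (isNormalHom_id _)
      fun g => ?_
    rw [StarAlgHom.comp_apply, hfu, map_smul, hfu', smul_smul, MonoidHom.inv_apply,
      ← Circle.coe_mul, mul_inv_cancel, Circle.coe_one, one_smul]
    rfl
  refine ⟨StarAlgEquiv.ofStarAlgHom f f' h2 h1, hf, hfu, fun g => ?_⟩
  rw [map_inv]
  exact hfu' g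

end Diagonal

/-! ### The coefficient algebra of L(G) is the group algebra -/

section Coefficients

variable {G : Type u} [Group G]

/-- The inclusion of the group algebra in the group von Neumann algebra. -/
def groupAlgebraHom (G : Type u) [Group G] : MonoidAlgebra ℂ G →ₐ[ℂ] Elem (groupVN G) :=
  MonoidAlgebra.lift ℂ (Elem (groupVN G)) G
    { toFun := canonicalUnitary
      map_one' := canonicalUnitary_one
      map_mul' := fun g h => (canonicalUnitary_mul g h).symm }

theorem groupAlgebraHom_of (g : G) :
    groupAlgebraHom G (MonoidAlgebra.of ℂ G g) = canonicalUnitary g :=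
  MonoidAlgebra.lift_of _ _

/-- The Fourier coefficient `⟪δ_g, x δ_1⟫` of `x ∈ L(G)`. -/
def fourier (g : G) : Elem (groupVN G) →ₗ[ℂ] ℂ :=
  vectorFunctional (groupVN G) (delta G g) (delta G 1)

theorem fourier_canonicalUnitary [DecidableEq G] (g h : G) :
    fourier g (canonicalUnitary h) = if g = h then 1 else 0 := by
  change ⟪delta G g, leftReg h (delta G 1)⟫_ℂ = _
  rw [leftReg_apply, mul_one, basis_inner]

theorem fourier_ext {x y : Elem (groupVN G)} (h : ∀ g, fourier g x = fourier g y) : x = y :=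
  groupVN_ext (basis_vec_ext (delta G) h)

theorem fourier_groupAlgebraHom (p : MonoidAlgebra ℂ G) (g : G) :
    fourier g (groupAlgebraHom G p) = p.coeff g := by
  classical
  induction p using MonoidAlgebra.induction_on with
  | of h =>
    rw [groupAlgebraHom_of, fourier_canonicalUnitary, MonoidAlgebra.of_apply]
    simp [Finsupp.single_apply, eq_comm]
  | add x y hx hy => simp [hx, hy]
  | smul r x hx => simp [hx]

theorem injective_groupAlgebraHom : Function.Injective (groupAlgebraHom G) := fun p q h =>
  MonoidAlgebra.ext <| Finsupp.ext fun g => by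
    rw [← fourier_groupAlgebraHom, ← fourier_groupAlgebraHom, h]

/-- Formally Δ_G(x) = ∑ x_g u_g ⊗ u_g, so only diagonal coefficients survive. -/
theorem groupComul_inner [DecidableEq G] (g h : G) (x : Elem (groupVN G)) :
    vectorFunctional (vnTensor (groupVN G) (groupVN G)) (vtmul (delta G g) (delta G h))
      (vtmul (delta G 1) (delta G 1)) (groupComul G x) = if g = h then fourier g x else 0 := by
  have h1 : (groupW G).symm (vtmul (delta G 1) (delta G 1)) = vtmul (delta G 1) (delta G 1) := by
    rw [← delta2_apply, groupW, permUnitary_symm_apply, Equiv.prodShear_symm_apply, delta2_apply]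
    have h4 : (Equiv.mulLeft (1 : G)).symm 1 = 1 := by simp [Equiv.mulLeft]
    rw [delta2_apply]
    exact congrArg (fun k => vtmul (delta G 1) (delta G k)) h4
  have h2 : groupW G (vtmul (delta G g) (delta G (g⁻¹ * h))) = vtmul (delta G g) (delta G h) := by
    rw [← delta2_apply, groupW, permUnitary_apply, ← delta2_apply]
    simp
  have h3 : vectorFunctional (vnTensor (groupVN G) (groupVN G)) (vtmul (delta G g) (delta G h))
      (vtmul (delta G 1) (delta G 1)) (groupComul G x) =
      ⟪vtmul (delta G g) (delta G h), groupW G (amplify (L2 G) (x : L2 G →L[ℂ] L2 G)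
        ((groupW G).symm (vtmul (delta G 1) (delta G 1))))⟫_ℂ := rfl
  rw [h3, h1, ← h2, LinearIsometryEquiv.inner_map_map, amplify_vtmul, inner_vtmul, basis_inner]
  simp only [inv_mul_eq_one]
  split_ifs
  · exact mul_one _
  · exact mul_zero _

variable {n : ℕ} {X : Matrix (Fin n) (Fin n) (Elem (groupVN G))}

theorem IsUnitaryCorep.sum_fourier [DecidableEq G] (hX : IsUnitaryCorep (groupComul G) X)
    (g h : G) (i j : Fin n) :
    ∑ k, fourier g (X i k) * fourier h (X k j) = if g = h then fourier g (X i j) else 0 := by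
  have h1 := congrArg (vectorFunctional (vnTensor (groupVN G) (groupVN G))
    (vtmul (delta G g) (delta G h)) (vtmul (delta G 1) (delta G 1))) (hX.2 i j)
  rw [groupComul_inner, map_sum] at h1
  rw [h1]
  exact Finset.sum_congr rfl fun k _ => (vectorFunctional_tmul _ _ _ _ _ _).symm

/-- The matrices P_g of Fourier coefficients at g are mutually orthogonal idempotents. The nonzero
ones are linearly independent in Mₙ(ℂ), hence finite in number. -/
theorem IsUnitaryCorep.finite_fourier (hX : IsUnitaryCorep (groupComul G) X) :
    {g : G | ∃ i j, fourier g (X i j) ≠ 0}.Finite := by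
  classical
  set P : G → Matrix (Fin n) (Fin n) ℂ := fun g => Matrix.of fun i j => fourier g (X i j) with hP
  have hmul : ∀ g h, P g * P h = if g = h then P g else 0 := by
    intro g h
    ext i j
    rw [Matrix.mul_apply]
    refine (hX.sum_fourier g h i j).trans ?_
    split_ifs <;> rfl
  have hli : LinearIndependent ℂ fun g : {g : G | ∃ i j, fourier g (X i j) ≠ 0} => P g := by
    rw [linearIndependent_iff']
    rintro s c hc ⟨g, i, j, hg⟩ hgs
    have h1 := congrArg (· * P g) hc
    simp only [Finset.sum_mul, smul_mul_assoc, hmul, zero_mul] at h1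
    rw [Finset.sum_eq_single ⟨g, i, j, hg⟩ (fun b _ hb => by
      rw [if_neg fun h => hb (Subtype.ext h), smul_zero]) (fun h => absurd hgs h), if_pos rfl] at h1
    have h2 := congrFun (congrFun h1 i) j
    exact (mul_eq_zero.mp h2).resolve_right hg
  exact Set.finite_coe_iff.mp hli.finite

theorem IsUnitaryCorep.mem_range (hX : IsUnitaryCorep (groupComul G) X) (i j : Fin n) :
    ∃ p : MonoidAlgebra ℂ G, groupAlgebraHom G p = X i j := by
  classical
  have hs := hX.finite_fourier
  refine ⟨∑ g ∈ hs.toFinset, fourier g (X i j) • MonoidAlgebra.of ℂ G g, fourier_ext fun h => ?_⟩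
  simp only [map_sum, map_smul, groupAlgebraHom_of, fourier_canonicalUnitary, smul_eq_mul, mul_ite,
    mul_one, mul_zero, Finset.sum_ite_eq]
  split_ifs with h1
  · rfl
  · by_contra h2
    exact h1 (hs.mem_toFinset.mpr ⟨i, j, fun h3 => h2 h3.symm⟩)

/-- The adjoint is realised inside the group algebra while tracking its value under χ; this supplies
the *-compatibility of the character built from χ. -/
theorem exists_star_groupAlgebraHom (χ : G →* Circle) (p : MonoidAlgebra ℂ G) :
    ∃ q, groupAlgebraHom G q = star (groupAlgebraHom G p) ∧
      MonoidAlgebra.lift ℂ ℂ G (Circle.coeHom.comp χ) q =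
        star (MonoidAlgebra.lift ℂ ℂ G (Circle.coeHom.comp χ) p) := by
  induction p using MonoidAlgebra.induction_on with
  | of h =>
    refine ⟨MonoidAlgebra.of ℂ G h⁻¹, ?_, ?_⟩
    · rw [groupAlgebraHom_of, groupAlgebraHom_of, star_canonicalUnitary]
    · rw [MonoidAlgebra.lift_of, MonoidAlgebra.lift_of]
      change ((χ h⁻¹ : Circle) : ℂ) = star ((χ h : Circle) : ℂ)
      rw [map_inv]
      exact Circle.coe_inv_eq_conj _
  | add x y hx hy =>
    obtain ⟨q, h1, h2⟩ := hx
    obtain ⟨r, h3, h4⟩ := hy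
    exact ⟨q + r, by rw [map_add, map_add, star_add, h1, h3],
      by rw [map_add, map_add, star_add, h2, h4]⟩
  | smul r x hx =>
    obtain ⟨q, h1, h2⟩ := hx
    exact ⟨star r • q, by rw [map_smul, map_smul, star_smul, h1],
      by rw [map_smul, map_smul, star_smul, h2]⟩

theorem isUnitaryCorep_canonicalUnitary (g : G) :
    IsUnitaryCorep (groupComul G) (Matrix.of fun _ _ : Fin 1 => canonicalUnitary g) := by
  refine ⟨?_, fun i j => ?_⟩
  · rw [Unitary.mem_iff]
    constructor
    all_goals
      ext i j : 2
      simp [Matrix.mul_apply, Matrix.star_apply, star_canonicalUnitary, canonicalUnitary_mul,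
        canonicalUnitary_one, Matrix.one_apply, Subsingleton.elim i j]
  · rw [Fintype.sum_unique]
    exact groupComul_canonicalUnitary G g

theorem mem_coeffAlgebra_iff (x : Elem (groupVN G)) :
    x ∈ coeffAlgebra (groupComul G) ↔ ∃ p, groupAlgebraHom G p = x := by
  constructor
  · intro hx
    induction hx using StarAlgebra.adjoin_induction with
    | mem x hx =>
      obtain ⟨n, X, hX, i, j, rfl⟩ := hx
      exact hX.mem_range i j
    | algebraMap r => exact ⟨algebraMap ℂ _ r, AlgHom.commutes _ r⟩
    | add x y _ _ hx hy =>
      obtain ⟨p, rfl⟩ := hx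
      obtain ⟨q, rfl⟩ := hy
      exact ⟨p + q, map_add _ _ _⟩
    | mul x y _ _ hx hy =>
      obtain ⟨p, rfl⟩ := hx
      obtain ⟨q, rfl⟩ := hy
      exact ⟨p * q, map_mul _ _ _⟩
    | star x _ hx =>
      obtain ⟨p, rfl⟩ := hx
      obtain ⟨q, hq, -⟩ := exists_star_groupAlgebraHom 1 p
      exact ⟨q, hq⟩
  · rintro ⟨p, rfl⟩
    induction p using MonoidAlgebra.induction_on with
    | of h =>
      rw [groupAlgebraHom_of]
      exact (isUnitaryCorep_canonicalUnitary h).mem_coeffAlgebra 0 0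
    | add x y hx hy =>
      rw [map_add]
      exact add_mem hx hy
    | smul r x hx =>
      rw [map_smul]
      exact SMulMemClass.smul_mem r hx

/-- The character of `(L(G), Δ_G)` with `u_g ↦ χ(g)`. -/
theorem exists_qChar (χ : G →* Circle) :
    ∃ ω : QChar (groupComul G), ∀ (p : MonoidAlgebra ℂ G)
      (h : groupAlgebraHom G p ∈ coeffAlgebra (groupComul G)),
      ω ⟨groupAlgebraHom G p, h⟩ = MonoidAlgebra.lift ℂ ℂ G (Circle.coeHom.comp χ) p := by
  have hp : ∀ a : coeffAlgebra (groupComul G), ∃ p, groupAlgebraHom G p = (a : Elem (groupVN G)) := fun a =>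
    (mem_coeffAlgebra_iff _).mp a.2
  -- The preimage in the group algebra is unique by injectivity, so the choice is compatible with
  -- all algebra operations.
  choose P hP using hp
  have hP' : ∀ (a : coeffAlgebra (groupComul G)) p, groupAlgebraHom G p =
      (a : Elem (groupVN G)) → P a = p := fun a p h =>
    injective_groupAlgebraHom ((hP a).trans h.symm)
  refine ⟨{ toFun := fun a => MonoidAlgebra.lift ℂ ℂ G (Circle.coeHom.comp χ) (P a)
            map_one' := ?_, map_mul' := ?_, map_zero' := ?_, map_add' := ?_, commutes' := ?_,
            map_star' := ?_ }, fun p h => ?_⟩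
  · rw [hP' 1 1 (map_one _), map_one]
  · intro a b
    rw [hP' (a * b) (P a * P b) (by rw [map_mul, hP, hP]; rfl), map_mul]
  · rw [hP' 0 0 (map_zero _), map_zero]
  · intro a b
    rw [hP' (a + b) (P a + P b) (by rw [map_add, hP, hP]; rfl), map_add]
  · intro r
    rw [hP' (algebraMap ℂ _ r) (algebraMap ℂ _ r) (AlgHom.commutes _ r), AlgHom.commutes]
  · intro a
    obtain ⟨q, hq, hq'⟩ := exists_star_groupAlgebraHom χ (P a)
    change MonoidAlgebra.lift ℂ ℂ G (Circle.coeHom.comp χ) (P (star a)) = _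
    rw [hP' (star a) q (by rw [hq, hP]; rfl), hq']
  · change MonoidAlgebra.lift ℂ ℂ G (Circle.coeHom.comp χ) (P _) = _
    rw [hP' _ p rfl]

end Coefficients

/-! ### The untwisted isomorphism -/

section Iso

variable {G : Type u} [Group G] {K : Type v} [NormedAddCommGroup K] [InnerProductSpace ℂ K]
  [CompleteSpace K] {N : VonNeumannAlgebra K} {ΔN : Elem N →⋆ₐ[ℂ] Elem (vnTensor N N)}
  {π : Elem (groupVN G) ≃⋆ₐ[ℂ] Elem N} {μ : Elem (groupVN G) ≃⋆ₐ[ℂ] Elem (groupVN G)}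
  {Φ : Elem (vnTensor (groupVN G) (groupVN G)) →⋆ₐ[ℂ] Elem (vnTensor N N)}
  {Ψ : Elem (vnTensor N N) →⋆ₐ[ℂ] Elem (vnTensor (groupVN G) (groupVN G))} {χ : G →* Circle}

theorem comul_apply_canonicalUnitary (hΦ : IsTensorHom π.toStarAlgHom π.toStarAlgHom Φ)
    (hΨ : IsTensorHom π.symm.toStarAlgHom π.symm.toStarAlgHom Ψ)
    (hχ : ∀ g, transport ΔN π Ψ (canonicalUnitary g) =
      (χ g : ℂ) • tmul (canonicalUnitary g) (canonicalUnitary g)) (g : G) :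
    ΔN (π (canonicalUnitary g)) =
      (χ g : ℂ) • tmul (π (canonicalUnitary g)) (π (canonicalUnitary g)) := by
  have h1 := hΦ.apply_symm_apply hΨ (ΔN (π (canonicalUnitary g)))
  have h2 : Ψ (ΔN (π (canonicalUnitary g))) =
      (χ g : ℂ) • tmul (canonicalUnitary g) (canonicalUnitary g) := hχ g
  have h3 : Φ (tmul (canonicalUnitary g) (canonicalUnitary g)) =
      tmul (π (canonicalUnitary g)) (π (canonicalUnitary g)) := hΦ.2 _ _
  have h4 := map_smul Φ (χ g : ℂ) (tmul (canonicalUnitary g) (canonicalUnitary g))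
  rw [h3] at h4
  exact h1.symm.trans ((congrArg Φ h2).trans h4)

theorem IsTensorHom.trans {Λ : Elem (vnTensor (groupVN G) (groupVN G)) →⋆ₐ[ℂ]
      Elem (vnTensor (groupVN G) (groupVN G))}
    (hΦ : IsTensorHom π.toStarAlgHom π.toStarAlgHom Φ)
    (hΛ : IsTensorHom μ.toStarAlgHom μ.toStarAlgHom Λ) :
    IsTensorHom (μ.trans π).toStarAlgHom (μ.trans π).toStarAlgHom (Φ.comp Λ) := by
  have h1 : (μ.trans π).toStarAlgHom = π.toStarAlgHom.comp μ.toStarAlgHom :=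
    StarAlgHom.ext fun _ => rfl
  rw [h1]
  exact IsTensorHom.comp hΦ hΛ

theorem trans_canonicalUnitary
    (hμu : ∀ g, μ (canonicalUnitary g) = (χ g : ℂ) • canonicalUnitary g) (g : G) :
    (μ.trans π).toStarAlgHom (canonicalUnitary g) = (χ g : ℂ) • π (canonicalUnitary g) :=
  (congrArg π (hμu g)).trans (π.map_smul' (χ g : ℂ) (canonicalUnitary g))

theorem isQuantumGroupIso_of_canonicalUnitary {ρ : Elem (groupVN G) ≃⋆ₐ[ℂ] Elem N}
    (hΔ : IsNormalHom ΔN) (hρ : IsNormalHom ρ.toStarAlgHom)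
    (hΦ : IsTensorHom ρ.toStarAlgHom ρ.toStarAlgHom Φ)
    (h : ∀ g, ΔN (ρ.toStarAlgHom (canonicalUnitary g)) =
      tmul (ρ.toStarAlgHom (canonicalUnitary g)) (ρ.toStarAlgHom (canonicalUnitary g))) :
    IsQuantumGroupIso (groupComul G) ΔN ρ := by
  have h1 : ΔN.comp ρ.toStarAlgHom = Φ.comp (groupComul G) := by
    refine IsNormalHom.groupVN_ext (hΔ.comp hρ) (hΦ.1.comp isSpatial_groupComul.isNormalHom)
      fun g => (h g).trans ?_
    have h2 := congrArg Φ (groupComul_canonicalUnitary G g)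
    exact (h2.trans (hΦ.2 _ _)).symm
  exact ⟨Φ, hΦ, fun a => DFunLike.congr_fun h1 a⟩

/-- The scalars balance: Δ_N(χ(g) π(u_g)) = χ(g)² π(u_g) ⊗ π(u_g), which is the tensor square of
χ(g) π(u_g). -/
theorem isQuantumGroupIso_trans (hΔ : IsNormalHom ΔN) (hπ : IsSpatial π.toStarAlgHom)
    (hμ : IsSpatial μ.toStarAlgHom) (hΦ : IsTensorHom π.toStarAlgHom π.toStarAlgHom Φ)
    (hΨ : IsTensorHom π.symm.toStarAlgHom π.symm.toStarAlgHom Ψ)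
    (hχ : ∀ g, transport ΔN π Ψ (canonicalUnitary g) =
      (χ g : ℂ) • tmul (canonicalUnitary g) (canonicalUnitary g))
    (hμu : ∀ g, μ (canonicalUnitary g) = (χ g : ℂ) • canonicalUnitary g) :
    IsQuantumGroupIso (groupComul G) ΔN (μ.trans π) := by
  obtain ⟨Λ, hΛ, -⟩ := hμ.exists_tensor hμ
  have hn : IsNormalHom (μ.trans π).toStarAlgHom := hπ.isNormalHom.comp hμ.isNormalHom
  refine isQuantumGroupIso_of_canonicalUnitary hΔ hn (hΦ.trans hΛ) fun g => ?_
  have h4 := map_smul ΔN (χ g : ℂ) (π (canonicalUnitary g))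
  rw [comul_apply_canonicalUnitary hΦ hΨ hχ, smul_smul, ← smul_tmul_smul] at h4
  rw [trans_canonicalUnitary hμu, h4]

end Iso

/-! ### Left translations, invariant characters and strict rigidity -/

section Translation

variable {G : Type u} [Group G]

theorem fourier_apply_groupAlgebraHom {w : G → ℂ} {lam : Elem (groupVN G) ≃⋆ₐ[ℂ] Elem (groupVN G)}
    (hl : ∀ g, lam (canonicalUnitary g) = w g • canonicalUnitary g) (p : MonoidAlgebra ℂ G)
    (g : G) : fourier g (lam (groupAlgebraHom G p)) = w g * fourier g (groupAlgebraHom G p) := by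
  classical
  induction p using MonoidAlgebra.induction_on with
  | of h =>
    rw [groupAlgebraHom_of, hl, map_smul, fourier_canonicalUnitary, smul_eq_mul]
    split_ifs with hgh
    · rw [hgh]
    · rw [mul_zero, mul_zero]
  | add x y hx hy => rw [map_add, map_add, map_add, hx, hy, map_add, mul_add]
  | smul r x hx =>
    rw [map_smul, map_smul, map_smul, hx, map_smul, smul_eq_mul, smul_eq_mul, mul_left_comm]

theorem lift_eq_sum_fourier {w : G →* ℂ} (s : Finset G) (p : MonoidAlgebra ℂ G)
    (h : ∀ g, fourier g (groupAlgebraHom G p) ≠ 0 → g ∈ s) :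
    MonoidAlgebra.lift ℂ ℂ G w p = ∑ g ∈ s, fourier g (groupAlgebraHom G p) * w g := by
  rw [MonoidAlgebra.lift_apply]
  simp only [fourier_groupAlgebraHom] at h ⊢
  exact Finsupp.sum_of_support_subset _ (fun g hg => h g (Finsupp.mem_support_iff.mp hg)) _
    fun g _ => zero_smul _ _

/-- At the Fourier coefficient h, the right side is ∑_g χ(g) (P_g P_h)_{ij}, which orthogonality of
the P_g reduces to χ(h) (P_h)_{ij}. -/
theorem isLeftTranslation_of_apply {χ : G →* Circle} {ω : QChar (groupComul G)}
    (hω : ∀ (p : MonoidAlgebra ℂ G) (h : groupAlgebraHom G p ∈ coeffAlgebra (groupComul G)),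
      ω ⟨groupAlgebraHom G p, h⟩ = MonoidAlgebra.lift ℂ ℂ G (Circle.coeHom.comp χ) p)
    {lam : Elem (groupVN G) ≃⋆ₐ[ℂ] Elem (groupVN G)}
    (hl : ∀ g, lam (canonicalUnitary g) = (χ g : ℂ) • canonicalUnitary g) :
    IsLeftTranslation (groupComul G) ω lam := by
  classical
  intro n X hX i j
  have hs := hX.finite_fourier
  refine fourier_ext fun h => ?_
  have hωX : ∀ k, ω ⟨X i k, hX.mem_coeffAlgebra i k⟩ =
      ∑ g ∈ hs.toFinset, fourier g (X i k) * (χ g : ℂ) := by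
    intro k
    obtain ⟨p, hp⟩ := hX.mem_range i k
    have h1 : (⟨X i k, hX.mem_coeffAlgebra i k⟩ : coeffAlgebra (groupComul G)) =
        ⟨groupAlgebraHom G p, hp.symm ▸ hX.mem_coeffAlgebra i k⟩ := Subtype.ext hp.symm
    rw [h1, hω, lift_eq_sum_fourier hs.toFinset p, hp]
    · rfl
    · intro g hg
      rw [hp] at hg
      exact hs.mem_toFinset.mpr ⟨i, k, hg⟩
  obtain ⟨p, hp⟩ := hX.mem_range i j
  rw [← hp, fourier_apply_groupAlgebraHom hl, hp, map_sum]
  simp only [map_smul, smul_eq_mul, hωX, Finset.sum_mul]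
  rw [Finset.sum_comm]
  have h1 : ∀ g, ∑ k, fourier g (X i k) * (χ g : ℂ) * fourier h (X k j) =
      if g = h then (χ g : ℂ) * fourier g (X i j) else 0 := by
    intro g
    rw [← mul_ite_zero, ← hX.sum_fourier, Finset.mul_sum]
    exact Finset.sum_congr rfl fun k _ => by ring
  simp only [h1, Finset.sum_ite_eq']
  split_ifs with h2
  · rfl
  · by_cases h3 : fourier h (X i j) = 0
    · rw [h3, mul_zero]
    · exact absurd (hs.mem_toFinset.mpr ⟨i, j, h3⟩) h2

theorem isInvariantChar_of_apply {χ : G →* Circle} {ω : QChar (groupComul G)}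
    (hω : ∀ (p : MonoidAlgebra ℂ G) (h : groupAlgebraHom G p ∈ coeffAlgebra (groupComul G)),
      ω ⟨groupAlgebraHom G p, h⟩ = MonoidAlgebra.lift ℂ ℂ G (Circle.coeHom.comp χ) p)
    {θ : MulAut G} (hθ : ∀ g, χ (θ g) = χ g) : IsInvariantChar ω (groupVNAut θ) := by
  rintro ⟨a, ha⟩
  obtain ⟨p, rfl⟩ := (mem_coeffAlgebra_iff a).mp ha
  have h1 : ∃ q, groupAlgebraHom G q = groupVNAut θ (groupAlgebraHom G p) ∧
      MonoidAlgebra.lift ℂ ℂ G (Circle.coeHom.comp χ) q =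
        MonoidAlgebra.lift ℂ ℂ G (Circle.coeHom.comp χ) p := by
    clear ha
    induction p using MonoidAlgebra.induction_on with
    | of h =>
      refine ⟨MonoidAlgebra.of ℂ G (θ h), ?_, ?_⟩
      · rw [groupAlgebraHom_of, groupAlgebraHom_of, groupVNAut_canonicalUnitary]
      · rw [MonoidAlgebra.lift_of, MonoidAlgebra.lift_of]
        exact congrArg Circle.coeHom (hθ h)
    | add x y hx hy =>
      obtain ⟨q, h1, h2⟩ := hx
      obtain ⟨r, h3, h4⟩ := hy
      exact ⟨q + r, by rw [map_add, map_add, map_add, h1, h3], by rw [map_add, map_add, h2, h4]⟩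
    | smul r x hx =>
      obtain ⟨q, h1, h2⟩ := hx
      exact ⟨r • q, by rw [map_smul, map_smul, map_smul, h1], by rw [map_smul, map_smul, h2]⟩
  obtain ⟨q, hq, hq'⟩ := h1
  have hm : groupAlgebraHom G q ∈ coeffAlgebra (groupComul G) :=
    (mem_coeffAlgebra_iff _).mpr ⟨q, rfl⟩
  have h2 : (⟨groupVNAut θ (groupAlgebraHom G p), hq ▸ hm⟩ : coeffAlgebra (groupComul G)) =
      ⟨groupAlgebraHom G q, hm⟩ := Subtype.ext hq.symm
  refine ⟨hq ▸ hm, ?_⟩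
  rw [h2, hω, hq', hω]

theorem isStrictlyRigid_groupVN (hG : IsICC G) (Γ : Subgroup (MulAut G))
    (hΓ : (MulAut.conj : G →* MulAut G).range ≤ Γ) :
    IsStrictlyRigid.{u, v} (groupComul G) (groupTrace G) (Γ.map groupVNAut) := by
  intro K _ _ _ N ΔN φN hN π hφ hα
  obtain ⟨hπ, hπ'⟩ := isSpatial_of_statePreserving hN.isHaarState.1.normal π hφ
  obtain ⟨Ψ, hΨ, hΨs⟩ := hπ'.exists_tensor hπ'
  obtain ⟨Φ, hΦ, -⟩ := hπ.exists_tensor hπ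
  have hΔ := hN.isCompactQuantumGroup.normal
  have hT := isNormalHom_transport hΔ hπ hΨ
  have hH := isHaarState_transport hN.isHaarState isFaithfulNormalState_groupTrace hφ hπ hπ' hΨ
  have hE : ∀ θ ∈ Γ, IsEquivariant (transport ΔN π Ψ) θ := by
    intro θ hθ
    obtain ⟨A, hA, -⟩ := (isSpatial_groupVNAut θ).exists_tensor (isSpatial_groupVNAut θ)
    exact ⟨A, hA, transport_equivariant (hα _ ⟨θ, hθ, rfl⟩) hΨ hA⟩
  have hD := isDual_dualOp hT
    (isCoassociative_transport hN.isCompactQuantumGroup.coassociative hπ hπ' hΨ hΨs) hH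
    fun s => hE _ (hΓ ⟨s, rfl⟩)
  obtain ⟨χ, hχ⟩ := hD.exists_circle hG hH
  obtain ⟨μ, hμ, hμu, hμu'⟩ := exists_diagonal_aut χ
  obtain ⟨ω, hω⟩ := exists_qChar χ⁻¹
  -- π = (π ∘ μ) ∘ μ⁻¹, where μ⁻¹ multiplies u_g by χ(g)⁻¹; this is why ω is built from χ⁻¹.
  refine ⟨μ.trans π, ω, μ.symm, isQuantumGroupIso_trans hΔ hπ hμ hΦ hΨ hχ hμu, ?_, ?_, ?_⟩
  · rintro _ ⟨θ, hθ, rfl⟩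
    refine isInvariantChar_of_apply hω fun g => ?_
    rw [MonoidHom.inv_apply, MonoidHom.inv_apply, (hE θ hθ).apply_eq hχ]
  · refine isLeftTranslation_of_apply hω fun g => ?_
    rw [hμu', MonoidHom.inv_apply, map_inv]
  · intro a
    exact congrArg π (μ.apply_symm_apply a).symm

end Translation

end QGroup

end

theorem mainTheorem4 {G : Type u} [Group G] (hG : QGroup.IsICC G)
    (Γ : Subgroup (MulAut G)) (hΓ_countable : Countable Γ)
    (hΓ_inner : (MulAut.conj : G →* MulAut G).range ≤ Γ) :
    QGroup.IsKacQuantumGroup (QGroup.groupComul G) (QGroup.groupTrace G) ∧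
    (∀ θ ∈ Γ, QGroup.IsQuantumGroupIso (QGroup.groupComul G) (QGroup.groupComul G)
      (QGroup.groupVNAut θ)) ∧
    QGroup.IsStrictlyRigid.{u, v} (QGroup.groupComul G) (QGroup.groupTrace G)
      (Γ.map QGroup.groupVNAut) :=
  ⟨QGroup.isKacQuantumGroup_groupVN, fun θ _ => QGroup.isQuantumGroupIso_groupVNAut θ,
    QGroup.isStrictlyRigid_groupVN hG Γ hΓ_inner⟩
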